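/- There is an absolute constant $C>0$ such that the following holds. Let $m\ge 1$ and $n\ge 0$ be integers, $p\ge 1$ a real number, $c_1,\dots,c_m\ge 0$ opening costs, and let $f:\mathbb{R}_{\ge 0}^m\to\mathbb{R}_{\ge 0}$ be a $p$-bounded convex function, i.e. $f$ is monotone, differentiable and convex, $\nabla f$ is coordinatewise monotone non-decreasing, and $\langle\nabla f(y),y\rangle\le p\,f(y)$ for all $y\in\mathbb{R}_{\ge 0}^m$. In Online Non-metric Facility Location (load balancing with startup costs), $n$ clients arrive one at a time; when client $j$ arrives, its assignment costs $p_{1j},\dots,p_{mj}\ge 0$ are revealed and it must be irrevocably assigned to one facility $\sigma(j)\in\{1,\dots,m\}$. The cost of facility $i$ is $$\Lambda_i(\sigma)=c_i\cdot\mathbf{1}[\exists j:\sigma(j)=i]+\sum_{j:\sigma(j)=i}p_{ij},$$ and the aggregate cost is $f(\Lambda_1(\sigma),\dots,\Lambda_m(\sigma))$. The data $m,n,p,f,c$ are known in advance; the assignment costs are not. Then there is a randomized integral online algorithm such that, for every choice of the assignment costs $(p_{ij})$ (fixed in advance by an oblivious adversary), its random assignment $\sigma$ satisfies $$\mathbb{E}\big[f(\Lambda(\sigma))\big]\le\Big(C\,p^2\,(\max\{1,\log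 m\})^2\,\max\{1,\log n\}\,\max\{1,\log\log n\}\Big)^p\cdot\min_{\tau}f(\Lambda(\tau)),$$ where $\tau$ ranges over all assignments of the $n$ clients to the $m$ facilities (and $\max\{1,\log n\}$, $\max\{1,\log\log n\}$ are read as $1$ when $\log n$, respectively $\log\log n$, is undefined). That is, the algorithm is $O(p^2(\log m)^2\log n\log\log n)^p$-competitive. -/

import Mathlib

open MeasureTheory
open scoped NNReal

noncomputable section

namespace OnlineFL

/-- `p`-bounded aggregate functions on the nonnegative orthant `Set.Ici 0` of `ℝ^m`.
Only the values of `f` on the orthant matter. The orthant is a convex set with nonempty interior,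
so the derivative of `f` within it is unique, and
`fderivWithin ℝ f (Set.Ici 0) x (Pi.single i 1)` is the `i`-th coordinate of `∇ f x`
(a one-sided partial derivative on the faces `x i = 0`). -/
structure PBounded {m : ℕ} (p : ℝ) (f : (Fin m → ℝ) → ℝ) : Prop where
  one_le : 1 ≤ p
  nonneg : ∀ x ∈ Set.Ici (0 : Fin m → ℝ), 0 ≤ f x
  monotone : MonotoneOn f (Set.Ici 0)
  convex : ConvexOn ℝ (Set.Ici 0) f
  differentiable : DifferentiableOn ℝ f (Set.Ici 0)
  /-- the gradient is monotone, coordinate by coordinate -/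
  gradient_monotone : ∀ i : Fin m,
    MonotoneOn (fun x => fderivWithin ℝ f (Set.Ici 0) x (Pi.single i 1)) (Set.Ici 0)
  /-- `⟨∇ f y, y⟩ ≤ p * f y` -/
  inner_gradient_le : ∀ y ∈ Set.Ici (0 : Fin m → ℝ),
    fderivWithin ℝ f (Set.Ici 0) y y ≤ p * f y

/-- The cost at facility `i` when client `j` is assigned to facility `σ j`: the opening cost `c i`,
paid once if some client is assigned to `i`, plus the costs `d j i` of the clients `j`
assigned to `i`. -/
def facilityCost {m n : ℕ} (c : Fin m → ℝ≥0) (d : Fin n → Fin m → ℝ≥0) (σ : Fin n → Fin m) :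
    Fin m → ℝ :=
  fun i => (if ∃ j, σ j = i then (c i : ℝ) else 0) + ∑ j with σ j = i, (d j i : ℝ)

/-- The offline optimum: the least aggregate cost of an assignment of all clients. -/
def opt {m n : ℕ} (f : (Fin m → ℝ) → ℝ) (c : Fin m → ℝ≥0) (d : Fin n → Fin m → ℝ≥0) : ℝ :=
  ⨅ σ : Fin n → Fin m, f (facilityCost c d σ)

/-- A randomized integral online algorithm for `n` clients and `m` facilities: a random
(with seed `ω`) deterministic rule that assigns client `j`, irrevocably, to one facility on the
basis of the assignment costs of the clients `0, …, j` only. -/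
structure OnlineAlgorithm (m n : ℕ) where
  Ω : Type
  [measurableSpace : MeasurableSpace Ω]
  μ : Measure Ω
  [isProbabilityMeasure : IsProbabilityMeasure μ]
  rule : Ω → (j : Fin n) → (Fin (j.val + 1) → Fin m → ℝ≥0) → Fin m
  measurable_rule : ∀ j h, Measurable (fun ω => rule ω j h)

attribute [instance] OnlineAlgorithm.measurableSpace OnlineAlgorithm.isProbabilityMeasure

/-- The (random) assignment that the algorithm produces when the assignment costs are `d`. -/
def OnlineAlgorithm.assignment {m n : ℕ} (A : OnlineAlgorithm m n) (d : Fin n → Fin m → ℝ≥0)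
    (ω : A.Ω) : Fin n → Fin m :=
  fun j => A.rule ω j (fun k => d (Fin.castLE (Nat.succ_le_of_lt j.isLt) k))

/-- The algorithm is `ρ`-competitive (in expectation, against an oblivious adversary) for the
aggregate cost `f` and the opening costs `c`. -/
def OnlineAlgorithm.IsCompetitive {m n : ℕ} (A : OnlineAlgorithm m n) (f : (Fin m → ℝ) → ℝ)
    (c : Fin m → ℝ≥0) (ρ : ℝ) : Prop :=
  ∀ d : Fin n → Fin m → ℝ≥0,
    Integrable (fun ω => f (facilityCost c d (A.assignment d ω))) A.μ ∧
      ∫ ω, f (facilityCost c d (A.assignment d ω)) ∂A.μ ≤ ρ * opt f c d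

end OnlineFL

end

namespace OnlineFL

/-! A `p`-bounded `f` grows with order at most `p`, and its increments increase with the base point.
With convexity this gives a contraction (`Aggregate.increment_le`): `D` times the increment caused
by adding `y` to `x` is at most half of `f x` plus `(4 * p * D) ^ p * f y`. A primal-dual argument
that loses a factor `D` on linear prices thus yields a ratio of the form `O(p * D) ^ p`.

Suppose first that some solution of cost at most a known `B` exists. Each facility is offered at
capacities `u i / 2 ^ k`, where `u i` bounds the load of `i` in every solution of cost at most `B`.
A copy carries its whole capacity as load, and serving a client uses up a fraction of it. The price
of a copy is the expected increase of `f` at the current random load. An update (`exists_isUpdate`)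
raises fractions exponentially until a unit of demand is served, at cost at most twice a dual value;
that value is charged to the resource in the comparison solution, through its assignment rate and
the logarithm of its fraction. Fractions start at `1 / (4 * (m * (m + 1)))`, so each resource is
charged `O(log m)` times its price. Prices only increase, and the contraction absorbs the final
prices.

Rounding happens online: growth by `δ` buys a copy with probability `δ / 2`, independently over
time, so `law` is the true expectation over the copies bought. A copy takes requests at random, as
long as the fraction has not more than doubled since the purchase and the copy is not used up;
Markov's inequality shows that it is still usable with probability at least `1 / 2`. To make failure
rare, a client issues `K = O(p log n)` requests in disjoint layers of resources. For one purchase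
the events of serving these requests are disjoint, and distinct purchases are independent, so all
fail with probability at most `exp (-K / 64)`. A failing client goes to its cheapest facility, and
the probability outweighs the crude factor `n ^ p` in the cost of failures.

Without knowledge of `B`, the optimum of the clients seen so far is rounded up to a power of `2 ^
p`, and each value gets its own run; by weighted convexity the costs of the runs form a geometric
series. If some facility alone never raises `f` above `f 0`, it takes all clients; otherwise a zero
optimum forces zero costs. The ratio reached is `O(p ^ 2 * log m * log n) ^ p` (logarithms truncated
below at `1`), so one factor `log m` and the factor `log log n` of the claim are slack. -/

/-- The derivative-free consequences of `p`-boundedness: growth of order at most `p`, and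
increments that increase with the base point. -/
structure Aggregate {m : ℕ} (p : ℝ) (f : (Fin m → ℝ) → ℝ) : Prop where
  one_le : 1 ≤ p
  nonneg : ∀ x, 0 ≤ x → 0 ≤ f x
  mono : ∀ x y, 0 ≤ x → x ≤ y → f x ≤ f y
  convex : ConvexOn ℝ (Set.Ici 0) f
  continuousOn : ContinuousOn f (Set.Ici 0)
  increment_mono : ∀ x y z, 0 ≤ x → x ≤ y → 0 ≤ z → f (x + z) - f x ≤ f (y + z) - f y
  growth : ∀ (t : ℝ) x, 1 ≤ t → 0 ≤ x → f (t • x) ≤ t ^ p * f x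

/-! ### Growth and monotone increments from `p`-boundedness -/

theorem hasDerivWithinAt_line {m : ℕ} {f : (Fin m → ℝ) → ℝ}
    (hf : DifferentiableOn ℝ f (Set.Ici 0)) {x z : Fin m → ℝ} (hx : 0 ≤ x) (hz : 0 ≤ z)
    {t : ℝ} (ht : 0 ≤ t) :
    HasDerivWithinAt (fun s : ℝ => f (x + s • z))
      (fderivWithin ℝ f (Set.Ici 0) (x + t • z) z) (Set.Ici 0) t := by
  have hmem : ∀ s : ℝ, s ∈ Set.Ici (0 : ℝ) → x + s • z ∈ Set.Ici (0 : Fin m → ℝ) := by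
    intro s hs
    exact add_nonneg hx (smul_nonneg hs hz)
  have h1 := (hf _ (hmem t ht)).hasFDerivWithinAt
  have h2 : HasDerivWithinAt (fun s : ℝ => x + s • z) z (Set.Ici 0) t := by
    have := (((hasDerivAt_id t).smul_const z).const_add x).hasDerivWithinAt (s := Set.Ici 0)
    simpa using this
  exact h1.comp_hasDerivWithinAt t h2 hmem

/-- A derivative in a nonnegative direction is a nonnegative combination of partial derivatives,
each of which is monotone. -/
theorem fderivWithin_apply_mono {m : ℕ} {p : ℝ} {f : (Fin m → ℝ) → ℝ} (hf : PBounded p f)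
    {x y z : Fin m → ℝ} (hx : 0 ≤ x) (hxy : x ≤ y) (hz : 0 ≤ z) :
    fderivWithin ℝ f (Set.Ici 0) x z ≤ fderivWithin ℝ f (Set.Ici 0) y z := by
  have key : ∀ w : Fin m → ℝ, fderivWithin ℝ f (Set.Ici 0) w z
      = ∑ i, z i * fderivWithin ℝ f (Set.Ici 0) w (Pi.single i 1) := by
    intro w
    conv_lhs => rw [pi_eq_sum_univ' z]
    simp [map_sum]
  rw [key, key]
  refine Finset.sum_le_sum fun i _ => mul_le_mul_of_nonneg_left ?_ (hz i)
  exact hf.gradient_monotone i hx (le_trans hx hxy) hxy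

/-- Along the direction `z`, the difference of the values over the base points `y` and `x` has
nonnegative derivative. -/
theorem PBounded.increment_mono {m : ℕ} {p : ℝ} {f : (Fin m → ℝ) → ℝ} (hf : PBounded p f)
    (x y z : Fin m → ℝ) (hx : 0 ≤ x) (hxy : x ≤ y) (hz : 0 ≤ z) :
    f (x + z) - f x ≤ f (y + z) - f y := by
  have hy : 0 ≤ y := hx.trans hxy
  have hd : ∀ t : ℝ, 0 ≤ t → HasDerivWithinAt (fun s : ℝ => f (y + s • z) - f (x + s • z))
      (fderivWithin ℝ f (Set.Ici 0) (y + t • z) z - fderivWithin ℝ f (Set.Ici 0) (x + t • z) z)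
      (Set.Ici 0) t := fun t ht =>
    (hasDerivWithinAt_line hf.differentiable hy hz ht).sub
      (hasDerivWithinAt_line hf.differentiable hx hz ht)
  have hm : MonotoneOn (fun s : ℝ => f (y + s • z) - f (x + s • z)) (Set.Ici 0) := by
    refine monotoneOn_of_hasDerivWithinAt_nonneg (convex_Ici 0)
      (fun t ht => (hd t ht).continuousWithinAt)
      (fun t ht => (hd t (interior_subset ht)).mono interior_subset) ?_
    intro t ht
    have ht' : (0 : ℝ) ≤ t := interior_subset ht
    have h0 : 0 ≤ x + t • z := add_nonneg hx (smul_nonneg ht' hz)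
    exact sub_nonneg.2 (fderivWithin_apply_mono hf h0 (by gcongr) hz)
  have := hm (Set.mem_Ici.2 le_rfl) (Set.mem_Ici.2 zero_le_one) zero_le_one
  simp at this
  linarith

/-- The bound on `⟨∇ f y, y⟩` says that `s ^ (-p) * f (s • x)` has nonpositive derivative. -/
theorem PBounded.growth {m : ℕ} {p : ℝ} {f : (Fin m → ℝ) → ℝ} (hf : PBounded p f)
    (t : ℝ) (x : Fin m → ℝ) (ht : 1 ≤ t) (hx : 0 ≤ x) : f (t • x) ≤ t ^ p * f x := by
  have hd : ∀ s : ℝ, 1 ≤ s → HasDerivWithinAt (fun s : ℝ => s ^ (-p) * f (s • x))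
      ((-p * s ^ (-p - 1)) * f (s • x)
        + s ^ (-p) * fderivWithin ℝ f (Set.Ici 0) (s • x) x) (Set.Ici 1) s := by
    intro s hs
    have h1 := hasDerivWithinAt_line hf.differentiable le_rfl hx (zero_le_one.trans hs)
    simp only [zero_add] at h1
    have h2 := (Real.hasDerivAt_rpow_const (x := s) (p := -p)
      (Or.inl (by linarith))).hasDerivWithinAt (s := Set.Ici 1)
    exact h2.mul (h1.mono (Set.Ici_subset_Ici.2 zero_le_one))
  have hm : AntitoneOn (fun s : ℝ => s ^ (-p) * f (s • x)) (Set.Ici 1) := by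
    refine antitoneOn_of_hasDerivWithinAt_nonpos (convex_Ici 1)
      (fun s hs => (hd s hs).continuousWithinAt)
      (fun s hs => (hd s (interior_subset hs)).mono interior_subset) ?_
    intro s hs
    have hs1 : (1 : ℝ) ≤ s := interior_subset hs
    have hs0 : 0 < s := by linarith
    have h := hf.inner_gradient_le (s • x) (smul_nonneg hs0.le hx)
    rw [map_smul, smul_eq_mul] at h
    have e : s ^ (-p) = s ^ (-p - 1) * s := by
      rw [← Real.rpow_add_one hs0.ne']; ring_nf
    rw [e]
    have hpos : 0 < s ^ (-p - 1) := Real.rpow_pos_of_pos hs0 _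
    nlinarith [mul_le_mul_of_nonneg_left h hpos.le]
  have := hm (Set.mem_Ici.2 le_rfl) (Set.mem_Ici.2 ht) ht
  have ht0 : 0 < t := by linarith
  have hpos : 0 < t ^ p := Real.rpow_pos_of_pos ht0 _
  simp only [Real.one_rpow, one_smul, one_mul, Real.rpow_neg ht0.le] at this
  rwa [inv_mul_le_iff₀ hpos] at this

theorem PBounded.aggregate {m : ℕ} {p : ℝ} {f : (Fin m → ℝ) → ℝ} (hf : PBounded p f) :
    Aggregate p f where
  one_le := hf.one_le
  nonneg := hf.nonneg
  mono _ _ hx hxy := hf.monotone hx (hx.trans hxy) hxy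
  convex := hf.convex
  continuousOn := hf.differentiable.continuousOn
  increment_mono := hf.increment_mono
  growth := hf.growth

/-! ### Inequalities for aggregate functions -/

namespace Aggregate

variable {m : ℕ} {p : ℝ} {f : (Fin m → ℝ) → ℝ}

theorem le_rpow_mul (hf : Aggregate p f) {t : ℝ} {x y : Fin m → ℝ} (ht : 1 ≤ t) (hx : 0 ≤ x)
    (hy : 0 ≤ y) (h : y ≤ t • x) : f y ≤ t ^ p * f x :=
  (hf.mono _ _ hy h).trans (hf.growth t x ht hx)

/-- Convexity with weights `1 - s` and `s` at the dilated points `x / (1 - s)` and `y / s`; growth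
undoes the dilations. -/
theorem add_le (hf : Aggregate p f) {s : ℝ} (hs0 : 0 < s) (hs1 : s < 1) {x y : Fin m → ℝ}
    (hx : 0 ≤ x) (hy : 0 ≤ y) :
    f (x + y) ≤ (1 - s) ^ (1 - p) * f x + s ^ (1 - p) * f y := by
  have h1s : 0 < 1 - s := by linarith
  have aux : ∀ (a : ℝ) (z : Fin m → ℝ), 0 < a → a < 1 → 0 ≤ z →
      a * f (a⁻¹ • z) ≤ a ^ (1 - p) * f z := by
    intro a z ha ha1 hz
    have := hf.growth a⁻¹ z ((one_le_inv₀ ha).2 ha1.le) hz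
    calc a * f (a⁻¹ • z) ≤ a * ((a⁻¹) ^ p * f z) := by gcongr
      _ = a ^ (1 - p) * f z := by
        rw [Real.rpow_sub ha, Real.rpow_one, Real.inv_rpow ha.le]; ring
  have h := hf.convex.2 (x := (1 - s)⁻¹ • x) (y := s⁻¹ • y)
    (smul_nonneg (inv_nonneg.2 h1s.le) hx) (smul_nonneg (inv_nonneg.2 hs0.le) hy)
    h1s.le hs0.le (by ring)
  rw [smul_inv_smul₀ h1s.ne', smul_inv_smul₀ hs0.ne', smul_eq_mul, smul_eq_mul] at h
  linarith [aux (1 - s) x h1s (by linarith) hx, aux s y hs0 hs1 hy]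

/-- An increment only grows when earlier summands are added to the base point. This compares the
separate prices of all facilities of a solution with its load vector as a whole. -/
theorem sum_increment_le (hf : Aggregate p f) {ι : Type*} (I : Finset ι)
    (a : ι → Fin m → ℝ) (ha : ∀ i, 0 ≤ a i) {z : Fin m → ℝ} (hz : 0 ≤ z) :
    ∑ i ∈ I, (f (z + a i) - f z) ≤ f (z + ∑ i ∈ I, a i) - f z := by
  classical
  induction I using Finset.induction_on with
  | empty => simp
  | insert i I hi ih =>
    rw [Finset.sum_insert hi, Finset.sum_insert hi]
    have hs : 0 ≤ ∑ i ∈ I, a i := Finset.sum_nonneg fun i _ => ha i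
    have := hf.increment_mono z (z + ∑ i ∈ I, a i) (a i) hz (le_add_of_nonneg_right hs) (ha i)
    rw [show z + (a i + ∑ i ∈ I, a i) = z + ∑ i ∈ I, a i + a i by abel]
    linarith

/-- Contraction: adding `y` increases `f` by little, relative to `f x`, plus a multiple
of `f y`. -/
theorem increment_le (hf : Aggregate p f) {D : ℝ} (hD : 1 ≤ D) {x y : Fin m → ℝ}
    (hx : 0 ≤ x) (hy : 0 ≤ y) :
    D * (f (x + y) - f x) ≤ f x / 2 + (4 * p * D) ^ p * f y := by
  have hp := hf.one_le
  -- Chosen so that `D * (2 * (p * s)) = 1 / 2`, the coefficient allowed for `f x`.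
  set s : ℝ := 1 / (4 * p * D) with hs
  have hpD : 1 ≤ p * D := one_le_mul_of_one_le_of_one_le hp hD
  have h4 : 0 < 4 * p * D := by nlinarith
  have hs0 : 0 < s := by positivity
  have hps : p * s * (4 * D) = 1 := by rw [hs]; field_simp
  have hps4 : p * s ≤ 1 / 4 := by
    have : 0 ≤ p * s := by positivity
    nlinarith
  have hs1 : s < 1 := by nlinarith
  have h1s : 0 < 1 - s := by linarith
  have hfx := hf.nonneg x hx
  have hfy := hf.nonneg y hy
  have h := hf.add_le hs0 hs1 hx hy
  have hb : (1 - s) ^ (1 - p) ≤ 1 + 2 * (p * s) := by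
    have h1 : 1 - p * s ≤ (1 - s) ^ p := by
      have := one_add_mul_self_le_rpow_one_add (s := -s) (by linarith) hp
      simpa [sub_eq_add_neg] using this
    have h2 : (1 - s) ^ (1 - p) ≤ ((1 - s) ^ p)⁻¹ := by
      rw [← Real.rpow_neg h1s.le]
      exact Real.rpow_le_rpow_of_exponent_ge h1s (by linarith) (by linarith)
    refine h2.trans ?_
    have h3 : 0 < 1 - p * s := by linarith
    calc ((1 - s) ^ p)⁻¹ ≤ (1 - p * s)⁻¹ := inv_anti₀ h3 h1
      _ ≤ 1 + 2 * (p * s) := by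
        rw [inv_le_iff_one_le_mul₀ h3]
        have : 0 ≤ p * s := by positivity
        nlinarith
  have hc : D * s ^ (1 - p) ≤ (4 * p * D) ^ p := by
    have e : s ^ (1 - p) = (4 * p * D) ^ (p - 1) := by
      rw [hs, one_div, Real.inv_rpow h4.le, ← Real.rpow_neg h4.le]; ring_nf
    rw [e]
    calc D * (4 * p * D) ^ (p - 1) ≤ (4 * p * D) * (4 * p * D) ^ (p - 1) := by
          gcongr; nlinarith
      _ = (4 * p * D) ^ p := by
          rw [mul_comm, ← Real.rpow_add_one h4.ne']; ring_nf
  have : D * (f (x + y) - f x) ≤ D * ((2 * (p * s)) * f x + s ^ (1 - p) * f y) := by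
    gcongr
    nlinarith [mul_le_mul_of_nonneg_right hb hfx]
  nlinarith [mul_le_mul_of_nonneg_right hc hfy]

end Aggregate

/-! ### The fractional update -/

/-- The potential that measures multiplicative growth below `1`. -/
noncomputable def logTrunc (y : ℝ) : ℝ := Real.log (min y 1)

theorem logTrunc_mono {a b : ℝ} (ha : 0 < a) (hab : a ≤ b) : logTrunc a ≤ logTrunc b :=
  Real.log_le_log (lt_min ha one_pos) (min_le_min_right _ hab)

theorem logTrunc_nonpos {a : ℝ} (ha : 0 < a) : logTrunc a ≤ 0 :=
  Real.log_nonpos (le_min ha.le zero_le_one) (min_le_right _ _)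

/-- One fractional update: the resources in `A`, with prices `w`, assignment rates `r`
and fractions `y`, serve a unit of demand by `x` after the fractions have grown to `y'`.
The cost is `2 * θ` at most, and `θ` is paid by the potential of every resource in `A`. -/
structure IsUpdate {S : Type*} [Fintype S] (A : Finset S) (w y r x y' : S → ℝ) (θ : ℝ) :
    Prop where
  nonneg : 0 ≤ θ
  x_nonneg : ∀ s, 0 ≤ x s
  x_off : ∀ s, s ∉ A → x s = 0
  sum_x : ∑ s, x s = 1
  x_le : ∀ s, x s ≤ y' s
  le : ∀ s, y s + r s * x s ≤ y' s
  sum_sub_le : ∑ s, (y' s - y s) ≤ 2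
  cost_le : ∑ s, w s * (y' s - y s) ≤ 2 * θ
  le_potential : ∀ s ∈ A, θ ≤ w s * (2 * r s + (logTrunc (y' s) - logTrunc (y s)))

/-- The degree to which a resource of assignment price `c` is used at dual value `θ`. -/
noncomputable def activation (c θ : ℝ) : ℝ := if c = 0 then 1 else max 0 (min 1 (θ / c - 1))

theorem continuous_activation (c : ℝ) : Continuous (activation c) := by
  unfold activation
  split_ifs <;> fun_prop

theorem activation_nonneg (c θ : ℝ) : 0 ≤ activation c θ := by
  unfold activation; split_ifs <;> simp

theorem activation_le_one (c θ : ℝ) : activation c θ ≤ 1 := by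
  unfold activation; split_ifs <;> simp

theorem activation_eq_one {c θ : ℝ} (hc : 0 ≤ c) (h : 2 * c ≤ θ) : activation c θ = 1 := by
  unfold activation
  split_ifs with h0
  · rfl
  · have hc' : 0 < c := lt_of_le_of_ne hc (Ne.symm h0)
    have : 1 ≤ θ / c - 1 := by
      rw [le_sub_iff_add_le, le_div_iff₀ hc']; linarith
    rw [min_eq_left this, max_eq_right zero_le_one]

/-- Below `c` the activation vanishes, so a resource is used only when the dual value pays for its
assignment price. -/
theorem mul_activation_le {c θ : ℝ} (hc : 0 ≤ c) (hθ : 0 ≤ θ) :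
    c * activation c θ ≤ θ * activation c θ := by
  by_cases h : c ≤ θ
  · exact mul_le_mul_of_nonneg_right h (activation_nonneg _ _)
  · have h0 : c ≠ 0 := by rintro rfl; exact h hθ
    have hc' : 0 < c := lt_of_le_of_ne hc (Ne.symm h0)
    have : θ / c - 1 ≤ 0 := by
      rw [sub_nonpos, div_le_one hc']; linarith
    have : activation c θ = 0 := by
      unfold activation
      rw [if_neg h0]
      exact max_eq_left ((min_le_right _ _).trans this)
    simp [this]

/-- Water filling in `θ`: fractions are multiplied by `exp (z θ s)`, and their activated parts serve
the demand. The ramp in `activation` makes the total service `F` continuous, so either `F θ = 1` for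
some `θ`, or `θ = 0` already suffices. Exponential growth costs at most `w * z * y * exp z ≤ θ * g`,
in total `θ`, and the extra growth `r s * x s` costs another `θ`. The offset `2 * r s` in `z`
ensures that a fraction grows exponentially only once its resource is fully activated. -/
theorem exists_isUpdate {S : Type*} [Fintype S] (A : Finset S) (hA : A.Nonempty)
    (w y r : S → ℝ) (hw : ∀ s, 0 < w s) (hy : ∀ s, 0 < y s) (hr : ∀ s, 0 ≤ r s)
    (hr1 : ∀ s, r s ≤ 1) : ∃ x y' θ, IsUpdate A w y r x y' θ := by
  classical
  set z : ℝ → S → ℝ := fun θ s => max (θ / w s - 2 * r s) 0 with hz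
  set g : ℝ → S → ℝ := fun θ s => y s * activation (r s * w s) θ * Real.exp (z θ s) with hg
  set F : ℝ → ℝ := fun θ => ∑ s ∈ A, g θ s with hF
  have hFc : Continuous F := by
    refine continuous_finsetSum _ fun s _ => ?_
    have := continuous_activation (r s * w s)
    simp only [hg, hz]
    fun_prop
  have hg0 : ∀ θ s, 0 ≤ g θ s := fun θ s =>
    mul_nonneg (mul_nonneg (hy s).le (activation_nonneg _ _)) (Real.exp_pos _).le
  have hz0 : ∀ θ s, 0 ≤ z θ s := fun θ s => le_max_right _ _
  have hrw : ∀ s, 0 ≤ r s * w s := fun s => mul_nonneg (hr s) (hw s).le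
  have hzpos : ∀ θ s, 0 < z θ s → g θ s = y s * Real.exp (z θ s) := by
    intro θ s h
    have h1 : 0 < θ / w s - 2 * r s := by
      by_contra hn
      rw [hz] at h
      simp only [max_eq_right (not_lt.1 hn), lt_irrefl] at h
    have h2 : 2 * (r s * w s) ≤ θ := by
      have := (lt_div_iff₀ (hw s)).1 (sub_pos.1 h1)
      linarith
    simp only [hg, activation_eq_one (hrw s) h2, mul_one]
  have hz00 : ∀ s, z 0 s = 0 := fun s => by
    simp only [hz, zero_div, zero_sub]
    exact max_eq_right (by linarith [hr s])
  obtain ⟨θ, hθ0, hF1, hθF⟩ : ∃ θ, 0 ≤ θ ∧ 1 ≤ F θ ∧ (θ = 0 ∨ F θ = 1) := by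
    by_cases h0 : 1 ≤ F 0
    · exact ⟨0, le_rfl, h0, Or.inl rfl⟩
    · obtain ⟨s, hs⟩ := hA
      -- At this value the single resource `s` is fully activated and its fraction is raised to at
      -- least `1`.
      set θ₁ : ℝ := w s * (2 * r s + max 0 (-Real.log (y s))) with hθ₁
      have hm : 0 ≤ max 0 (-Real.log (y s)) := le_max_left _ _
      have hθ₁0 : 0 ≤ θ₁ := mul_nonneg (hw s).le (by linarith [hr s])
      have hb : 1 ≤ F θ₁ := by
        refine le_trans ?_ (Finset.single_le_sum (fun i _ => hg0 θ₁ i) hs)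
        have e1 : activation (r s * w s) θ₁ = 1 := by
          apply activation_eq_one (hrw s)
          rw [hθ₁]; nlinarith [hw s, mul_nonneg (hw s).le hm]
        have e2 : z θ₁ s = max 0 (-Real.log (y s)) := by
          simp only [hz, hθ₁]
          rw [mul_div_cancel_left₀ _ (hw s).ne', add_sub_cancel_left]
          exact max_eq_left hm
        simp only [hg, e1, e2, mul_one]
        calc (1 : ℝ) = y s * Real.exp (-Real.log (y s)) := by
              rw [Real.exp_neg, Real.exp_log (hy s), mul_inv_cancel₀ (hy s).ne']
          _ ≤ _ := by
              have := (hy s).le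
              gcongr
              exact le_max_right _ _
      obtain ⟨θ, hθ, hFθ⟩ := intermediate_value_Icc hθ₁0 hFc.continuousOn
        (show (1 : ℝ) ∈ Set.Icc (F 0) (F θ₁) from ⟨(not_le.1 h0).le, hb⟩)
      exact ⟨θ, hθ.1, hFθ.ge, Or.inr hFθ⟩
  have hFpos : 0 < F θ := by linarith
  -- Normalising by `F θ` is free: `F θ` differs from `1` only when `θ = 0`.
  have hθmul : θ * F θ = θ := by
    rcases hθF with h | h
    · simp [h]
    · simp [h]
  set x : S → ℝ := fun s => if s ∈ A then g θ s / F θ else 0 with hx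
  set y₁ : S → ℝ := fun s => if s ∈ A then y s * Real.exp (z θ s) else y s with hy₁
  have hx0 : ∀ s, 0 ≤ x s := fun s => by
    simp only [hx]; split_ifs
    · exact div_nonneg (hg0 _ _) hFpos.le
    · exact le_rfl
  have hxsum : ∑ s, x s = 1 := by
    simp only [hx, Finset.sum_ite_mem, Finset.univ_inter, ← Finset.sum_div]
    exact div_self hFpos.ne'
  have hxle : ∀ s ∈ A, x s ≤ g θ s := fun s hs => by
    simp only [hx, if_pos hs]
    exact div_le_self (hg0 _ _) hF1
  have hyy₁ : ∀ s, y s ≤ y₁ s := fun s => by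
    simp only [hy₁]; split_ifs
    · exact le_mul_of_one_le_right (hy s).le (Real.one_le_exp (hz0 _ _))
    · exact le_rfl
  have hxy₁ : ∀ s, x s ≤ y₁ s := fun s => by
    by_cases hs : s ∈ A
    · refine (hxle s hs).trans ?_
      simp only [hy₁, if_pos hs, hg]
      have := (Real.exp_pos (z θ s)).le
      have := (hy s).le
      gcongr
      exact mul_le_of_le_one_right this (activation_le_one _ _)
    · simp only [hx, if_neg hs]; exact (hy s).le.trans (hyy₁ s)
  have hwx : ∀ s, w s * (r s * x s) ≤ θ * x s := fun s => by
    by_cases hs : s ∈ A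
    · simp only [hx, if_pos hs, hg]
      have h := mul_activation_le (hrw s) hθ0
      have h2 : 0 ≤ y s * Real.exp (z θ s) / F θ :=
        div_nonneg (mul_nonneg (hy s).le (Real.exp_pos _).le) hFpos.le
      calc _ = (r s * w s * activation (r s * w s) θ) * (y s * Real.exp (z θ s) / F θ) := by ring
        _ ≤ (θ * activation (r s * w s) θ) * (y s * Real.exp (z θ s) / F θ) := by gcongr
        _ = _ := by ring
    · simp [hx, hs]
  have hwz : ∀ s, z θ s = 0 ∨ w s * z θ s ≤ θ := fun s => by
    rcases le_total (θ / w s - 2 * r s) 0 with h | h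
    · left; simp only [hz]; exact max_eq_right h
    · right; simp only [hz]; rw [max_eq_left h, mul_sub, mul_div_cancel₀ _ (hw s).ne']
      nlinarith [hw s, hr s, hrw s]
  have hexp : ∀ t : ℝ, Real.exp t - 1 ≤ t * Real.exp t := fun t => by
    have h1 := Real.add_one_le_exp (-t)
    have h2 := mul_le_mul_of_nonneg_right h1 (Real.exp_pos t).le
    rw [← Real.exp_add] at h2
    simp at h2
    linarith
  have hgrow : ∀ s ∈ A, w s * (y₁ s - y s) ≤ θ * g θ s := fun s hs => by
    simp only [hy₁, if_pos hs]
    rcases (hz0 θ s).eq_or_lt with h | h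
    · rw [← h]; simpa using mul_nonneg hθ0 (hg0 θ s)
    · rw [hzpos θ s h]
      have hle : w s * z θ s ≤ θ := (hwz s).resolve_left h.ne'
      have h3 : 0 ≤ y s * Real.exp (z θ s) := mul_nonneg (hy s).le (Real.exp_pos _).le
      calc w s * (y s * Real.exp (z θ s) - y s) = w s * y s * (Real.exp (z θ s) - 1) := by ring
        _ ≤ w s * y s * (z θ s * Real.exp (z θ s)) := by
            have := mul_nonneg (hw s).le (hy s).le
            gcongr
            exact hexp _
        _ = (w s * z θ s) * (y s * Real.exp (z θ s)) := by ring
        _ ≤ _ := by gcongr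
  have hgrow1 : ∀ s ∈ A, 0 < z θ s → F θ = 1 := fun s _ h => by
    rcases hθF with h0 | h1
    · rw [h0, hz00] at h; exact absurd h (lt_irrefl _)
    · exact h1
  have hoff : ∀ s, s ∉ A → y₁ s - y s = 0 := fun s hs => by simp [hy₁, hs]
  have hsub : ∀ h : S → ℝ, (∑ s, h s * (y₁ s - y s)) = ∑ s ∈ A, h s * (y₁ s - y s) := fun h =>
    (Finset.sum_subset (Finset.subset_univ A) fun s _ hs => by rw [hoff s hs, mul_zero]).symm
  refine ⟨x, fun s => y₁ s + r s * x s, θ, hθ0, hx0, fun s hs => by simp [hx, hs], hxsum,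
    fun s => (hxy₁ s).trans (le_add_of_nonneg_right (mul_nonneg (hr s) (hx0 s))),
    fun s => by simpa using hyy₁ s, ?_, ?_, ?_⟩
  · have h1 : ∑ s, (y₁ s - y s) ≤ 1 := by
      have e := hsub fun _ => 1
      simp only [one_mul] at e
      rw [e]
      by_cases hex : ∃ s ∈ A, 0 < z θ s
      · obtain ⟨s₀, hs₀, h₀⟩ := hex
        rw [← hgrow1 s₀ hs₀ h₀]
        refine Finset.sum_le_sum fun s hs => ?_
        simp only [hy₁, if_pos hs]
        rcases (hz0 θ s).eq_or_lt with h | h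
        · rw [← h]; simpa using hg0 θ s
        · rw [hzpos θ s h]; linarith [hy s]
      · push Not at hex
        refine le_trans (Finset.sum_nonpos fun s hs => ?_) zero_le_one
        have : z θ s = 0 := le_antisymm (hex s hs) (hz0 _ _)
        simp [hy₁, hs, this]
    have h2 : ∑ s, r s * x s ≤ 1 := by
      rw [← hxsum]
      exact Finset.sum_le_sum fun s _ => mul_le_of_le_one_left (hx0 s) (hr1 s)
    calc ∑ s, (y₁ s + r s * x s - y s) = ∑ s, (y₁ s - y s) + ∑ s, r s * x s := by
          rw [← Finset.sum_add_distrib]; exact Finset.sum_congr rfl fun s _ => by ring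
      _ ≤ 2 := by linarith
  · have h1 : ∑ s, w s * (y₁ s - y s) ≤ θ := by
      rw [hsub, ← hθmul, hF, Finset.mul_sum]
      exact Finset.sum_le_sum hgrow
    have h2 : ∑ s, w s * (r s * x s) ≤ θ := by
      calc _ ≤ ∑ s, θ * x s := Finset.sum_le_sum fun s _ => hwx s
        _ = θ := by rw [← Finset.mul_sum, hxsum, mul_one]
    calc ∑ s, w s * (y₁ s + r s * x s - y s)
        = ∑ s, w s * (y₁ s - y s) + ∑ s, w s * (r s * x s) := by
          rw [← Finset.sum_add_distrib]; exact Finset.sum_congr rfl fun s _ => by ring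
      _ ≤ 2 * θ := by linarith
  · intro s hs
    have h1 : θ ≤ w s * (2 * r s + z θ s) := by
      have : θ / w s - 2 * r s ≤ z θ s := le_max_left _ _
      have h2 : θ / w s ≤ 2 * r s + z θ s := by linarith
      rw [div_le_iff₀ (hw s)] at h2
      linarith
    refine h1.trans ?_
    have hle : y₁ s ≤ y₁ s + r s * x s := le_add_of_nonneg_right (mul_nonneg (hr s) (hx0 s))
    have hy₁pos : 0 < y₁ s := (hy s).trans_le (hyy₁ s)
    have : z θ s ≤ logTrunc (y₁ s + r s * x s) - logTrunc (y s) := by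
      rcases (hz0 θ s).eq_or_lt with h | h
      · rw [← h, sub_nonneg]
        exact logTrunc_mono (hy s) ((hyy₁ s).trans hle)
      · have h3 := logTrunc_mono hy₁pos hle
        have e1 : y₁ s = y s * Real.exp (z θ s) := by simp [hy₁, hs]
        -- An exponentially raised fraction is a term of `F θ = 1`, so the truncation in `logTrunc`
        -- is inactive and the potential rises by exactly `z`.
        have h4 : y₁ s ≤ 1 := by
          rw [e1, ← hzpos θ s h, ← hgrow1 s hs h]
          exact Finset.single_le_sum (fun i _ => hg0 θ i) hs
        have h5 : y s ≤ 1 := (hyy₁ s).trans h4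
        have e2 : logTrunc (y₁ s) = logTrunc (y s) + z θ s := by
          unfold logTrunc
          rw [min_eq_left h4, min_eq_left h5, e1, Real.log_mul (hy s).ne' (Real.exp_ne_zero _),
            Real.log_exp]
        linarith
    have := (hw s).le
    gcongr

/-! ### The fractional algorithm and its law -/

/-- A unit of demand, to be served by the resources in `avail`; serving it by `s` uses up the
fraction `rate s` of a copy of `s`. -/
structure Request (S : Type*) where
  avail : Finset S
  rate : S → ℝ
  rate_nonneg : ∀ s, 0 ≤ rate s
  rate_le_one : ∀ s, rate s ≤ 1

/-- The fractions bought so far, and the expectation functional of the random load vector that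
results from buying them at random. -/
structure FracState (m : ℕ) (S : Type*) where
  y : S → ℝ
  law : ((Fin m → ℝ) → ℝ) →ₗ[ℝ] ℝ

/-- The parameters of the fractional algorithm: the aggregate function, the load vector of
a copy of each resource, an additive constant in the prices, and the initial fraction. -/
structure FracParams (m : ℕ) (S : Type*) where
  f : (Fin m → ℝ) → ℝ
  v : S → Fin m → ℝ
  ε : ℝ
  y₀ : ℝ

/-- Standing assumptions on the data of the fractional algorithm. -/
structure FracParams.Valid {m : ℕ} {S : Type*} (P : FracParams m S) (p : ℝ) : Prop where
  aggregate : Aggregate p P.f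
  v_nonneg : ∀ s, 0 ≤ P.v s
  ε_pos : 0 < P.ε
  y₀_pos : 0 < P.y₀
  y₀_le_one : P.y₀ ≤ 1

section FractionalRun

variable {m : ℕ} {S : Type*} [Fintype S]

/-- The price of a copy of `s`: the expected increase of the aggregate cost, plus `ε`. -/
noncomputable def FracParams.price (P : FracParams m S) (st : FracState m S) (s : S) : ℝ :=
  st.law (fun z => P.f (z + P.v s) - P.f z) + P.ε

open Classical in
/-- A choice of an update, consisting of `x`, `y'` and `θ`. -/
noncomputable def update (A : Finset S) (w y r : S → ℝ) : (S → ℝ) × (S → ℝ) × ℝ :=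
  if h : ∃ q : (S → ℝ) × (S → ℝ) × ℝ, IsUpdate A w y r q.1 q.2.1 q.2.2 then h.choose
  else (0, y, 0)

/-- An update step for the current request: fractions, new weights and dual value. -/
noncomputable def FracParams.upd (P : FracParams m S) (st : FracState m S) (q : Request S) :
    (S → ℝ) × (S → ℝ) × ℝ :=
  update q.avail (P.price st) st.y q.rate

/-- Buying `s` with probability half the growth of its fraction changes the law of the load. -/
noncomputable def FracParams.step (P : FracParams m S) (st : FracState m S) (q : Request S) :
    FracState m S where
  y := (P.upd st q).2.1
  law := st.law + ∑ s, (((P.upd st q).2.1 s - st.y s) / 2) •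
    (st.law ∘ₗ LinearMap.funLeft ℝ ℝ (fun z => z + P.v s) - st.law)

/-- The states of the fractional algorithm on the requests `q`. -/
noncomputable def FracParams.process (P : FracParams m S) (q : ℕ → Request S) :
    ℕ → FracState m S
  | 0 => ⟨fun _ => P.y₀, LinearMap.proj 0⟩
  | t + 1 => P.step (P.process q t) (q t)

/-- The weights at time `t`. -/
noncomputable def FracParams.y (P : FracParams m S) (q : ℕ → Request S) (t : ℕ) : S → ℝ :=
  (P.process q t).y

/-- The expectation under the law of the random load at time `t`. -/
noncomputable def FracParams.law (P : FracParams m S) (q : ℕ → Request S) (t : ℕ) :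
    ((Fin m → ℝ) → ℝ) →ₗ[ℝ] ℝ :=
  (P.process q t).law

/-- The fractions of request `t` that the resources serve. -/
noncomputable def FracParams.x (P : FracParams m S) (q : ℕ → Request S) (t : ℕ) : S → ℝ :=
  (P.upd (P.process q t) (q t)).1

/-- The dual value of request `t`. -/
noncomputable def FracParams.dual (P : FracParams m S) (q : ℕ → Request S) (t : ℕ) : ℝ :=
  (P.upd (P.process q t) (q t)).2.2

theorem FracParams.process_congr (P : FracParams m S) {q q' : ℕ → Request S} {t : ℕ}
    (h : ∀ t' < t, q t' = q' t') : P.process q t = P.process q' t := by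
  induction t with
  | zero => rfl
  | succ t ih =>
    rw [process, process, ih fun t' ht' => h t' (by omega), h t (by omega)]

theorem FracParams.x_congr (P : FracParams m S) {q q' : ℕ → Request S} {t : ℕ}
    (h : ∀ t' ≤ t, q t' = q' t') : P.x q t = P.x q' t := by
  rw [x, x, P.process_congr fun t' ht' => h t' ht'.le, h t le_rfl]

theorem FracParams.law_succ (P : FracParams m S) (q : ℕ → Request S) (t : ℕ)
    (φ : (Fin m → ℝ) → ℝ) :
    P.law q (t + 1) φ = P.law q t φ + ∑ s, ((P.y q (t + 1) s - P.y q t s) / 2) *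
      (P.law q t (fun z => φ (z + P.v s)) - P.law q t φ) := by
  simp only [law, y, process, step, LinearMap.add_apply, LinearMap.sum_apply,
    LinearMap.smul_apply, LinearMap.sub_apply, LinearMap.comp_apply, smul_eq_mul]
  rfl

/-- Invariants of the states of the fractional algorithm. -/
structure FracState.Good (st : FracState m S) : Prop where
  y_pos : ∀ s, 0 < st.y s
  mono : ∀ φ ψ : (Fin m → ℝ) → ℝ, (∀ z, 0 ≤ z → φ z ≤ ψ z) → st.law φ ≤ st.law ψ
  one : st.law (fun _ => 1) = 1

omit [Fintype S] in
theorem FracState.Good.law_nonneg {st : FracState m S} (h : st.Good) {φ : (Fin m → ℝ) → ℝ}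
    (hφ : ∀ z, 0 ≤ z → 0 ≤ φ z) : 0 ≤ st.law φ := by
  have := h.mono 0 φ hφ
  simpa using this

omit [Fintype S] in
theorem FracParams.Valid.increment_nonneg {P : FracParams m S} {p : ℝ} (hP : P.Valid p)
    (s : S) {z : Fin m → ℝ} (hz : 0 ≤ z) : 0 ≤ P.f (z + P.v s) - P.f z :=
  sub_nonneg.2 (hP.aggregate.mono _ _ hz (le_add_of_nonneg_right (hP.v_nonneg s)))

omit [Fintype S] in
theorem FracParams.Valid.price_pos {P : FracParams m S} {p : ℝ} (hP : P.Valid p)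
    {st : FracState m S} (h : st.Good) (s : S) : 0 < P.price st s :=
  add_pos_of_nonneg_of_pos (h.law_nonneg fun _ hz => hP.increment_nonneg s hz) hP.ε_pos

theorem FracParams.Valid.upd_isUpdate {P : FracParams m S} {p : ℝ} (hP : P.Valid p)
    {st : FracState m S} (h : st.Good) (q : Request S) (hq : q.avail.Nonempty) :
    IsUpdate q.avail (P.price st) st.y q.rate (P.upd st q).1 (P.upd st q).2.1
      (P.upd st q).2.2 := by
  obtain ⟨x, y', θ, hu⟩ := exists_isUpdate q.avail hq (P.price st) st.y q.rate
    (hP.price_pos h) h.y_pos q.rate_nonneg q.rate_le_one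
  have hex : ∃ u : (S → ℝ) × (S → ℝ) × ℝ,
      IsUpdate q.avail (P.price st) st.y q.rate u.1 u.2.1 u.2.2 := ⟨(x, y', θ), hu⟩
  have e : P.upd st q = hex.choose := by
    rw [upd, update, dif_pos hex]
  rw [e]
  exact hex.choose_spec

/-- Nothing supported on the empty set sums to `1`, so `update` falls back on its default and the
state is unchanged. Time slots without a client are therefore harmless. -/
theorem FracParams.upd_of_empty (P : FracParams m S) (st : FracState m S) (q : Request S)
    (hq : ¬ q.avail.Nonempty) : P.upd st q = (0, st.y, 0) := by
  rw [upd, update, dif_neg]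
  rintro ⟨u, hu⟩
  have h := hu.sum_x
  rw [Finset.not_nonempty_iff_eq_empty] at hq
  rw [Finset.sum_eq_zero fun s _ => hu.x_off s (by simp [hq])] at h
  exact zero_ne_one h

theorem FracParams.Valid.le_upd {P : FracParams m S} {p : ℝ} (hP : P.Valid p)
    {st : FracState m S} (h : st.Good) (q : Request S) (s : S) :
    0 ≤ (P.upd st q).1 s ∧ (P.upd st q).1 s ≤ (P.upd st q).2.1 s ∧
      st.y s + q.rate s * (P.upd st q).1 s ≤ (P.upd st q).2.1 s := by
  by_cases hq : q.avail.Nonempty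
  · have hu := hP.upd_isUpdate h q hq
    exact ⟨hu.x_nonneg s, hu.x_le s, hu.le s⟩
  · rw [P.upd_of_empty st q hq]
    simp [(h.y_pos s).le]

theorem FracParams.Valid.y_le_upd {P : FracParams m S} {p : ℝ} (hP : P.Valid p)
    {st : FracState m S} (h : st.Good) (q : Request S) (s : S) :
    st.y s ≤ (P.upd st q).2.1 s := by
  have h1 := hP.le_upd h q s
  have := mul_nonneg (q.rate_nonneg s) h1.1
  linarith [h1.2.2]

theorem FracParams.Valid.sum_upd_sub_le {P : FracParams m S} {p : ℝ} (hP : P.Valid p)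
    {st : FracState m S} (h : st.Good) (q : Request S) :
    ∑ s, ((P.upd st q).2.1 s - st.y s) ≤ 2 := by
  by_cases hq : q.avail.Nonempty
  · exact (hP.upd_isUpdate h q hq).sum_sub_le
  · rw [P.upd_of_empty st q hq]
    simp

/-- The new law is a mixture of the old law and its shifts, with half the growths as weights of the
shifts. Total growth at most `2` keeps the weight of the old law nonnegative. -/
theorem FracParams.Valid.step_good {P : FracParams m S} {p : ℝ} (hP : P.Valid p)
    {st : FracState m S} (h : st.Good) (q : Request S) : (P.step st q).Good where
  y_pos s := (h.y_pos s).trans_le (hP.y_le_upd h q s)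
  mono φ ψ hφψ := by
    have key : ∀ φ : (Fin m → ℝ) → ℝ, (P.step st q).law φ
        = (1 - ∑ s, ((P.upd st q).2.1 s - st.y s) / 2) * st.law φ
          + ∑ s, ((P.upd st q).2.1 s - st.y s) / 2 * st.law (fun z => φ (z + P.v s)) := by
      intro φ
      have e : (P.step st q).law φ = st.law φ + ∑ s, ((P.upd st q).2.1 s - st.y s) / 2 *
          (st.law (fun z => φ (z + P.v s)) - st.law φ) := by
        simp only [step, LinearMap.add_apply, LinearMap.sum_apply,
          LinearMap.smul_apply, LinearMap.sub_apply, LinearMap.comp_apply, smul_eq_mul]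
        rfl
      simp only [e, mul_sub, Finset.sum_sub_distrib, ← Finset.sum_mul]
      ring
    rw [key, key]
    have h1 : 0 ≤ 1 - ∑ s, ((P.upd st q).2.1 s - st.y s) / 2 := by
      rw [← Finset.sum_div]
      linarith [hP.sum_upd_sub_le h q]
    refine add_le_add (mul_le_mul_of_nonneg_left (h.mono _ _ hφψ) h1)
      (Finset.sum_le_sum fun s _ => mul_le_mul_of_nonneg_left (h.mono _ _ fun z hz =>
        hφψ _ (add_nonneg hz (hP.v_nonneg s))) ?_)
    linarith [hP.y_le_upd h q s]
  one := by
    simp only [step, LinearMap.add_apply, LinearMap.sum_apply,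
      LinearMap.smul_apply, LinearMap.sub_apply, LinearMap.comp_apply, h.one]
    have : ∀ s, (LinearMap.funLeft ℝ ℝ (fun z => z + P.v s)) (fun _ : Fin m → ℝ => (1 : ℝ))
        = fun _ => 1 := fun s => rfl
    simp [this, h.one]

/-! ### Primal-dual analysis -/

namespace FracParams.Valid

variable {P : FracParams m S} {p : ℝ} (hP : P.Valid p) (q : ℕ → Request S)
include hP

theorem good (t : ℕ) : (P.process q t).Good := by
  induction t with
  | zero =>
    exact ⟨fun _ => hP.y₀_pos, fun φ ψ h => h 0 le_rfl, rfl⟩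
  | succ t ih => exact hP.step_good ih (q t)

theorem y_pos (t : ℕ) (s : S) : 0 < P.y q t s := (hP.good q t).y_pos s

theorem x_nonneg (t : ℕ) (s : S) : 0 ≤ P.x q t s := (hP.le_upd (hP.good q t) (q t) s).1

theorem x_le (t : ℕ) (s : S) : P.x q t s ≤ P.y q (t + 1) s :=
  (hP.le_upd (hP.good q t) (q t) s).2.1

theorem rate_mul_x_le (t : ℕ) (s : S) :
    (q t).rate s * P.x q t s ≤ P.y q (t + 1) s - P.y q t s :=
  le_sub_iff_add_le'.2 (hP.le_upd (hP.good q t) (q t) s).2.2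

theorem y_le_succ (t : ℕ) (s : S) : P.y q t s ≤ P.y q (t + 1) s :=
  hP.y_le_upd (hP.good q t) (q t) s

theorem y_mono (s : S) : Monotone fun t => P.y q t s :=
  monotone_nat_of_le_succ fun t => hP.y_le_succ q t s

theorem sum_y_sub_le (t : ℕ) : ∑ s, (P.y q (t + 1) s - P.y q t s) ≤ 2 :=
  hP.sum_upd_sub_le (hP.good q t) (q t)

theorem sum_x (t : ℕ) (h : (q t).avail.Nonempty) : ∑ s ∈ (q t).avail, P.x q t s = 1 := by
  have hu := hP.upd_isUpdate (hP.good q t) (q t) h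
  rw [← hu.sum_x]
  exact Finset.sum_subset (Finset.subset_univ _) fun s _ hs => hu.x_off s hs

/-- A purchase shifts the load upwards, and increments of `f` increase with the base point. -/
theorem price_le_succ (t : ℕ) (s : S) :
    P.price (P.process q t) s ≤ P.price (P.process q (t + 1)) s := by
  refine add_le_add_left ?_ _
  have e := P.law_succ q t (fun z => P.f (z + P.v s) - P.f z)
  simp only [law] at e
  rw [e, le_add_iff_nonneg_right]
  refine Finset.sum_nonneg fun u _ => mul_nonneg ?_ ?_
  · linarith [hP.y_le_succ q t u]
  · rw [sub_nonneg]
    refine (hP.good q t).mono _ _ fun z hz => ?_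
    exact hP.aggregate.increment_mono _ _ _ hz
      (le_add_of_nonneg_right (hP.v_nonneg u)) (hP.v_nonneg s)

theorem price_mono (s : S) : Monotone fun t => P.price (P.process q t) s :=
  monotone_nat_of_le_succ fun t => hP.price_le_succ q t s

/-- Growth turns into a purchase with half its size as probability, so the cost `2 * θ` of an update
becomes `θ`. -/
theorem law_f_succ_le (t : ℕ) : P.law q (t + 1) P.f ≤ P.law q t P.f + P.dual q t := by
  rw [P.law_succ]
  refine add_le_add_right ?_ _
  have h1 : ∀ s, P.law q t (fun z => P.f (z + P.v s)) - P.law q t P.f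
      ≤ P.price (P.process q t) s := by
    intro s
    rw [← map_sub]
    exact le_add_of_nonneg_right hP.ε_pos.le
  have h2 : ∑ s, P.price (P.process q t) s * (P.y q (t + 1) s - P.y q t s)
      ≤ 2 * P.dual q t := by
    by_cases h : (q t).avail.Nonempty
    · exact (hP.upd_isUpdate (hP.good q t) (q t) h).cost_le
    · have e := P.upd_of_empty (P.process q t) (q t) h
      simp [y, dual, process, step, e]
  calc _ ≤ ∑ s, (P.y q (t + 1) s - P.y q t s) / 2 * P.price (P.process q t) s := by
        refine Finset.sum_le_sum fun s _ => mul_le_mul_of_nonneg_left (h1 s) ?_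
        linarith [hP.y_le_succ q t s]
    _ = (∑ s, P.price (P.process q t) s * (P.y q (t + 1) s - P.y q t s)) / 2 := by
        rw [Finset.sum_div]; exact Finset.sum_congr rfl fun s _ => by ring
    _ ≤ _ := by linarith

/-- The dual value of request `t` is charged to `σ t`, at the final price, which is the largest. For
a resource in `O` the rates add up to at most `1`, and the truncated logarithms telescope from `log
y₀` to something nonpositive. -/
theorem law_f_le_sum_price [DecidableEq S] (T : ℕ) (σ : ℕ → S) (O : Finset S)
    (hσ : ∀ t < T, (q t).avail.Nonempty → σ t ∈ (q t).avail ∧ σ t ∈ O)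
    (hO : ∀ s ∈ O, ∑ t ∈ Finset.range T,
      (if (q t).avail.Nonempty ∧ σ t = s then (q t).rate s else 0) ≤ 1) :
    P.law q T P.f ≤ P.f 0
      + ∑ s ∈ O, P.price (P.process q T) s * (2 - Real.log P.y₀) := by
  set w : S → ℝ := fun s => P.price (P.process q T) s
  have hw : ∀ s, 0 ≤ w s := fun s => (hP.price_pos (hP.good q T) s).le
  set a : ℕ → S → ℝ := fun t s =>
    if (q t).avail.Nonempty ∧ σ t = s then (q t).rate s else 0 with ha
  have ha0 : ∀ t s, 0 ≤ a t s := fun t s => by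
    simp only [ha]; split_ifs
    · exact (q t).rate_nonneg s
    · exact le_rfl
  have hψ : ∀ t s, 0 ≤ logTrunc (P.y q (t + 1) s) - logTrunc (P.y q t s) := fun t s =>
    sub_nonneg.2 (logTrunc_mono (hP.y_pos q t s) (hP.y_le_succ q t s))
  have hdual : ∀ t < T, P.dual q t ≤ ∑ s ∈ O, w s *
      (2 * a t s + (logTrunc (P.y q (t + 1) s) - logTrunc (P.y q t s))) := by
    intro t ht
    have hn : ∀ s ∈ O, 0 ≤ w s *
      (2 * a t s + (logTrunc (P.y q (t + 1) s) - logTrunc (P.y q t s))) := fun s _ =>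
      mul_nonneg (hw s) (by linarith [ha0 t s, hψ t s])
    by_cases h : (q t).avail.Nonempty
    · obtain ⟨h1, h2⟩ := hσ t ht h
      have hu := (hP.upd_isUpdate (hP.good q t) (q t) h).le_potential _ h1
      refine le_trans ?_ (Finset.single_le_sum hn h2)
      have e : a t (σ t) = (q t).rate (σ t) := by simp [ha, h]
      rw [e]
      refine hu.trans (mul_le_mul_of_nonneg_right (hP.price_mono q (σ t) ht.le) ?_)
      have := (q t).rate_nonneg (σ t)
      have := hψ t (σ t)
      have h3 : 0 ≤ logTrunc (P.y q (t + 1) (σ t)) - logTrunc (P.y q t (σ t)) := this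
      simp only [y, process, step] at h3
      linarith
    · have e := P.upd_of_empty (P.process q t) (q t) h
      have : P.dual q t = 0 := by simp [dual, e]
      rw [this]
      exact Finset.sum_nonneg hn
  have hsum : ∀ t ≤ T, P.law q t P.f ≤ P.f 0 + ∑ t' ∈ Finset.range t, P.dual q t' := by
    intro t
    induction t with
    | zero => intro _; simp [law, process]
    | succ t ih =>
      intro ht
      rw [Finset.sum_range_succ]
      linarith [ih (by omega), hP.law_f_succ_le q t]
  refine (hsum T le_rfl).trans (add_le_add_right ?_ _)
  calc ∑ t ∈ Finset.range T, P.dual q t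
      ≤ ∑ t ∈ Finset.range T, ∑ s ∈ O, w s *
        (2 * a t s + (logTrunc (P.y q (t + 1) s) - logTrunc (P.y q t s))) :=
        Finset.sum_le_sum fun t ht => hdual t (Finset.mem_range.1 ht)
    _ = ∑ s ∈ O, w s * (2 * ∑ t ∈ Finset.range T, a t s
        + (logTrunc (P.y q T s) - logTrunc (P.y q 0 s))) := by
        rw [Finset.sum_comm]
        refine Finset.sum_congr rfl fun s _ => ?_
        rw [← Finset.mul_sum, Finset.sum_add_distrib, ← Finset.mul_sum,
          Finset.sum_range_sub (fun t => logTrunc (P.y q t s))]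
    _ ≤ _ := by
        refine Finset.sum_le_sum fun s hs => mul_le_mul_of_nonneg_left ?_ (hw s)
        have h1 := hO s hs
        have h2 := logTrunc_nonpos (hP.y_pos q T s)
        have h3 : logTrunc (P.y q 0 s) = Real.log P.y₀ := by
          simp only [y, process, logTrunc]
          rw [min_eq_left hP.y₀_le_one]
        rw [h3]
        linarith

/-- The fractional algorithm is competitive against the choice `σ` of resources, one copy of
each resource in `O`, when `K` copies of the load vector `l` account for the copies in `O`. -/
theorem law_f_le [DecidableEq S] (T : ℕ) (σ : ℕ → S) (O : Finset S)
    (hσ : ∀ t < T, (q t).avail.Nonempty → σ t ∈ (q t).avail ∧ σ t ∈ O)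
    (hO : ∀ s ∈ O, ∑ t ∈ Finset.range T,
      (if (q t).avail.Nonempty ∧ σ t = s then (q t).rate s else 0) ≤ 1)
    {K B : ℝ} (hK : 1 ≤ K) {l : Fin m → ℝ} (hl : 0 ≤ l)
    (hOl : ∀ z, 0 ≤ z → ∑ s ∈ O, (P.f (z + P.v s) - P.f z) ≤ K * (P.f (z + l) - P.f z))
    (hOB : O.card * P.ε ≤ K * B) :
    P.law q T P.f ≤ 2 * P.f 0 + 2 * (K * (2 - Real.log P.y₀)) * B
      + 2 * (4 * p * (K * (2 - Real.log P.y₀))) ^ p * P.f l := by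
  set c := 2 - Real.log P.y₀ with hc
  have hlog : Real.log P.y₀ ≤ 0 := Real.log_nonpos hP.y₀_pos.le hP.y₀_le_one
  have hc1 : 2 ≤ c := by linarith
  have h1 := hP.law_f_le_sum_price q T σ O hσ hO
  have hg := hP.good q T
  have h2 : ∑ s ∈ O, P.price (P.process q T) s
      ≤ K * (P.law q T (fun z => P.f (z + l) - P.f z)) + K * B := by
    have e : ∑ s ∈ O, P.price (P.process q T) s
        = P.law q T (∑ s ∈ O, fun z => P.f (z + P.v s) - P.f z) + O.card * P.ε := by
      simp only [price, Finset.sum_add_distrib, map_sum, Finset.sum_const, nsmul_eq_mul, law]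
    rw [e]
    refine add_le_add ?_ hOB
    rw [← smul_eq_mul, ← map_smul]
    refine hg.mono _ _ fun z hz => ?_
    simpa [Finset.sum_apply] using hOl z hz
  have hD : 1 ≤ K * c := by nlinarith
  -- The contraction with `D = K * c`, integrated over the random load; the half of `P.law q T P.f`
  -- on its right is absorbed at the end.
  have h3 : (K * c) * P.law q T (fun z => P.f (z + l) - P.f z)
      ≤ P.law q T P.f / 2 + (4 * p * (K * c)) ^ p * P.f l := by
    have e : P.law q T P.f / 2 + (4 * p * (K * c)) ^ p * P.f l
        = P.law q T (fun z => P.f z / 2 + (4 * p * (K * c)) ^ p * P.f l) := by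
      have : (fun z => P.f z / 2 + (4 * p * (K * c)) ^ p * P.f l)
          = (1 / 2 : ℝ) • P.f + ((4 * p * (K * c)) ^ p * P.f l) • (fun _ => (1 : ℝ)) := by
        ext z; simp; ring
      have h1 : P.law q T (fun _ => 1) = 1 := hg.one
      rw [this, map_add, map_smul, map_smul, h1]
      simp; ring
    rw [e, ← smul_eq_mul, ← map_smul]
    refine hg.mono _ _ fun z hz => ?_
    simpa using hP.aggregate.increment_le hD hz hl
  rw [← Finset.sum_mul] at h1
  have h4 := mul_le_mul_of_nonneg_right h2 (by linarith : 0 ≤ c)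
  nlinarith

end FracParams.Valid

end FractionalRun

/-! ### Discrete random variables and seeds -/

open ProbabilityTheory

instance optionMeasurableSpace (S : Type*) : MeasurableSpace (Option S) := ⊤

instance optionDiscrete (S : Type*) : DiscreteMeasurableSpace (Option S) := ⟨fun _ => trivial⟩

theorem integral_comp_discrete {Ω α : Type*} [MeasurableSpace Ω] {μ : Measure Ω}
    [IsProbabilityMeasure μ] [Fintype α] [MeasurableSpace α] [DiscreteMeasurableSpace α]
    {X : Ω → α} (hX : Measurable X) (g : α → ℝ) :
    ∫ ω, g (X ω) ∂μ = ∑ a, μ.real (X ⁻¹' {a}) * g a := by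
  have : IsProbabilityMeasure (μ.map X) := Measure.isProbabilityMeasure_map hX.aemeasurable
  rw [← integral_map hX.aemeasurable (Measurable.of_discrete (f := g)).aestronglyMeasurable,
    integral_fintype Integrable.of_finite]
  refine Finset.sum_congr rfl fun a _ => ?_
  rw [map_measureReal_apply hX (measurableSet_singleton a), smul_eq_mul]

theorem integrable_comp_discrete {Ω α : Type*} [MeasurableSpace Ω] {μ : Measure Ω}
    [IsProbabilityMeasure μ] [Finite α] [MeasurableSpace α] [DiscreteMeasurableSpace α]
    {X : Ω → α} (hX : Measurable X) (g : α → ℝ) : Integrable (fun ω => g (X ω)) μ := by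
  have : IsProbabilityMeasure (μ.map X) := Measure.isProbabilityMeasure_map hX.aemeasurable
  exact (Integrable.of_finite (f := g) (μ := μ.map X)).comp_measurable hX

theorem integral_comp_indep {Ω α β : Type*} [MeasurableSpace Ω] {μ : Measure Ω}
    [IsProbabilityMeasure μ] [Fintype α] [MeasurableSpace α] [DiscreteMeasurableSpace α]
    [Fintype β] [MeasurableSpace β] [DiscreteMeasurableSpace β]
    {X : Ω → α} {Y : Ω → β} (hX : Measurable X) (hY : Measurable Y) (h : IndepFun X Y μ)
    (g : α → β → ℝ) :
    ∫ ω, g (X ω) (Y ω) ∂μ = ∑ b, μ.real (Y ⁻¹' {b}) * ∫ ω, g (X ω) b ∂μ := by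
  rw [integral_comp_discrete (hX.prodMk hY) (fun ab : α × β => g ab.1 ab.2),
    Fintype.sum_prod_type_right]
  refine Finset.sum_congr rfl fun b _ => ?_
  rw [integral_comp_discrete hX (fun a => g a b), Finset.mul_sum]
  refine Finset.sum_congr rfl fun a _ => ?_
  have e : (fun ω => (X ω, Y ω)) ⁻¹' {(a, b)} = X ⁻¹' {a} ∩ Y ⁻¹' {b} := by
    ext ω; simp
  have : μ.real ((fun ω => (X ω, Y ω)) ⁻¹' {(a, b)}) = μ.real (X ⁻¹' {a}) * μ.real (Y ⁻¹' {b}) := by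
    rw [e, measureReal_def, h.measure_inter_preimage_eq_mul _ _ (measurableSet_singleton a)
      (measurableSet_singleton b), ENNReal.toReal_mul]
    rfl
  rw [this]; ring

/-- A subprobability weight on a finite type is the law of a function of a uniform seed. -/
theorem exists_pick {S : Type*} [Fintype S] (π : S → ℝ) (hπ : ∀ s, 0 ≤ π s) (hsum : ∑ s, π s ≤ 1) :
    ∃ g : unitInterval → Option S, Measurable g ∧
      ∀ s, (volume : Measure unitInterval).real (g ⁻¹' {some s}) = π s := by
  classical
  set N := Fintype.card S
  set e : S ≃ Fin N := Fintype.equivFin S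
  set ρ : ℕ → ℝ := fun k => if h : k < N then π (e.symm ⟨k, h⟩) else 0 with hρ
  have hρ0 : ∀ k, 0 ≤ ρ k := fun k => by simp only [hρ]; split_ifs <;> simp [hπ]
  set c : ℕ → ℝ := fun k => ∑ i ∈ Finset.range k, ρ i with hc
  have hcmono : Monotone c := monotone_nat_of_le_succ fun k => by
    simp only [hc, Finset.sum_range_succ]; linarith [hρ0 k]
  have hcN : c N ≤ 1 := by
    refine le_trans (le_of_eq ?_) hsum
    simp only [hc]
    rw [← Fin.sum_univ_eq_sum_range, ← e.sum_comp]
    refine Finset.sum_congr rfl fun s _ => ?_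
    simp [hρ]
  have hc0 : ∀ k, 0 ≤ c k := fun k => Finset.sum_nonneg fun i _ => hρ0 i
  have hc1 : ∀ k ≤ N, c k ≤ 1 := fun k hk => (hcmono hk).trans hcN
  have hcI : ∀ k ≤ N, c k ∈ Set.Icc (0 : ℝ) 1 := fun k hk => ⟨hc0 k, hc1 k hk⟩
  have hsucc : ∀ s, c ((e s : ℕ) + 1) = c (e s) + π s := fun s => by
    simp only [hc, Finset.sum_range_succ]
    simp [hρ]
  -- Consecutive half-open intervals of lengths `π s`; the rest of the unit interval yields `none`.
  set J : S → Set unitInterval := fun s =>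
    Set.Ioc ⟨c (e s), hcI _ (e s).2.le⟩ ⟨c ((e s : ℕ) + 1), hcI _ (e s).2⟩ with hJ
  have hdisj : ∀ s s' a, a ∈ J s → a ∈ J s' → s = s' := by
    have aux : ∀ s s' a, a ∈ J s → a ∈ J s' → ¬ (e s : ℕ) < e s' := by
      intro s s' a h h' hlt
      have h1 : (a : ℝ) ≤ c ((e s : ℕ) + 1) := h.2
      have h2 : c (e s') < (a : ℝ) := h'.1
      have := hcmono (show (e s : ℕ) + 1 ≤ e s' from hlt)
      linarith
    intro s s' a h h'
    exact e.injective (Fin.ext (le_antisymm (not_lt.1 (aux s' s a h' h)) (not_lt.1 (aux s s' a h h'))))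
  set g : unitInterval → Option S := fun a => if h : ∃ s, a ∈ J s then some h.choose else none with hg
  have hpre : ∀ s, g ⁻¹' {some s} = J s := by
    intro s
    ext a
    simp only [Set.mem_preimage, Set.mem_singleton_iff, hg]
    constructor
    · intro h
      split_ifs at h with hex
      · rw [← Option.some.inj h]; exact hex.choose_spec
    · intro h
      have hex : ∃ s, a ∈ J s := ⟨s, h⟩
      rw [dif_pos hex, hdisj _ _ a hex.choose_spec h]
  have hJm : ∀ s, MeasurableSet (J s) := fun s => measurableSet_Ioc
  refine ⟨g, ?_, fun s => ?_⟩
  · refine measurable_to_countable' fun o => ?_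
    cases o with
    | some s => rw [hpre]; exact hJm s
    | none =>
      have : g ⁻¹' {none} = (⋃ s, J s)ᶜ := by
        ext a
        simp only [Set.mem_preimage, Set.mem_singleton_iff, hg, Set.mem_compl_iff, Set.mem_iUnion]
        split_ifs with h <;> simp [h]
      rw [this]
      exact (MeasurableSet.iUnion hJm).compl
  · rw [hpre, measureReal_def, hJ, unitInterval.volume_Ioc]
    change (ENNReal.ofReal (c ((e s : ℕ) + 1) - c (e s))).toReal = π s
    rw [hsucc, add_sub_cancel_left, ENNReal.toReal_ofReal (hπ s)]

open Classical in
/-- A random element of `S` with given (subprobability) weights, as a function of a seed. -/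
noncomputable def pick {S : Type*} [Fintype S] (π : S → ℝ) : unitInterval → Option S :=
  if h : (∀ s, 0 ≤ π s) ∧ ∑ s, π s ≤ 1 then (exists_pick π h.1 h.2).choose else fun _ => none

theorem measurable_pick {S : Type*} [Fintype S] (π : S → ℝ) : Measurable (pick π) := by
  unfold pick
  split_ifs with h
  · exact (exists_pick π h.1 h.2).choose_spec.1
  · exact measurable_const

theorem pick_preimage {S : Type*} [Fintype S] {π : S → ℝ} (hπ : ∀ s, 0 ≤ π s) (hsum : ∑ s, π s ≤ 1)
    (s : S) : (volume : Measure unitInterval).real (pick π ⁻¹' {some s}) = π s := by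
  unfold pick
  rw [dif_pos ⟨hπ, hsum⟩]
  exact (exists_pick π hπ hsum).choose_spec.2 s

/-- A seed for the copy bought in one step: one number to decide which resource is bought, and
one for each later request. -/
abbrev Block : Type := unitInterval × (ℕ → unitInterval)

/-- Independent uniform variables. -/
noncomputable def seqMeasure : Measure (ℕ → unitInterval) := Measure.infinitePi fun _ => volume

instance : IsProbabilityMeasure seqMeasure := by unfold seqMeasure; infer_instance

/-- The law of the randomness used at one time step. -/
noncomputable def blockMeasure : Measure Block := volume.prod seqMeasure

instance : IsProbabilityMeasure blockMeasure := by unfold blockMeasure; infer_instance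

/-- The law of the seed of the online algorithm. -/
noncomputable def seedMeasure : Measure (ℕ → Block) := Measure.infinitePi fun _ => blockMeasure

instance : IsProbabilityMeasure seedMeasure := by unfold seedMeasure; infer_instance

/-! ### Random purchases realise the law -/

section Rounding

variable {m : ℕ} {S : Type*} [Fintype S]

/-- The resource of which a copy is bought at time `t`, if any. -/
noncomputable def FracParams.bought (P : FracParams m S) (q : ℕ → Request S) (t : ℕ)
    (a : unitInterval) : Option S :=
  pick (fun s => (P.y q (t + 1) s - P.y q t s) / 2) a

theorem FracParams.measurable_bought (P : FracParams m S) (q : ℕ → Request S) (t : ℕ) :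
    Measurable (P.bought q t) := measurable_pick _

/-- The load vector of the copy bought, if any. -/
def FracParams.load (P : FracParams m S) (o : Option S) : Fin m → ℝ := o.elim 0 P.v

namespace FracParams.Valid

variable {P : FracParams m S} {p : ℝ} (hP : P.Valid p) (q : ℕ → Request S)
include hP

theorem bought_preimage (t : ℕ) (s : S) :
    (volume : Measure unitInterval).real (P.bought q t ⁻¹' {some s})
      = (P.y q (t + 1) s - P.y q t s) / 2 := by
  refine pick_preimage (fun s => ?_) ?_ s
  · linarith [hP.y_le_succ q t s]
  · rw [← Finset.sum_div]
    linarith [hP.sum_y_sub_le q t]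

omit [Fintype S] in
theorem load_nonneg (o : Option S) : 0 ≤ P.load o := by
  cases o with
  | none => exact le_rfl
  | some s => exact hP.v_nonneg s

/-- The functional `law` is the expectation over the loads of the copies bought. -/
theorem law_eq_integral (T : ℕ) (φ : (Fin m → ℝ) → ℝ) :
    P.law q T φ
      = ∫ ω, φ (∑ t ∈ Finset.range T, P.load (P.bought q t (ω t).1)) ∂seedMeasure := by
  classical
  induction T generalizing φ with
  | zero => simp [law, process]
  | succ T ih =>
    have hV : ∀ t, Measurable fun b : Block => P.bought q t b.1 := fun t =>
      (P.measurable_bought q t).comp measurable_fst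
    have hV' : ∀ t, Measurable fun ω : ℕ → Block => P.bought q t (ω t).1 := fun t =>
      (hV t).comp (measurable_pi_apply t)
    have hind : iIndepFun (fun t (ω : ℕ → Block) => P.bought q t (ω t).1) seedMeasure :=
      iIndepFun_infinitePi hV
    -- The purchase at `T` is independent of the earlier ones and adds `v s` with probability half
    -- the growth: the recursion `law_succ`.
    have h2 := hind.indepFun_finset (Finset.range T) {T} (by simp) hV'
    have hev : Measurable fun o : ({T} : Finset ℕ) → Option S =>
        o ⟨T, Finset.mem_singleton_self T⟩ := measurable_pi_apply _
    have h3 := h2.comp measurable_id hev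
    have hX : Measurable fun (ω : ℕ → Block) (t : Finset.range T) => P.bought q t (ω t).1 :=
      measurable_pi_lambda _ fun t => hV' t
    have hcoe : ∀ ω : ℕ → Block, ∑ t ∈ Finset.range T, P.load (P.bought q t (ω t).1)
        = ∑ t : Finset.range T, P.load (P.bought q t (ω t).1) := fun ω =>
      (Finset.sum_coe_sort (Finset.range T) fun t => P.load (P.bought q t (ω t).1)).symm
    have h4 := integral_comp_indep hX (hV' T) h3
      (fun (a : Finset.range T → Option S) b => φ (∑ t, P.load (a t) + P.load b))
    simp only [Finset.sum_range_succ, hcoe] at ih ⊢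
    rw [h4, Fintype.sum_option]
    have hm : ∀ o, seedMeasure.real ((fun ω : ℕ → Block => P.bought q T (ω T).1) ⁻¹' {o})
        = (volume : Measure unitInterval).real (P.bought q T ⁻¹' {o}) := by
      intro o
      have e1 : MeasurePreserving (fun ω : ℕ → Block => ω T) seedMeasure blockMeasure :=
        measurePreserving_eval_infinitePi (fun _ : ℕ => blockMeasure) T
      have e2 : MeasurePreserving (Prod.fst : Block → unitInterval) blockMeasure volume :=
        measurePreserving_fst
      exact (e2.comp e1).measureReal_preimage
        ((P.measurable_bought q T) (measurableSet_singleton o)).nullMeasurableSet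
    have hone : (volume : Measure unitInterval).real (P.bought q T ⁻¹' {none})
        = 1 - ∑ s, (P.y q (T + 1) s - P.y q T s) / 2 := by
      have := integral_comp_discrete (μ := (volume : Measure unitInterval))
        (P.measurable_bought q T) (fun _ => (1 : ℝ))
      simp only [integral_const, probReal_univ, smul_eq_mul, mul_one, Fintype.sum_option,
        hP.bought_preimage] at this
      linarith
    simp only [hm, hone, hP.bought_preimage]
    rw [P.law_succ, ih]
    have hs : ∀ s, ∫ ω, φ (∑ t : Finset.range T, P.load (P.bought q t (ω t).1) + P.load (some s))
        ∂seedMeasure = P.law q T (fun z => φ (z + P.v s)) := fun s => by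
      rw [ih]; rfl
    have hn : ∫ ω, φ (∑ t : Finset.range T, P.load (P.bought q t (ω t).1) + P.load none)
        ∂seedMeasure = P.law q T φ := by
      rw [ih]; simp [load]
    simp only [hs, hn, ← ih, mul_sub, Finset.sum_sub_distrib, ← Finset.sum_mul]
    ring

end FracParams.Valid

end Rounding

/-! ### Which requests a bought copy accepts -/

section Acceptance

variable {m : ℕ} {S : Type*} [Fintype S]

/-- The copy of `s` bought at time `t'` wants the request at time `t`, with seed `u`. -/
def FracParams.Wants (P : FracParams m S) (q : ℕ → Request S) (t' t : ℕ) (s : S)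
    (u : unitInterval) : Prop :=
  (s ∈ (q t).avail ∧ t' ≤ t ∧ P.y q (t + 1) s ≤ 2 * P.y q (t' + 1) s) ∧
    (u : ℝ) ≤ P.x q t s / (4 * P.y q (t + 1) s)

open Classical in
/-- The part of the copy of `s` bought at time `t'` that is used up before time `t`. -/
noncomputable def FracParams.usage (P : FracParams m S) (q : ℕ → Request S) (t' t : ℕ) (s : S)
    (u : ℕ → unitInterval) : ℝ :=
  ∑ i ∈ Finset.range t, if P.Wants q t' i s (u i) then (q i).rate s else 0

/-- The copy of `s` bought at time `t'` accepts the request at time `t`: it wants it and is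
not used up. -/
def FracParams.Accepts (P : FracParams m S) (q : ℕ → Request S) (t' t : ℕ) (s : S)
    (u : ℕ → unitInterval) : Prop :=
  P.Wants q t' t s (u t) ∧ P.usage q t' t s u < 1

omit [Fintype S] in
theorem usage_step {a b A : ℝ} (ha0 : 0 ≤ a) (ha1 : a ≤ 1) (hA : A ≤ 2) (hAb : A ≤ b)
    (c : Prop) [Decidable c] (hc : c → b < 1) :
    A + (if c then a else 0) ≤ 2 ∧ A + (if c then a else 0) ≤ b + a := by
  split_ifs with h
  · exact ⟨by linarith [hc h], by linarith⟩
  · exact ⟨by linarith, by linarith⟩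

-- Accepted rates are among the wanted ones, and acceptance stops once the wanted rates reach `1`;
-- the last accepted request overshoots by at most `1`.
open Classical in
theorem FracParams.sum_accepted_le (P : FracParams m S) (q : ℕ → Request S) (t' T : ℕ) (s : S)
    (u : ℕ → unitInterval) :
    ∑ t ∈ Finset.range T, (if P.Accepts q t' t s u then (q t).rate s else 0) ≤ 2 := by
  suffices h : ∑ t ∈ Finset.range T, (if P.Accepts q t' t s u then (q t).rate s else 0) ≤ 2 ∧
      ∑ t ∈ Finset.range T, (if P.Accepts q t' t s u then (q t).rate s else 0)
        ≤ P.usage q t' T s u from h.1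
  induction T with
  | zero => simp [usage]
  | succ T ih =>
    have hr0 := (q T).rate_nonneg s
    have hr1 := (q T).rate_le_one s
    rw [Finset.sum_range_succ, usage, Finset.sum_range_succ]
    change _ ∧ _ ≤ P.usage q t' T s u + _
    by_cases hw : P.Wants q t' T s (u T)
    · simp only [hw, if_true]
      exact usage_step hr0 hr1 ih.1 ih.2 _ fun h => h.2
    · have hna : ¬ P.Accepts q t' T s u := fun h => hw h.1
      simpa [hw, hna] using ih

theorem FracParams.measurableSet_wants (P : FracParams m S) (q : ℕ → Request S) (t' t : ℕ)
    (s : S) : MeasurableSet {u | P.Wants q t' t s u} := by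
  unfold Wants
  by_cases h : s ∈ (q t).avail ∧ t' ≤ t ∧ P.y q (t + 1) s ≤ 2 * P.y q (t' + 1) s
  · simp only [h, and_self, true_and]
    exact measurableSet_le measurable_subtype_coe measurable_const
  · simp only [h, false_and, Set.ofPred_false, MeasurableSet.empty]

theorem FracParams.measurable_usage (P : FracParams m S) (q : ℕ → Request S) (t' t : ℕ)
    (s : S) : Measurable (P.usage q t' t s) := by
  classical
  unfold usage
  refine Finset.measurable_fun_sum _ fun i _ => ?_
  exact Measurable.ite ((P.measurableSet_wants q t' i s).preimage (measurable_pi_apply i))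
    measurable_const measurable_const

theorem FracParams.measurableSet_accepts (P : FracParams m S) (q : ℕ → Request S) (t' t : ℕ)
    (s : S) : MeasurableSet {u | P.Accepts q t' t s u} :=
  ((P.measurableSet_wants q t' t s).preimage (measurable_pi_apply t)).inter
    (measurableSet_lt (P.measurable_usage q t' t s) measurable_const)

theorem unitInterval_real_le {c : ℝ} (h0 : 0 ≤ c) (h1 : c ≤ 1) :
    (volume : Measure unitInterval).real {u | (u : ℝ) ≤ c} = c := by
  have : {u : unitInterval | (u : ℝ) ≤ c} = Set.Iic ⟨c, h0, h1⟩ := by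
    ext u; exact Iff.rfl
  rw [this, measureReal_def, unitInterval.volume_Iic, ENNReal.toReal_ofReal h0]

namespace FracParams.Valid

variable {P : FracParams m S} {p : ℝ} (hP : P.Valid p) (q : ℕ → Request S)
include hP

theorem x_div_nonneg (t : ℕ) (s : S) : 0 ≤ P.x q t s / (4 * P.y q (t + 1) s) :=
  div_nonneg (hP.x_nonneg q t s) (mul_nonneg (by norm_num) (hP.y_pos q (t + 1) s).le)

theorem wants_prob_eq {t' t : ℕ} {s : S} (hs : s ∈ (q t).avail) (ht : t' ≤ t)
    (hy : P.y q (t + 1) s ≤ 2 * P.y q (t' + 1) s) :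
    (volume : Measure unitInterval).real {u | P.Wants q t' t s u}
      = P.x q t s / (4 * P.y q (t + 1) s) := by
  have hpos := hP.y_pos q (t + 1) s
  simp only [Wants, hs, ht, hy, and_self, true_and]
  refine unitInterval_real_le (hP.x_div_nonneg q t s) ?_
  rw [div_le_one (by linarith)]
  linarith [hP.x_le q t s]

omit hP in
theorem seq_prob_eval (t : ℕ) {U : Set unitInterval} (hU : MeasurableSet U) :
    seqMeasure.real {u | u t ∈ U} = (volume : Measure unitInterval).real U :=
  (measurePreserving_eval_infinitePi (fun _ : ℕ => (volume : Measure unitInterval)) t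
    ).measureReal_preimage hU.nullMeasurableSet

/-- Since `rate * x` is at most the growth of the fraction, a wanted request uses in expectation at
most that growth over `4 * y (t' + 1)`. Requests are wanted only until the fraction has doubled
since the purchase, so the growths, truncated at `c`, telescope to at most `c = 2 * y (t' + 1)`. -/
theorem integral_usage_le (t' t : ℕ) (s : S) : ∫ u, P.usage q t' t s u ∂seqMeasure ≤ 1 / 2 := by
  classical
  have hm : ∀ i, MeasurableSet {u : ℕ → unitInterval | P.Wants q t' i s (u i)} := fun i =>
    (P.measurableSet_wants q t' i s).preimage (measurable_pi_apply i)
  have hind : ∀ i, (fun u : ℕ → unitInterval =>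
      if P.Wants q t' i s (u i) then (q i).rate s else 0)
      = {u : ℕ → unitInterval | P.Wants q t' i s (u i)}.indicator fun _ => (q i).rate s := by
    intro i; ext u; rfl
  have hint : ∀ i, Integrable (fun u : ℕ → unitInterval =>
      if P.Wants q t' i s (u i) then (q i).rate s else 0) seqMeasure := fun i => by
    rw [hind i]; exact (integrable_const _).indicator (hm i)
  have hy' := hP.y_pos q (t' + 1) s
  set c := 2 * P.y q (t' + 1) s with hc
  have hterm : ∀ i, ∫ u, (if P.Wants q t' i s (u i) then (q i).rate s else 0) ∂seqMeasure
      ≤ (min (P.y q (i + 1) s) c - min (P.y q i s) c) / (4 * P.y q (t' + 1) s) := by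
    intro i
    rw [hind i, integral_indicator_const _ (hm i), smul_eq_mul]
    have hmono := hP.y_le_succ q i s
    by_cases h : s ∈ (q i).avail ∧ t' ≤ i ∧ P.y q (i + 1) s ≤ c
    · have e : seqMeasure.real {u : ℕ → unitInterval | P.Wants q t' i s (u i)}
          = P.x q i s / (4 * P.y q (i + 1) s) := by
        rw [← hP.wants_prob_eq q h.1 h.2.1 h.2.2]
        exact seq_prob_eval i (P.measurableSet_wants q t' i s)
      rw [e, min_eq_left h.2.2, min_eq_left (hmono.trans h.2.2), div_mul_eq_mul_div, mul_comm]
      have h1 := hP.rate_mul_x_le q i s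
      have h2 : P.y q (t' + 1) s ≤ P.y q (i + 1) s := hP.y_mono q s (by omega)
      have h3 : 0 ≤ P.y q (i + 1) s - P.y q i s := sub_nonneg.2 hmono
      gcongr
    · have e : {u : ℕ → unitInterval | P.Wants q t' i s (u i)} = ∅ := by
        ext u
        simp only [Set.mem_ofPred_eq, Set.mem_empty_iff_false, iff_false]
        exact fun hw => h hw.1
      rw [e, measureReal_empty, zero_mul]
      exact div_nonneg (sub_nonneg.2 (min_le_min_right _ hmono)) (by linarith)
  unfold usage
  rw [integral_finsetSum _ fun i _ => hint i]
  refine (Finset.sum_le_sum fun i _ => hterm i).trans ?_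
  rw [← Finset.sum_div, Finset.sum_range_sub (fun i => min (P.y q i s) c), div_le_iff₀ (by linarith)]
  have h1 : min (P.y q t s) c ≤ c := min_le_right _ _
  have h2 : 0 ≤ min (P.y q 0 s) c := le_min (hP.y_pos q 0 s).le (by linarith)
  linarith

/-- Markov's inequality for the expected usage `1 / 2`. -/
theorem usage_prob_ge (t' t : ℕ) (s : S) :
    1 / 2 ≤ seqMeasure.real {u | P.usage q t' t s u < 1} := by
  classical
  have hnn : ∀ u, 0 ≤ P.usage q t' t s u := fun u => Finset.sum_nonneg fun i _ => by
    split_ifs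
    · exact (q i).rate_nonneg s
    · exact le_rfl
  have hint : Integrable (P.usage q t' t s) seqMeasure := by
    refine Integrable.of_bound (C := ∑ i ∈ Finset.range t, (q i).rate s)
      (P.measurable_usage q t' t s).aestronglyMeasurable (Filter.Eventually.of_forall fun u => ?_)
    rw [Real.norm_of_nonneg (hnn u)]
    refine Finset.sum_le_sum fun i _ => ?_
    split_ifs
    · exact le_rfl
    · exact (q i).rate_nonneg s
  have h1 := mul_meas_ge_le_integral_of_nonneg (Filter.Eventually.of_forall hnn) hint 1
  have h2 := hP.integral_usage_le q t' t s
  have hm : MeasurableSet {u | P.usage q t' t s u < 1} :=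
    measurableSet_lt (P.measurable_usage q t' t s) measurable_const
  have e : {u | 1 ≤ P.usage q t' t s u} = {u | P.usage q t' t s u < 1}ᶜ := by
    ext u; simp
  rw [e, probReal_compl_eq_one_sub hm] at h1
  linarith

/-- Usage depends on seeds before `t` only, hence is independent of whether the request at `t` is
wanted; the probabilities `1 / 2` and `x / (4 * y)` multiply. -/
theorem accepts_prob_ge {t' t : ℕ} {s : S} (hs : s ∈ (q t).avail) (ht : t' ≤ t)
    (hy : P.y q (t + 1) s ≤ 2 * P.y q (t' + 1) s) :
    P.x q t s / (8 * P.y q (t + 1) s) ≤ seqMeasure.real {u | P.Accepts q t' t s u} := by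
  classical
  -- At index `t` the value is `1` instead of the rate, so that `g t > 0` detects a wanted request
  -- even if its rate is zero.
  set g : ℕ → unitInterval → ℝ := fun i a =>
    if P.Wants q t' i s a then (if i = t then 1 else (q i).rate s) else 0 with hg
  have hgm : ∀ i, Measurable (g i) := fun i =>
    Measurable.ite (P.measurableSet_wants q t' i s) measurable_const measurable_const
  have hI : iIndepFun (fun i (u : ℕ → unitInterval) => g i (u i)) seqMeasure :=
    iIndepFun_infinitePi hgm
  have h1 := hI.indepFun_finsetSum_of_notMem
    (fun i => (hgm i).comp (measurable_pi_apply i)) (Finset.notMem_range_self (n := t))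
  have hus : ∀ u, (∑ j ∈ Finset.range t, fun u : ℕ → unitInterval => g j (u j)) u
      = P.usage q t' t s u := by
    intro u
    rw [Finset.sum_apply, usage]
    refine Finset.sum_congr rfl fun i hi => ?_
    have : i ≠ t := (Finset.mem_range.1 hi).ne
    simp [hg, this]
  have h2 := h1.measure_inter_preimage_eq_mul (Set.Iio 1) (Set.Ioi 0) measurableSet_Iio
    measurableSet_Ioi
  have e1 : (∑ j ∈ Finset.range t, fun u : ℕ → unitInterval => g j (u j)) ⁻¹' Set.Iio 1
      = {u | P.usage q t' t s u < 1} := by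
    ext u; simp only [Set.mem_preimage, hus, Set.mem_Iio, Set.mem_ofPred_eq]
  have e2 : (fun u : ℕ → unitInterval => g t (u t)) ⁻¹' Set.Ioi 0
      = {u | P.Wants q t' t s (u t)} := by
    ext u
    simp only [hg, Set.mem_preimage, Set.mem_Ioi, Set.mem_ofPred_eq, if_true]
    split_ifs with h <;> simp [h]
  rw [e1, e2] at h2
  have e3 : {u | P.Accepts q t' t s u}
      = {u | P.usage q t' t s u < 1} ∩ {u | P.Wants q t' t s (u t)} := by
    ext u; exact and_comm
  have e4 : seqMeasure.real {u | P.Wants q t' t s (u t)} = P.x q t s / (4 * P.y q (t + 1) s) := by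
    rw [← hP.wants_prob_eq q hs ht hy]
    exact seq_prob_eval t (P.measurableSet_wants q t' t s)
  rw [e3, measureReal_def, h2, ENNReal.toReal_mul, ← measureReal_def, ← measureReal_def, e4]
  have h5 := hP.usage_prob_ge q t' t s
  have h6 := hP.x_div_nonneg q t s
  have e5 : P.x q t s / (8 * P.y q (t + 1) s) = 1 / 2 * (P.x q t s / (4 * P.y q (t + 1) s)) := by
    have := (hP.y_pos q (t + 1) s).ne'
    field_simp; ring
  rw [e5]
  gcongr

end FracParams.Valid

end Acceptance

/-! ### Probability that a client is served -/

section Service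

variable {m : ℕ} {S : Type*} [Fintype S]

/-- With seed `b`, a copy of `s` is bought at time `t'` and accepts the request at time `t`. -/
def FracParams.Serves (P : FracParams m S) (q : ℕ → Request S) (t' t : ℕ) (s : S)
    (b : Block) : Prop :=
  P.bought q t' b.1 = some s ∧ P.Accepts q t' t s b.2

theorem FracParams.measurableSet_serves (P : FracParams m S) (q : ℕ → Request S) (t' t : ℕ)
    (s : S) : MeasurableSet {b | P.Serves q t' t s b} :=
  ((P.measurable_bought q t' (measurableSet_singleton (some s))).preimage measurable_fst).inter
    ((P.measurableSet_accepts q t' t s).preimage measurable_snd)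

/-- With seed `b`, the copy bought at time `t'` accepts some request at a time in `Q`. -/
def FracParams.ServesIn (P : FracParams m S) (q : ℕ → Request S) (t' : ℕ) (Q : Finset ℕ)
    (b : Block) : Prop :=
  ∃ t ∈ Q, ∃ s, P.Serves q t' t s b

theorem FracParams.measurableSet_servesIn (P : FracParams m S) (q : ℕ → Request S) (t' : ℕ)
    (Q : Finset ℕ) : MeasurableSet {b | P.ServesIn q t' Q b} := by
  have : {b | P.ServesIn q t' Q b} = ⋃ t ∈ Q, ⋃ s, {b | P.Serves q t' t s b} := by
    ext b; simp [ServesIn]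
  rw [this]
  exact Finset.measurableSet_biUnion _ fun t _ =>
    MeasurableSet.iUnion fun s => P.measurableSet_serves q t' t s

namespace FracParams.Valid

variable {P : FracParams m S} {p : ℝ} (hP : P.Valid p) (q : ℕ → Request S)
include hP

/-- Half the growth is the probability of the purchase. Only growth above `y (t + 1) / 2` is
counted, since copies bought there are young enough to want the request; the form with `max`
telescopes over `t'`. -/
theorem serves_prob_ge {t' t : ℕ} {s : S} (hs : s ∈ (q t).avail) (ht : t' ≤ t) :
    (max (P.y q (t' + 1) s) (P.y q (t + 1) s / 2) - max (P.y q t' s) (P.y q (t + 1) s / 2))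
      * (P.x q t s / (16 * P.y q (t + 1) s)) ≤ blockMeasure.real {b | P.Serves q t' t s b} := by
  have hmono := hP.y_le_succ q t' s
  have hpos := hP.y_pos q (t + 1) s
  by_cases hy : P.y q (t + 1) s ≤ 2 * P.y q (t' + 1) s
  · have e : {b | P.Serves q t' t s b}
        = (P.bought q t' ⁻¹' {some s}) ×ˢ {u | P.Accepts q t' t s u} := by
      ext b; rfl
    have h1 := hP.accepts_prob_ge q hs ht hy
    rw [e, blockMeasure, measureReal_prod_prod, hP.bought_preimage]
    have h2 : max (P.y q (t' + 1) s) (P.y q (t + 1) s / 2)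
        - max (P.y q t' s) (P.y q (t + 1) s / 2) ≤ P.y q (t' + 1) s - P.y q t' s := by
      rw [max_eq_left (by linarith)]
      linarith [le_max_left (P.y q t' s) (P.y q (t + 1) s / 2)]
    have h3 : P.x q t s / (8 * P.y q (t + 1) s) = 2 * (P.x q t s / (16 * P.y q (t + 1) s)) := by
      field_simp; ring
    have h4 : 0 ≤ P.x q t s / (16 * P.y q (t + 1) s) :=
      div_nonneg (hP.x_nonneg q t s) (by linarith)
    have h5 : 0 ≤ P.y q (t' + 1) s - P.y q t' s := sub_nonneg.2 hmono
    rw [h3] at h1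
    nlinarith [mul_le_mul_of_nonneg_left h1 h5, mul_le_mul_of_nonneg_right h2 h4]
  · rw [max_eq_right (by linarith), max_eq_right (by linarith), sub_self, zero_mul]
    exact measureReal_nonneg

/-- The telescoping sum is `y / 2`, the growth since the fraction had half its present value, and `y
/ 2 * (x / (16 * y)) = x / 32`. The hypothesis `hmature` places the initial fraction, which is never
bought, below that half. -/
theorem sum_serves_prob_ge {T t : ℕ} (htT : t < T) {s : S} (hs : s ∈ (q t).avail)
    (hmature : 2 * P.y₀ ≤ P.y q (t + 1) s) :
    P.x q t s / 32 ≤ ∑ t' ∈ Finset.range T, blockMeasure.real {b | P.Serves q t' t s b} := by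
  have hpos := hP.y_pos q (t + 1) s
  have h1 : ∑ t' ∈ Finset.range (t + 1), blockMeasure.real {b | P.Serves q t' t s b}
      ≤ ∑ t' ∈ Finset.range T, blockMeasure.real {b | P.Serves q t' t s b} :=
    Finset.sum_le_sum_of_subset_of_nonneg (Finset.range_mono htT) fun _ _ _ => measureReal_nonneg
  refine le_trans ?_ h1
  refine le_trans ?_ (Finset.sum_le_sum fun t' ht' =>
    hP.serves_prob_ge q hs (Nat.lt_succ_iff.1 (Finset.mem_range.1 ht')))
  rw [← Finset.sum_mul,
    Finset.sum_range_sub (fun t' => max (P.y q t' s) (P.y q (t + 1) s / 2)),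
    max_eq_left (by linarith), max_eq_right (show P.y q 0 s ≤ _ by
      change P.y₀ ≤ _; linarith)]
  apply le_of_eq
  field_simp
  ring

/-- Resources with fraction below `2 * y₀` serve at most half of the unit demand altogether, by
`hcard`; the other half is served at rate `1 / 32`. -/
theorem sum_sum_serves_prob_ge {T t : ℕ} (htT : t < T) (hne : (q t).avail.Nonempty)
    (hcard : 4 * (q t).avail.card * P.y₀ ≤ 1) :
    1 / 64 ≤ ∑ s ∈ (q t).avail, ∑ t' ∈ Finset.range T,
      blockMeasure.real {b | P.Serves q t' t s b} := by
  have h1 : ∀ s ∈ (q t).avail, (P.x q t s - 2 * P.y₀) / 32 ≤ ∑ t' ∈ Finset.range T,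
      blockMeasure.real {b | P.Serves q t' t s b} := by
    intro s hs
    have hy₀ := hP.y₀_pos
    by_cases hm : 2 * P.y₀ ≤ P.y q (t + 1) s
    · exact le_trans (by linarith) (hP.sum_serves_prob_ge q htT hs hm)
    · refine le_trans ?_ (Finset.sum_nonneg fun _ _ => measureReal_nonneg)
      linarith [hP.x_le q t s]
  refine le_trans ?_ (Finset.sum_le_sum h1)
  rw [← Finset.sum_div, Finset.sum_sub_distrib, hP.sum_x q t hne, Finset.sum_const, nsmul_eq_mul]
  linarith

-- One purchase yields one resource, and that resource determines the request in `Q`, so the events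
-- are disjoint. This is why the requests of a client live in separate layers.
omit hP in
theorem servesIn_prob_ge (t' : ℕ) (Q : Finset ℕ)
    (hdisj : ∀ t₁ ∈ Q, ∀ t₂ ∈ Q, ∀ s, s ∈ (q t₁).avail → s ∈ (q t₂).avail → t₁ = t₂) :
    ∑ t ∈ Q, ∑ s ∈ (q t).avail, blockMeasure.real {b | P.Serves q t' t s b}
      ≤ blockMeasure.real {b | P.ServesIn q t' Q b} := by
  classical
  rw [Finset.sum_sigma', ← measureReal_biUnion_finset]
  · refine measureReal_mono ?_
    intro b hb
    simp only [Set.mem_iUnion] at hb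
    obtain ⟨⟨t, s⟩, hts, h⟩ := hb
    exact ⟨t, (Finset.mem_sigma.1 hts).1, s, h⟩
  · rintro ⟨t₁, s₁⟩ h₁ ⟨t₂, s₂⟩ h₂ hne
    refine Set.disjoint_left.2 fun b hb₁ hb₂ => hne ?_
    have hs : s₁ = s₂ := Option.some.inj (hb₁.1.symm.trans hb₂.1)
    subst hs
    have ht := hdisj t₁ (Finset.mem_sigma.1 h₁).1 t₂ (Finset.mem_sigma.1 h₂).1 s₁
      hb₁.2.1.1.1 hb₂.2.1.1.1
    subst ht
    rfl
  · rintro ⟨t, s⟩ _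
    exact P.measurableSet_serves q t' t s

/-- All copies fail to serve the requests at the times in `Q` with exponentially
small probability. -/
theorem fail_prob_le (T : ℕ) (Q : Finset ℕ) (hQ : ∀ t ∈ Q, t < T)
    (hne : ∀ t ∈ Q, (q t).avail.Nonempty) (hcard : ∀ t ∈ Q, 4 * (q t).avail.card * P.y₀ ≤ 1)
    (hdisj : ∀ t₁ ∈ Q, ∀ t₂ ∈ Q, ∀ s, s ∈ (q t₁).avail → s ∈ (q t₂).avail → t₁ = t₂) :
    seedMeasure.real {ω | ∀ t' < T, ¬ P.ServesIn q t' Q (ω t')} ≤ Real.exp (-(Q.card / 64)) := by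
  have hm : ∀ t', MeasurableSet {b | ¬ P.ServesIn q t' Q b} := fun t' =>
    (P.measurableSet_servesIn q t' Q).compl
  have e : {ω : ℕ → Block | ∀ t' < T, ¬ P.ServesIn q t' Q (ω t')}
      = Set.pi ↑(Finset.range T) fun t' => {b | ¬ P.ServesIn q t' Q b} := by
    ext ω; simp [Set.mem_pi]
  have h1 : seedMeasure.real {ω | ∀ t' < T, ¬ P.ServesIn q t' Q (ω t')}
      = ∏ t' ∈ Finset.range T, blockMeasure.real {b | ¬ P.ServesIn q t' Q b} := by
    rw [e, measureReal_def, seedMeasure, Measure.infinitePi_pi _ fun t' _ => hm t',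
      ENNReal.toReal_prod]
    rfl
  -- `1 - x ≤ exp (-x)` turns the product over independent purchases into a sum of service
  -- probabilities, at least `1 / 64` per request.
  have h2 : ∀ t', blockMeasure.real {b | ¬ P.ServesIn q t' Q b}
      ≤ Real.exp (-blockMeasure.real {b | P.ServesIn q t' Q b}) := by
    intro t'
    have e1 : {b | ¬ P.ServesIn q t' Q b} = {b | P.ServesIn q t' Q b}ᶜ := rfl
    rw [e1, probReal_compl_eq_one_sub (P.measurableSet_servesIn q t' Q)]
    linarith [Real.add_one_le_exp (-blockMeasure.real {b | P.ServesIn q t' Q b})]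
  rw [h1]
  refine (Finset.prod_le_prod (fun _ _ => measureReal_nonneg) fun t' _ => h2 t').trans ?_
  rw [← Real.exp_sum, Real.exp_le_exp, Finset.sum_neg_distrib, neg_le_neg_iff]
  refine le_trans ?_ (Finset.sum_le_sum fun t' _ => servesIn_prob_ge (P := P) q t' Q hdisj)
  rw [Finset.sum_comm]
  have h3 : ∀ t ∈ Q, (1 : ℝ) / 64 ≤ ∑ t' ∈ Finset.range T, ∑ s ∈ (q t).avail,
      blockMeasure.real {b | P.Serves q t' t s b} := by
    intro t ht
    rw [Finset.sum_comm]
    exact hP.sum_sum_serves_prob_ge q (hQ t ht) (hne t ht) (hcard t ht)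
  refine le_trans (le_of_eq ?_) (Finset.sum_le_sum h3)
  rw [Finset.sum_const, nsmul_eq_mul]; ring

end FracParams.Valid

end Service

/-! ### One phase: capacity levels and the fractional cost -/

/-- The load vector when the active clients among the first `n` are assigned by `σ`. -/
noncomputable def activeLoad {m : ℕ} (c : Fin m → ℝ≥0) (a : ℕ → Option (Fin m → ℝ≥0)) (n : ℕ)
    (σ : ℕ → Fin m) : Fin m → ℝ := by
  classical exact fun i =>
    (if ∃ j < n, (a j).isSome ∧ σ j = i then (c i : ℝ) else 0)
      + ∑ j ∈ Finset.range n, if σ j = i then (((a j).getD 0 i : ℝ≥0) : ℝ) else 0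

theorem le_activeLoad {m : ℕ} (c : Fin m → ℝ≥0) {a : ℕ → Option (Fin m → ℝ≥0)} {n : ℕ}
    (σ : ℕ → Fin m) {j : ℕ} (hj : j < n) (ha : (a j).isSome) :
    (c (σ j) : ℝ) + ((a j).getD 0 (σ j) : ℝ≥0) ≤ activeLoad c a n σ (σ j) := by
  classical
  simp only [activeLoad]
  refine add_le_add (le_of_eq (if_pos ⟨j, hj, ha, rfl⟩).symm) ?_
  refine le_trans (le_of_eq ?_) (Finset.single_le_sum (f := fun j' =>
    if σ j' = σ j then (((a j').getD 0 (σ j) : ℝ≥0) : ℝ) else 0)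
    (fun j' _ => ?_) (Finset.mem_range.2 hj))
  · simp
  · split_ifs
    · exact NNReal.coe_nonneg _
    · exact le_rfl

theorem sum_range_mul_eq {M : Type*} [AddCommMonoid M] (g : ℕ → M) (n K : ℕ) :
    ∑ t ∈ Finset.range (n * K), g t
      = ∑ j ∈ Finset.range n, ∑ r ∈ Finset.range K, g (j * K + r) := by
  induction n with
  | zero => simp
  | succ n ih => rw [Nat.succ_mul, Finset.sum_range_add, ih, Finset.sum_range_succ]

/-- Data of a run of the algorithm on clients that can be served at aggregate cost `B`: the
aggregate function, the opening costs, an upper bound `u` on the loads, and the number `K` of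
parallel copies of the fractional algorithm. -/
structure Phase (m : ℕ) where
  f : (Fin m → ℝ) → ℝ
  c : Fin m → ℝ≥0
  u : Fin m → ℝ
  B : ℝ
  K : ℕ

namespace Phase

variable {m : ℕ}

/-- A resource is a facility together with a layer and a capacity level. -/
abbrev Resource (D : Phase m) : Type := Fin D.K × Fin m × Fin (m + 1)

/-- The `k`-th budget of facility `i`. -/
noncomputable def level (D : Phase m) (i : Fin m) (k : Fin (m + 1)) : ℝ := D.u i / 2 ^ (k : ℕ)

/-- The data of the fractional algorithm in a phase. -/
noncomputable def params (D : Phase m) : FracParams m D.Resource where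
  f := D.f
  v s := Pi.single s.2.1 (D.level s.2.1 s.2.2)
  ε := D.B / m
  y₀ := 1 / (4 * (m * (m + 1)))

open Classical in
/-- The request at time `t` for a client with assignment costs `a`, empty if there is none. -/
noncomputable def request (D : Phase m) (a : Option (Fin m → ℝ≥0)) (t : ℕ) :
    Request D.Resource where
  avail := Finset.univ.filter fun s => a.isSome ∧ (s.1 : ℕ) = t % D.K ∧
    (D.c s.2.1 : ℝ) + (a.getD 0 s.2.1 : ℝ≥0) ≤ D.level s.2.1 s.2.2
  rate s := max 0 (min 1 (((a.getD 0 s.2.1 : ℝ≥0) : ℝ) / D.level s.2.1 s.2.2))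
  rate_nonneg _ := le_max_left _ _
  rate_le_one _ := max_le zero_le_one (min_le_left _ _)

/-- Each client makes one request in each layer. -/
noncomputable def requests (D : Phase m) (a : ℕ → Option (Fin m → ℝ≥0)) (t : ℕ) :
    Request D.Resource :=
  D.request (a (t / D.K)) t

/-- Standing assumptions on the data of a phase. -/
structure Valid (D : Phase m) (p : ℝ) : Prop where
  m_pos : 0 < m
  aggregate : Aggregate p D.f
  u_pos : ∀ i, 0 < D.u i
  f_u : ∀ i, D.f (Pi.single i (D.u i)) ≤ 2 * D.B
  le_u : ∀ x, 0 ≤ x → D.f x ≤ D.B → ∀ i, x i ≤ D.u i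
  B_pos : 0 < D.B
  K_pos : 0 < D.K

theorem mem_avail (D : Phase m) {a : ℕ → Option (Fin m → ℝ≥0)} {t : ℕ} {s : D.Resource} :
    s ∈ (D.requests a t).avail ↔ (a (t / D.K)).isSome ∧ (s.1 : ℕ) = t % D.K ∧
      (D.c s.2.1 : ℝ) + ((a (t / D.K)).getD 0 s.2.1 : ℝ≥0) ≤ D.level s.2.1 s.2.2 := by
  simp [requests, request]

namespace Valid

variable {D : Phase m} {p : ℝ} (hD : D.Valid p)
include hD

theorem level_pos (i : Fin m) (k : Fin (m + 1)) : 0 < D.level i k :=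
  div_pos (hD.u_pos i) (by positivity)

theorem params_valid : D.params.Valid p where
  aggregate := hD.aggregate
  v_nonneg s := Pi.single_nonneg.2 (hD.level_pos _ _).le
  ε_pos := div_pos hD.B_pos (Nat.cast_pos.2 hD.m_pos)
  y₀_pos := by
    have : (0 : ℝ) < m := Nat.cast_pos.2 hD.m_pos
    simp only [params]; positivity
  y₀_le_one := by
    have : (1 : ℝ) ≤ m := Nat.one_le_cast.2 hD.m_pos
    simp only [params]
    rw [div_le_one (by positivity)]
    nlinarith

/-- A layer has `m * (m + 1)` resources; `y₀` is chosen to match. -/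
theorem card_avail (a : ℕ → Option (Fin m → ℝ≥0)) (t : ℕ) :
    4 * ((D.requests a t).avail.card : ℝ) * D.params.y₀ ≤ 1 := by
  have h1 : (D.requests a t).avail.card ≤ m * (m + 1) := by
    have : (D.requests a t).avail.card ≤ (Finset.univ : Finset (Fin m × Fin (m + 1))).card := by
      refine Finset.card_le_card_of_injOn (fun s => s.2) (fun _ _ => Finset.mem_univ _) ?_
      intro s hs s' hs' h
      have e := (D.mem_avail.1 hs).2.1.trans (D.mem_avail.1 hs').2.1.symm
      exact Prod.ext (Fin.ext e) h
    simpa using this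
  have h2 : ((D.requests a t).avail.card : ℝ) ≤ m * (m + 1) := by exact_mod_cast h1
  have : (0 : ℝ) < m := Nat.cast_pos.2 hD.m_pos
  simp only [params]
  rw [mul_one_div, div_le_one (by positivity)]
  linarith

theorem rate_eq {a : ℕ → Option (Fin m → ℝ≥0)} {t : ℕ} {s : D.Resource}
    (hs : s ∈ (D.requests a t).avail) :
    (D.requests a t).rate s = ((a (t / D.K)).getD 0 s.2.1 : ℝ≥0) / D.level s.2.1 s.2.2 := by
  have hl := hD.level_pos s.2.1 s.2.2
  have h := (D.mem_avail.1 hs).2.2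
  have hc : (0 : ℝ) ≤ D.c s.2.1 := NNReal.coe_nonneg _
  have h1 : (((a (t / D.K)).getD 0 s.2.1 : ℝ≥0) : ℝ) / D.level s.2.1 s.2.2 ≤ 1 := by
    rw [div_le_one hl]; linarith
  simp only [requests, request]
  rw [min_eq_right h1, max_eq_right (div_nonneg (NNReal.coe_nonneg _) hl.le)]

/-- Rounding up a load to a capacity level. -/
theorem exists_level {l : ℝ} {i : Fin m} (hl : l ≤ D.u i) (hl0 : 0 ≤ l) :
    ∃ k, l ≤ D.level i k ∧ D.level i k ≤ 2 * l + D.u i / m := by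
  have hm : (0 : ℝ) < m := Nat.cast_pos.2 hD.m_pos
  have hu := hD.u_pos i
  -- Loads below the smallest level are paid for by the additive term, as `m ≤ 2 ^ m`.
  by_cases h : l ≤ D.u i / 2 ^ m
  · refine ⟨Fin.last m, by simpa [level] using h, ?_⟩
    have : D.u i / 2 ^ m ≤ D.u i / m := by
      gcongr
      exact_mod_cast Nat.lt_two_pow_self.le
    simp only [level, Fin.val_last]
    linarith
  · have hex : ∃ k, D.u i / 2 ^ k < l := ⟨m, not_le.1 h⟩
    classical
    set k := Nat.find hex with hk
    have h1 : D.u i / 2 ^ k < l := Nat.find_spec hex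
    have hk0 : k ≠ 0 := by
      intro h0
      rw [h0] at h1
      simp at h1
      linarith
    obtain ⟨k', hk'⟩ := Nat.exists_eq_succ_of_ne_zero hk0
    have h2 : l ≤ D.u i / 2 ^ k' := not_lt.1 (Nat.find_min hex (show k' < k by omega))
    have hkm : k ≤ m := Nat.find_min' hex (not_le.1 h)
    refine ⟨⟨k', by omega⟩, h2, ?_⟩
    have e : D.u i / 2 ^ k' = 2 * (D.u i / 2 ^ k) := by
      rw [hk', pow_succ]; field_simp
    have : 0 ≤ D.u i / m := by positivity
    change D.u i / 2 ^ k' ≤ _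
    rw [e]; linarith

/-- Convexity with weights `1 / 2` separates `2 * l` from the additive term. The latter is cheap by
Jensen: `u / m` is the average of the vectors `Pi.single i (u i)`, each of aggregate cost at most `2
* B`. -/
theorem f_le_of_le {l l' : Fin m → ℝ} (hl : 0 ≤ l) (hl' : 0 ≤ l') (hle : ∀ i, l' i ≤ 2 * l i + D.u i / m)
    (hB : D.f l ≤ D.B) : D.f l' ≤ 2 * 4 ^ p * D.B := by
  have hf := hD.aggregate
  have hp := hf.one_le
  have hm : (0 : ℝ) < m := Nat.cast_pos.2 hD.m_pos
  have hu : (0 : Fin m → ℝ) ≤ (1 / m : ℝ) • D.u := fun i => by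
    have := (hD.u_pos i).le
    simp only [Pi.zero_apply, Pi.smul_apply, smul_eq_mul]; positivity
  have h1 : D.f ((1 / m : ℝ) • D.u) ≤ 2 * D.B := by
    have e : (1 / m : ℝ) • D.u = ∑ i, (1 / m : ℝ) • (Pi.single i (D.u i) : Fin m → ℝ) := by
      rw [← Finset.smul_sum, Finset.univ_sum_single]
    rw [e]
    refine (hf.convex.map_sum_le (t := Finset.univ) (w := fun _ => (1 / m : ℝ))
      (fun i _ => by positivity) (by simp [hm.ne'])
      (fun i _ => Pi.single_nonneg.2 (hD.u_pos i).le)).trans ?_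
    calc _ ≤ ∑ _i : Fin m, (1 / m : ℝ) * (2 * D.B) := by
          refine Finset.sum_le_sum fun i _ => ?_
          rw [smul_eq_mul]
          exact mul_le_mul_of_nonneg_left (hD.f_u i) (by positivity)
      _ = 2 * D.B := by
          rw [Finset.sum_const, Finset.card_univ, Fintype.card_fin, nsmul_eq_mul]; field_simp
  have h2 : D.f ((2 : ℝ) • (1 / m : ℝ) • D.u) ≤ 2 ^ p * (2 * D.B) :=
    (hf.growth 2 _ one_le_two hu).trans (by gcongr)
  have h3 : D.f ((4 : ℝ) • l) ≤ 4 ^ p * D.B :=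
    (hf.growth 4 _ (by norm_num) hl).trans (by gcongr)
  have h4 : D.f l' ≤ D.f ((1 / 2 : ℝ) • ((4 : ℝ) • l) + (1 / 2 : ℝ) • ((2 : ℝ) • (1 / m : ℝ) • D.u)) := by
    refine hf.mono _ _ hl' fun i => (hle i).trans (le_of_eq ?_)
    simp only [Pi.add_apply, Pi.smul_apply, smul_eq_mul]
    ring
  have h5 := hf.convex.2 (x := (4 : ℝ) • l) (y := (2 : ℝ) • (1 / m : ℝ) • D.u)
    (smul_nonneg (by norm_num) hl) (smul_nonneg (by norm_num) hu)
    (by norm_num : (0 : ℝ) ≤ 1 / 2) (by norm_num : (0 : ℝ) ≤ 1 / 2) (by norm_num)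
  have h6 : (2 : ℝ) ^ p ≤ 4 ^ p := Real.rpow_le_rpow (by norm_num) (by norm_num) (by linarith)
  have h7 := mul_le_mul_of_nonneg_right h6 hD.B_pos.le
  have h8 := mul_nonneg (Real.rpow_nonneg (show (0 : ℝ) ≤ 4 by norm_num) p) hD.B_pos.le
  simp only [smul_eq_mul] at h5
  linarith

theorem f_zero_le {a : ℕ → Option (Fin m → ℝ≥0)} {n : ℕ} {τ : ℕ → Fin m}
    (hτ : D.f (activeLoad D.c a n τ) ≤ D.B) (h0 : 0 ≤ activeLoad D.c a n τ) : D.f 0 ≤ D.B :=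
  (hD.aggregate.mono _ _ le_rfl h0).trans hτ

end Valid

end Phase

theorem activeLoad_nonneg {m : ℕ} (c : Fin m → ℝ≥0) (a : ℕ → Option (Fin m → ℝ≥0)) (n : ℕ)
    (σ : ℕ → Fin m) : 0 ≤ activeLoad c a n σ := by
  classical
  intro i
  refine add_nonneg ?_ (Finset.sum_nonneg fun j _ => ?_) <;> split_ifs <;> simp

namespace Phase.Valid

variable {m : ℕ} {D : Phase m} {p : ℝ} (hD : D.Valid p)
include hD

/-- The expected aggregate cost of the copies bought. -/
theorem law_f_le {a : ℕ → Option (Fin m → ℝ≥0)} {n : ℕ} {τ : ℕ → Fin m}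
    (hτ : D.f (activeLoad D.c a n τ) ≤ D.B) :
    D.params.law (D.requests a) (n * D.K) D.f
      ≤ 7 * (16 * p * (D.K * (2 + Real.log (4 * (m * (m + 1)))))) ^ p * D.B := by
  classical
  set l := activeLoad D.c a n τ with hldef
  have hl0 : 0 ≤ l := activeLoad_nonneg _ _ _ _
  have hf := hD.aggregate
  have hp := hf.one_le
  choose k hk1 hk2 using fun i => hD.exists_level (hD.le_u l hl0 hτ i) (hl0 i)
  set l' : Fin m → ℝ := fun i => D.level i (k i) with hl'
  have hl'0 : 0 ≤ l' := fun i => (hD.level_pos i _).le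
  have hfl' := hD.f_le_of_le hl0 hl'0 hk2 hτ
  have hP := hD.params_valid
  -- The comparison solution: in each layer, one copy of each facility at the level to which its
  -- load under `τ` is rounded up.
  set O : Finset D.Resource :=
    (Finset.univ : Finset (Fin D.K × Fin m)).image fun x => (x.1, x.2, k x.2) with hO
  have hinj : Function.Injective fun x : Fin D.K × Fin m =>
      ((x.1, x.2, k x.2) : D.Resource) := by
    intro x x' h
    simp only [Prod.mk.injEq] at h
    exact Prod.ext h.1 h.2.1
  have hmR : (0 : ℝ) < m := Nat.cast_pos.2 hD.m_pos
  set σ : ℕ → D.Resource := fun t =>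
    (⟨t % D.K, Nat.mod_lt _ hD.K_pos⟩, τ (t / D.K), k (τ (t / D.K))) with hσ
  have hactive : ∀ t, (D.requests a t).avail.Nonempty → (a (t / D.K)).isSome := by
    rintro t ⟨s, hs⟩
    exact (D.mem_avail.1 hs).1
  have hσmem : ∀ t < n * D.K, (D.requests a t).avail.Nonempty →
      σ t ∈ (D.requests a t).avail ∧ σ t ∈ O := by
    intro t ht hne
    refine ⟨D.mem_avail.2 ⟨hactive t hne, rfl, ?_⟩,
      Finset.mem_image.2 ⟨(⟨t % D.K, Nat.mod_lt _ hD.K_pos⟩, τ (t / D.K)), Finset.mem_univ _, rfl⟩⟩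
    have hj : t / D.K < n := Nat.div_lt_of_lt_mul (by rwa [mul_comm])
    exact (le_activeLoad D.c τ hj (hactive t hne)).trans (hk1 (τ (t / D.K)))
  have hOsum : ∀ s ∈ O, ∑ t ∈ Finset.range (n * D.K),
      (if (D.requests a t).avail.Nonempty ∧ σ t = s then (D.requests a t).rate s else 0) ≤ 1 := by
    intro s hs
    obtain ⟨⟨κ, i⟩, -, rfl⟩ := Finset.mem_image.1 hs
    have hlev := hD.level_pos i (k i)
    have h1 : ∀ t ∈ Finset.range (n * D.K), (if (D.requests a t).avail.Nonempty ∧ σ t = (κ, i, k i)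
        then (D.requests a t).rate (κ, i, k i) else 0)
        ≤ if t % D.K = κ ∧ τ (t / D.K) = i then
          (((a (t / D.K)).getD 0 i : ℝ≥0) : ℝ) / D.level i (k i) else 0 := by
      intro t ht
      by_cases h : (D.requests a t).avail.Nonempty ∧ σ t = (κ, i, k i)
      · have hm := (hσmem t (Finset.mem_range.1 ht) h.1).1
        rw [h.2] at hm
        have h2 := h.2
        simp only [hσ, Prod.mk.injEq] at h2
        rw [if_pos h, if_pos ⟨by rw [← h2.1], h2.2.1⟩, hD.rate_eq hm]
      · rw [if_neg h]
        split_ifs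
        · exact div_nonneg (NNReal.coe_nonneg _) hlev.le
        · exact le_rfl
    refine (Finset.sum_le_sum h1).trans ?_
    rw [sum_range_mul_eq]
    have h2 : ∀ j, ∑ r ∈ Finset.range D.K, (if (j * D.K + r) % D.K = κ ∧ τ ((j * D.K + r) / D.K) = i
        then (((a ((j * D.K + r) / D.K)).getD 0 i : ℝ≥0) : ℝ) / D.level i (k i) else 0)
        = (if τ j = i then (((a j).getD 0 i : ℝ≥0) : ℝ) else 0) / D.level i (k i) := by
      intro j
      rw [Finset.sum_eq_single_of_mem (κ : ℕ) (Finset.mem_range.2 κ.2)]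
      · have e1 : (j * D.K + κ) / D.K = j := by
          rw [add_comm, Nat.add_mul_div_right _ _ hD.K_pos, Nat.div_eq_of_lt κ.2, zero_add]
        have e2 : (j * D.K + κ) % D.K = κ := by
          rw [add_comm, Nat.add_mul_mod_self_right, Nat.mod_eq_of_lt κ.2]
        rw [e1, e2]
        by_cases h : τ j = i <;> simp [h]
      · intro r hr hne
        rw [if_neg]
        rintro ⟨h, -⟩
        rw [add_comm, Nat.add_mul_mod_self_right, Nat.mod_eq_of_lt (Finset.mem_range.1 hr)] at h
        exact hne h
    simp only [h2]
    rw [← Finset.sum_div, div_le_one hlev]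
    refine le_trans ?_ (hk1 i)
    simp only [hldef, activeLoad]
    refine le_add_of_nonneg_left ?_
    split_ifs
    · exact NNReal.coe_nonneg _
    · exact le_rfl
  have hOl : ∀ z, 0 ≤ z → ∑ s ∈ O, (D.params.f (z + D.params.v s) - D.params.f z)
      ≤ (D.K : ℝ) * (D.params.f (z + l') - D.params.f z) := by
    intro z hz
    rw [hO, Finset.sum_image fun x _ x' _ h => hinj h, Fintype.sum_prod_type]
    have h1 := hf.sum_increment_le Finset.univ (fun i => (Pi.single i (l' i) : Fin m → ℝ))
      (fun i => Pi.single_nonneg.2 (hl'0 i)) hz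
    rw [Finset.univ_sum_single] at h1
    calc _ ≤ ∑ _κ : Fin D.K, (D.f (z + l') - D.f z) := Finset.sum_le_sum fun κ _ => h1
      _ = _ := by rw [Finset.sum_const, Finset.card_univ, Fintype.card_fin, nsmul_eq_mul]; rfl
  have hOB : (O.card : ℝ) * D.params.ε ≤ D.K * D.B := by
    rw [hO, Finset.card_image_of_injective _ hinj]
    simp only [params, Finset.card_univ, Fintype.card_prod, Fintype.card_fin, Nat.cast_mul]
    apply le_of_eq
    field_simp
  have hK : (1 : ℝ) ≤ D.K := Nat.one_le_cast.2 hD.K_pos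
  have key := hP.law_f_le (D.requests a) (n * D.K) σ O hσmem hOsum hK hl'0 hOl hOB
  have hy : 2 - Real.log D.params.y₀ = 2 + Real.log (4 * (m * (m + 1))) := by
    simp only [params, one_div, Real.log_inv, sub_neg_eq_add]
  rw [hy] at key
  set E : ℝ := D.K * (2 + Real.log (4 * (m * (m + 1)))) with hE
  have hlog : 0 ≤ Real.log (4 * (m * (m + 1))) := by
    have : (1 : ℝ) ≤ m := Nat.one_le_cast.2 hD.m_pos
    exact Real.log_nonneg (by nlinarith)
  have hE2 : 2 ≤ E := by rw [hE]; nlinarith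
  have hB := hD.B_pos
  have h0 : D.f 0 ≤ D.B := hD.f_zero_le hτ hl0
  have e1 : (16 * p * E) ^ p = 4 ^ p * (4 * p * E) ^ p := by
    rw [← Real.mul_rpow (by norm_num) (by positivity)]; ring_nf
  have hpE : E ≤ (16 * p * E) ^ p := by
    have h16 : E ≤ 16 * p * E := by nlinarith
    exact h16.trans (Real.self_le_rpow_of_one_le (by nlinarith) hp)
  have h3 : D.params.f l' ≤ 2 * 4 ^ p * D.B := hfl'
  have h4 : 0 ≤ (4 * p * E) ^ p := by positivity
  have h5 := mul_le_mul_of_nonneg_left h3 h4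
  have h6 : D.params.f 0 ≤ D.B := h0
  change D.params.law (D.requests a) (n * D.K) D.params.f ≤ _
  have h7 := mul_le_mul_of_nonneg_right hpE hB.le
  have h8 : 2 * D.B ≤ E * D.B := by nlinarith
  have h9 : (4 * p * E) ^ p * (2 * 4 ^ p * D.B) = 2 * ((16 * p * E) ^ p * D.B) := by
    rw [e1]; ring
  -- The constant `7`: the terms `2 * f 0`, `2 * E * B` and the power term contribute `1`, `2` and
  -- `4` multiples of `(16 * p * E) ^ p * B`.
  nlinarith

end Phase.Valid

/-! ### One phase: the randomized assignment and its expected cost -/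

/-- A facility that serves a client of costs `d` on its own at least aggregate cost. -/
noncomputable def cheapest {m : ℕ} [NeZero m] (f : (Fin m → ℝ) → ℝ) (c d : Fin m → ℝ≥0) : Fin m :=
  (Finite.exists_min fun i : Fin m => f (Pi.single i ((c i : ℝ) + d i))).choose

theorem cheapest_le {m : ℕ} [NeZero m] (f : (Fin m → ℝ) → ℝ) (c d : Fin m → ℝ≥0) (i : Fin m) :
    f (Pi.single (cheapest f c d) ((c (cheapest f c d) : ℝ) + d (cheapest f c d)))
      ≤ f (Pi.single i ((c i : ℝ) + d i)) :=
  (Finite.exists_min fun i : Fin m => f (Pi.single i ((c i : ℝ) + d i))).choose_spec i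

theorem prob_exists_le {Ω ι : Type*} [MeasurableSpace Ω] {μ : Measure Ω} [IsFiniteMeasure μ]
    (I : Finset ι) (A : ι → Set Ω) {r : ℝ} (h : ∀ i ∈ I, μ.real (A i) ≤ r) :
    μ.real (⋃ i ∈ I, A i) ≤ I.card * r := by
  refine (measureReal_biUnion_finset_le I A).trans ((Finset.sum_le_sum h).trans (le_of_eq ?_))
  rw [Finset.sum_const, nsmul_eq_mul]

namespace Phase

variable {m : ℕ} [NeZero m]

/-- A copy of `s` was bought and accepts client `j`. -/
def Candidate (D : Phase m) (a : ℕ → Option (Fin m → ℝ≥0)) (ω : ℕ → Block) (j : ℕ)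
    (s : D.Resource) : Prop :=
  ∃ t ∈ Finset.Ico (j * D.K) (j * D.K + D.K), ∃ t' ≤ t,
    D.params.Serves (D.requests a) t' t s (ω t')

open Classical in
/-- A facility of one of the resources in `Q`, or else the facility `i`. -/
noncomputable def select (D : Phase m) (i : Fin m) (Q : D.Resource → Prop) : Fin m :=
  if h : ∃ s, Q s then h.choose.2.1 else i

/-- The randomized online assignment. -/
noncomputable def assign (D : Phase m) (a : ℕ → Option (Fin m → ℝ≥0)) (ω : ℕ → Block) (j : ℕ) :
    Fin m :=
  D.select (cheapest D.f D.c ((a j).getD 0)) (D.Candidate a ω j)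

omit [NeZero m] in
theorem measurableSet_candidate (D : Phase m) (a : ℕ → Option (Fin m → ℝ≥0)) (j : ℕ)
    (s : D.Resource) : MeasurableSet {ω | D.Candidate a ω j s} := by
  have : {ω | D.Candidate a ω j s} = ⋃ t ∈ Finset.Ico (j * D.K) (j * D.K + D.K),
      ⋃ t' ∈ Finset.range (t + 1),
        (fun ω : ℕ → Block => ω t') ⁻¹' {b | D.params.Serves (D.requests a) t' t s b} := by
    ext ω
    simp only [Candidate, Set.mem_ofPred_eq, Set.mem_iUnion, Set.mem_preimage, Finset.mem_range,
      Nat.lt_succ_iff, exists_prop]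
  rw [this]
  exact Finset.measurableSet_biUnion _ fun t _ => Finset.measurableSet_biUnion _ fun t' _ =>
    (D.params.measurableSet_serves _ t' t s).preimage (measurable_pi_apply t')

omit [NeZero m] in
theorem measurable_candidate (D : Phase m) (a : ℕ → Option (Fin m → ℝ≥0)) (j : ℕ) :
    Measurable fun ω : ℕ → Block => D.Candidate a ω j :=
  measurable_pi_lambda _ fun s => measurableSet_setOfPred.1 (D.measurableSet_candidate a j s)

theorem measurable_assign (D : Phase m) (a : ℕ → Option (Fin m → ℝ≥0)) (j : ℕ) :
    Measurable fun ω : ℕ → Block => D.assign a ω j :=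
  (Measurable.of_discrete (f := D.select (cheapest D.f D.c ((a j).getD 0)))).comp
    (D.measurable_candidate a j)

/-- An active client is accepted by no copy. -/
def Fails (D : Phase m) (a : ℕ → Option (Fin m → ℝ≥0)) (j : ℕ) (ω : ℕ → Block) : Prop :=
  (a j).isSome ∧ ¬ ∃ s, D.Candidate a ω j s

omit [NeZero m] in
theorem measurableSet_fails (D : Phase m) (a : ℕ → Option (Fin m → ℝ≥0)) (j : ℕ) :
    MeasurableSet {ω | D.Fails a j ω} := by
  have : {ω | D.Fails a j ω} = {_ω | (a j).isSome} ∩ (⋃ s, {ω | D.Candidate a ω j s})ᶜ := by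
    ext ω; simp [Fails]
  rw [this]
  exact (MeasurableSet.const _).inter
    (MeasurableSet.iUnion fun s => D.measurableSet_candidate a j s).compl

/-- The total load vector of the copies bought. -/
noncomputable def boughtLoad (D : Phase m) (a : ℕ → Option (Fin m → ℝ≥0)) (n : ℕ)
    (ω : ℕ → Block) : Fin m → ℝ :=
  ∑ t ∈ Finset.range (n * D.K), D.params.load (D.params.bought (D.requests a) t (ω t).1)

/-- The load of a client that is accepted by no copy. -/
noncomputable def failLoad (D : Phase m) (a : ℕ → Option (Fin m → ℝ≥0)) (j : ℕ) : Fin m → ℝ :=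
  Pi.single (cheapest D.f D.c ((a j).getD 0)) ((D.c (cheapest D.f D.c ((a j).getD 0)) : ℝ)
    + ((a j).getD 0 (cheapest D.f D.c ((a j).getD 0)) : ℝ≥0))

namespace Valid

variable {D : Phase m} {p : ℝ} (hD : D.Valid p)
include hD

-- A copy is of a single resource, an assignment cost is its rate times the level, and the accepted
-- rates total at most `2`.
open Classical in
omit [NeZero m] in
theorem sum_served_le (a : ℕ → Option (Fin m → ℝ≥0)) (T t' : ℕ) (b : Block) (i : Fin m) :
    ∑ t ∈ Finset.range T, (if ∃ s : D.Resource, s.2.1 = i ∧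
      D.params.Serves (D.requests a) t' t s b then (((a (t / D.K)).getD 0 i : ℝ≥0) : ℝ) else 0)
      ≤ 2 * D.params.load (D.params.bought (D.requests a) t' b.1) i := by
  have hP := hD.params_valid
  rcases ho : D.params.bought (D.requests a) t' b.1 with _ | s
  · have : ∀ t, ¬ ∃ s : D.Resource, s.2.1 = i ∧ D.params.Serves (D.requests a) t' t s b := by
      rintro t ⟨s, -, hs⟩
      rw [FracParams.Serves, ho] at hs
      exact Option.some_ne_none _ hs.1.symm
    simp [this, FracParams.load]
  · by_cases hi : s.2.1 = i
    · have hl := hD.level_pos s.2.1 s.2.2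
      have e : D.params.load (some s) i = D.level s.2.1 s.2.2 := by
        simp [FracParams.load, params, ← hi]
      have h := D.params.sum_accepted_le (D.requests a) t' T s b.2
      rw [e, mul_comm]
      refine le_trans ?_ (mul_le_mul_of_nonneg_left h hl.le)
      rw [Finset.mul_sum]
      refine Finset.sum_le_sum fun t _ => ?_
      split_ifs with h1 h2 h2
      · have hs := h2.1.1.1
        rw [hD.rate_eq hs, mul_div_cancel₀ _ hl.ne', hi]
      · obtain ⟨s', -, hs'⟩ := h1
        have : s = s' := Option.some.inj (ho.symm.trans hs'.1)
        exact absurd (this ▸ hs'.2) h2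
      · exact mul_nonneg hl.le ((D.requests a t).rate_nonneg s)
      · simp
    · have : ∀ t, ¬ ∃ s : D.Resource, s.2.1 = i ∧
          D.params.Serves (D.requests a) t' t s b := by
        rintro t ⟨s', h', hs'⟩
        have : s = s' := Option.some.inj (ho.symm.trans hs'.1)
        exact hi (this ▸ h')
      simp only [this, if_false, Finset.sum_const_zero]
      exact mul_nonneg zero_le_two (hP.load_nonneg _ i)

-- The level of a serving copy covers the opening cost once, and the assignment costs it accepts are
-- at most twice the level; hence the factor `3`.
open Classical in
theorem activeLoad_assign_le (a : ℕ → Option (Fin m → ℝ≥0)) (n : ℕ) (ω : ℕ → Block) :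
    activeLoad D.c a n (D.assign a ω) ≤ (3 : ℝ) • D.boughtLoad a n ω
      + ∑ j ∈ Finset.range n, if D.Fails a j ω then D.failLoad a j else 0 := by
  have hP := hD.params_valid
  intro i
  set σ := D.assign a ω with hσ
  set cost : ℕ → ℝ := fun j => (((a j).getD 0 i : ℝ≥0) : ℝ) with hcost
  have hcost0 : ∀ j, 0 ≤ cost j := fun j => NNReal.coe_nonneg _
  have hc0 : (0 : ℝ) ≤ D.c i := NNReal.coe_nonneg _
  set T := n * D.K with hT
  set L : ℕ → ℝ := fun t' => D.params.load (D.params.bought (D.requests a) t' (ω t').1) i with hL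
  have hL0 : ∀ t', 0 ≤ L t' := fun t' => hP.load_nonneg _ i
  set term : ℕ → ℕ → ℝ := fun t' t => if ∃ s : D.Resource, s.2.1 = i ∧
      D.params.Serves (D.requests a) t' t s (ω t') then cost (t / D.K) else 0 with hterm
  have hterm0 : ∀ t' t, 0 ≤ term t' t := fun t' t => by
    simp only [hterm]; split_ifs
    · exact hcost0 _
    · exact le_rfl
  have hsplit : ∀ j < n, (a j).isSome → σ j = i → D.Fails a j ω ∨
      ∃ t' < T, ∃ r < D.K, ∃ s : D.Resource, s.2.1 = i ∧
        D.params.Serves (D.requests a) t' (j * D.K + r) s (ω t') := by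
    intro j hj ha hi
    by_cases h : ∃ s, D.Candidate a ω j s
    · right
      have e : σ j = h.choose.2.1 := by
        rw [hσ, assign, select, dif_pos h]
      obtain ⟨t, ht, t', ht', hs⟩ := h.choose_spec
      rw [Finset.mem_Ico] at ht
      have h1 : t < T := by
        have : (j + 1) * D.K ≤ n * D.K := Nat.mul_le_mul_right _ hj
        rw [Nat.succ_mul] at this
        omega
      refine ⟨t', by omega, t - j * D.K, by omega, h.choose, by rw [← e, hi], ?_⟩
      rwa [Nat.add_sub_cancel' ht.1]
    · exact Or.inl ⟨ha, h⟩
  set F : ℕ → ℝ := fun j => if D.Fails a j ω then D.failLoad a j i else 0 with hF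
  have hfail : ∀ j, D.Fails a j ω → σ j = i → D.failLoad a j i = D.c i + cost j := by
    intro j hj hi
    have e : σ j = cheapest D.f D.c ((a j).getD 0) := by
      rw [hσ, assign, select, dif_neg hj.2]
    rw [failLoad, ← e, hi, Pi.single_eq_same]
  have hfail0 : ∀ j, 0 ≤ D.failLoad a j i := fun j => by
    have : (0 : Fin m → ℝ) ≤ D.failLoad a j :=
      Pi.single_nonneg.2 (add_nonneg (NNReal.coe_nonneg _) (NNReal.coe_nonneg _))
    exact this i
  set Fd : ℕ → ℝ := fun j => if D.Fails a j ω ∧ σ j = i then cost j else 0 with hFd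
  set Fc : ℕ → ℝ := fun j => if D.Fails a j ω ∧ σ j = i then (D.c i : ℝ) else 0 with hFc
  have hFc0 : ∀ j, 0 ≤ Fc j := fun j => by
    simp only [hFc]; split_ifs
    · exact hc0
    · exact le_rfl
  have hFcd : ∀ j, Fc j + Fd j ≤ F j := fun j => by
    simp only [hF, hFc, hFd]
    by_cases h1 : D.Fails a j ω
    · by_cases h2 : σ j = i
      · simp only [h1, h2, and_self, if_true]; rw [hfail j h1 h2]
      · simpa [h1, h2] using hfail0 j
    · simp [h1]
  have hKdiv : ∀ j, ∀ r < D.K, (j * D.K + r) / D.K = j := fun j r hr => by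
    rw [add_comm, Nat.add_mul_div_right _ _ hD.K_pos, Nat.div_eq_of_lt hr, zero_add]
  have h1 : ∀ j ∈ Finset.range n, (if σ j = i then cost j else 0)
      ≤ (∑ r ∈ Finset.range D.K, ∑ t' ∈ Finset.range T, term t' (j * D.K + r)) + Fd j := by
    intro j hj
    have hS : 0 ≤ ∑ r ∈ Finset.range D.K, ∑ t' ∈ Finset.range T, term t' (j * D.K + r) :=
      Finset.sum_nonneg fun _ _ => Finset.sum_nonneg fun _ _ => hterm0 _ _
    have hFd0 : 0 ≤ Fd j := by
      simp only [hFd]; split_ifs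
      · exact hcost0 j
      · exact le_rfl
    split_ifs with hi
    · by_cases ha : (a j).isSome
      · rcases hsplit j (Finset.mem_range.1 hj) ha hi with hf | ⟨t', ht', r, hr, s, hs⟩
        · have : Fd j = cost j := if_pos ⟨hf, hi⟩
          linarith
        · have e : term t' (j * D.K + r) = cost j := by
            simp only [hterm]
            rw [if_pos ⟨s, hs⟩, hKdiv j r hr]
          have h2 : term t' (j * D.K + r) ≤ ∑ t' ∈ Finset.range T, term t' (j * D.K + r) :=
            Finset.single_le_sum (fun t' _ => hterm0 t' _) (Finset.mem_range.2 ht')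
          have h3 := Finset.single_le_sum
            (f := fun r => ∑ t' ∈ Finset.range T, term t' (j * D.K + r))
            (fun r _ => Finset.sum_nonneg fun t' _ => hterm0 t' _) (Finset.mem_range.2 hr)
          linarith
      · have : cost j = 0 := by
          simp only [Option.not_isSome_iff_eq_none] at ha
          simp [hcost, ha]
        linarith
    · linarith
  have h2 : ∑ j ∈ Finset.range n, ∑ r ∈ Finset.range D.K, ∑ t' ∈ Finset.range T,
      term t' (j * D.K + r) ≤ 2 * ∑ t' ∈ Finset.range T, L t' := by
    rw [← sum_range_mul_eq (fun t => ∑ t' ∈ Finset.range T, term t' t), Finset.sum_comm,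
      Finset.mul_sum]
    exact Finset.sum_le_sum fun t' _ => hD.sum_served_le a T t' (ω t') i
  have h3 : (if ∃ j < n, (a j).isSome ∧ σ j = i then (D.c i : ℝ) else 0)
      ≤ ∑ t' ∈ Finset.range T, L t' + ∑ j ∈ Finset.range n, Fc j := by
    have hS1 : 0 ≤ ∑ t' ∈ Finset.range T, L t' := Finset.sum_nonneg fun _ _ => hL0 _
    have hS2 : 0 ≤ ∑ j ∈ Finset.range n, Fc j := Finset.sum_nonneg fun _ _ => hFc0 _
    split_ifs with h
    · obtain ⟨j, hj, ha, hi⟩ := h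
      rcases hsplit j hj ha hi with hf | ⟨t', ht', r, hr, s, hsi, hs⟩
      · have e : Fc j = D.c i := if_pos ⟨hf, hi⟩
        have := Finset.single_le_sum (fun j _ => hFc0 j) (Finset.mem_range.2 hj)
        linarith
      · have hm := (D.mem_avail.1 hs.2.1.1.1).2.2
        have e : L t' = D.level i s.2.2 := by
          simp only [hL, hs.1]
          simp [FracParams.load, params, ← hsi]
        rw [hsi] at hm
        have hd : (0 : ℝ) ≤ ((a ((j * D.K + r) / D.K)).getD 0 i : ℝ≥0) := NNReal.coe_nonneg _
        have := Finset.single_le_sum (fun t _ => hL0 t) (Finset.mem_range.2 ht')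
        linarith
    · linarith
  have h4 := Finset.sum_le_sum h1
  rw [Finset.sum_add_distrib] at h4
  have h5 : ∑ j ∈ Finset.range n, Fc j + ∑ j ∈ Finset.range n, Fd j ≤ ∑ j ∈ Finset.range n, F j := by
    rw [← Finset.sum_add_distrib]
    exact Finset.sum_le_sum fun j _ => hFcd j
  have e : ((3 : ℝ) • D.boughtLoad a n ω
      + ∑ j ∈ Finset.range n, if D.Fails a j ω then D.failLoad a j else 0) i
      = 3 * ∑ t' ∈ Finset.range T, L t' + ∑ j ∈ Finset.range n, F j := by
    simp only [Pi.add_apply, Pi.smul_apply, smul_eq_mul, boughtLoad, Finset.sum_apply, hL, hF]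
    congr 1
    refine Finset.sum_congr rfl fun j _ => ?_
    split_ifs <;> rfl
  rw [e]
  simp only [activeLoad]
  change (if ∃ j < n, (a j).isSome ∧ σ j = i then (D.c i : ℝ) else 0)
    + ∑ j ∈ Finset.range n, (if σ j = i then cost j else 0) ≤ _
  linarith

-- Each of the `K` requests of the client has an available resource, the top level of facility `τ
-- j`, and they lie in distinct layers, so `fail_prob_le` applies.
omit [NeZero m] in
theorem fails_prob_le {a : ℕ → Option (Fin m → ℝ≥0)} {n : ℕ} {τ : ℕ → Fin m}
    (hτ : D.f (activeLoad D.c a n τ) ≤ D.B) {j : ℕ} (hj : j < n) :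
    seedMeasure.real {ω | D.Fails a j ω} ≤ Real.exp (-(D.K / 64)) := by
  by_cases ha : (a j).isSome
  · have hKdiv : ∀ t ∈ Finset.Ico (j * D.K) (j * D.K + D.K), t / D.K = j := fun t ht => by
      rw [Finset.mem_Ico] at ht
      rw [Nat.div_eq_iff hD.K_pos]
      have := Nat.mul_comm j D.K
      constructor
      · exact ht.1
      · have := hD.K_pos
        omega
    have hl0 := activeLoad_nonneg D.c a n τ
    have h := hD.params_valid.fail_prob_le (D.requests a) (n * D.K)
      (Finset.Ico (j * D.K) (j * D.K + D.K)) ?_ ?_ (fun t _ => hD.card_avail a t) ?_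
    · rw [Nat.card_Ico, Nat.add_sub_cancel_left] at h
      refine le_trans (measureReal_mono ?_) h
      rintro ω ⟨-, hω⟩ t' _ ⟨t, ht, s, hs⟩
      exact hω ⟨s, t, ht, t', hs.2.1.1.2.1, hs⟩
    · intro t ht
      rw [Finset.mem_Ico] at ht
      have : (j + 1) * D.K ≤ n * D.K := Nat.mul_le_mul_right _ hj
      rw [Nat.succ_mul] at this
      omega
    · intro t ht
      refine ⟨(⟨t % D.K, Nat.mod_lt _ hD.K_pos⟩, τ j, 0), D.mem_avail.2 ⟨?_, rfl, ?_⟩⟩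
      · rwa [hKdiv t ht]
      · rw [hKdiv t ht]
        refine (le_activeLoad D.c τ hj ha).trans ((hD.le_u _ hl0 hτ _).trans (le_of_eq ?_))
        simp [level]
    · intro t₁ h₁ t₂ h₂ s hs₁ hs₂
      have e := (D.mem_avail.1 hs₁).2.1.symm.trans (D.mem_avail.1 hs₂).2.1
      rw [← Nat.div_add_mod t₁ D.K, ← Nat.div_add_mod t₂ D.K, hKdiv t₁ h₁, hKdiv t₂ h₂, e]
  · have : {ω | D.Fails a j ω} = ∅ := by
      ext ω; simp [Fails, ha]
    rw [this, measureReal_empty]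
    exact (Real.exp_pos _).le

/-- Serving the client alone at `τ j` costs no more than the whole solution `τ`, and the cheapest
facility does no worse. -/
theorem f_failLoad_le {a : ℕ → Option (Fin m → ℝ≥0)} {n : ℕ} {τ : ℕ → Fin m}
    (hτ : D.f (activeLoad D.c a n τ) ≤ D.B) {j : ℕ} (hj : j < n) (ha : (a j).isSome) :
    D.f (D.failLoad a j) ≤ D.B := by
  refine (cheapest_le D.f D.c ((a j).getD 0) (τ j)).trans (le_trans ?_ hτ)
  refine hD.aggregate.mono _ _ (Pi.single_nonneg.2
    (add_nonneg (NNReal.coe_nonneg _) (NNReal.coe_nonneg _))) fun i => ?_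
  by_cases hi : i = τ j
  · subst hi
    rw [Pi.single_eq_same]
    exact le_activeLoad D.c τ hj ha
  · rw [Pi.single_eq_of_ne hi]
    exact activeLoad_nonneg D.c a n τ i

-- A crude bound on the event of some failure: the vector is an average of `n` loads dilated by `2 *
-- n`, each of aggregate cost at most `(2 * n) ^ p * B`.
open Classical in
theorem f_fail_le {a : ℕ → Option (Fin m → ℝ≥0)} {n : ℕ} (hn : 0 < n) {τ : ℕ → Fin m}
    (hτ : D.f (activeLoad D.c a n τ) ≤ D.B) (ω : ℕ → Block) :
    D.f ((2 : ℝ) • ∑ j ∈ Finset.range n, if D.Fails a j ω then D.failLoad a j else 0)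
      ≤ D.B + (2 * n) ^ p * D.B *
        (⋃ j ∈ Finset.range n, {ω | D.Fails a j ω}).indicator 1 ω := by
  have hf := hD.aggregate
  have h0 : D.f 0 ≤ D.B := hD.f_zero_le hτ (activeLoad_nonneg _ _ _ _)
  have hnR : (0 : ℝ) < n := Nat.cast_pos.2 hn
  have hn1 : (1 : ℝ) ≤ n := Nat.one_le_cast.2 hn
  by_cases hω : ω ∈ ⋃ j ∈ Finset.range n, {ω | D.Fails a j ω}
  · rw [Set.indicator_of_mem hω, Pi.one_apply, mul_one]
    set w : ℕ → Fin m → ℝ := fun j => if D.Fails a j ω then D.failLoad a j else 0 with hw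
    have hw0 : ∀ j, 0 ≤ w j := fun j => by
      simp only [hw]; split_ifs
      · exact Pi.single_nonneg.2 (add_nonneg (NNReal.coe_nonneg _) (NNReal.coe_nonneg _))
      · exact le_rfl
    have hfw : ∀ j ∈ Finset.range n, D.f (w j) ≤ D.B := fun j hj => by
      simp only [hw]; split_ifs with h
      · exact hD.f_failLoad_le hτ (Finset.mem_range.1 hj) h.1
      · exact h0
    have e : (2 : ℝ) • ∑ j ∈ Finset.range n, w j
        = ∑ j ∈ Finset.range n, (1 / n : ℝ) • ((2 * n : ℝ) • w j) := by
      rw [Finset.smul_sum]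
      refine Finset.sum_congr rfl fun j _ => ?_
      rw [smul_smul]
      congr 1
      field_simp
    change D.f ((2 : ℝ) • ∑ j ∈ Finset.range n, w j) ≤ _
    rw [e]
    refine (hf.convex.map_sum_le (w := fun _ => (1 / n : ℝ))
      (fun i _ => by positivity) (by simp [hnR.ne'])
      (fun i _ => smul_nonneg (by positivity) (hw0 i))).trans ?_
    have h1 : ∀ j ∈ Finset.range n, (1 / n : ℝ) • D.f ((2 * n : ℝ) • w j)
        ≤ (1 / n : ℝ) * ((2 * n) ^ p * D.B) := fun j hj => by
      rw [smul_eq_mul]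
      refine mul_le_mul_of_nonneg_left ?_ (by positivity)
      refine (hf.growth _ _ (by linarith) (hw0 j)).trans ?_
      exact mul_le_mul_of_nonneg_left (hfw j hj) (by positivity)
    refine (Finset.sum_le_sum h1).trans ?_
    rw [Finset.sum_const, Finset.card_range, nsmul_eq_mul, ← mul_assoc,
      mul_one_div_cancel hnR.ne', one_mul]
    linarith [hD.B_pos]
  · rw [Set.indicator_of_notMem hω, mul_zero, add_zero]
    have : ∑ j ∈ Finset.range n, (if D.Fails a j ω then D.failLoad a j else 0) = 0 := by
      refine Finset.sum_eq_zero fun j hj => if_neg fun h => hω ?_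
      simp only [Set.mem_iUnion]
      exact ⟨j, hj, h⟩
    rw [this, smul_zero]
    exact h0

omit hD in
theorem integrable_f_assign (D : Phase m) (a : ℕ → Option (Fin m → ℝ≥0)) (n : ℕ) :
    Integrable (fun ω => D.f (activeLoad D.c a n (D.assign a ω))) seedMeasure := by
  classical
  have hm : Measurable fun (ω : ℕ → Block) (j : Fin n) => D.assign a ω j :=
    measurable_pi_lambda _ fun j => D.measurable_assign a j
  have h := integrable_comp_discrete (μ := seedMeasure) hm (fun g => D.f (activeLoad D.c a n
    fun j => if h : j < n then g ⟨j, h⟩ else 0))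
  convert h using 3 with ω
  ext i
  simp only [activeLoad]
  congr 1
  · congr 1
    refine propext (exists_congr fun j => and_congr_right fun hj => ?_)
    rw [dif_pos hj]
  · refine Finset.sum_congr rfl fun j hj => ?_
    rw [dif_pos (Finset.mem_range.1 hj)]

omit [NeZero m] hD in
theorem integrable_f_boughtLoad (D : Phase m) (a : ℕ → Option (Fin m → ℝ≥0)) (n : ℕ) :
    Integrable (fun ω => D.f (D.boughtLoad a n ω)) seedMeasure := by
  classical
  have hm : Measurable fun (ω : ℕ → Block) (t : Finset.range (n * D.K)) =>
      D.params.bought (D.requests a) t (ω t).1 :=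
    measurable_pi_lambda _ fun t =>
      (D.params.measurable_bought _ t).comp (measurable_fst.comp (measurable_pi_apply _))
  have h := integrable_comp_discrete (μ := seedMeasure) hm
    (fun g => D.f (∑ t, D.params.load (g t)))
  convert h using 3 with ω
  exact (Finset.sum_coe_sort (Finset.range (n * D.K))
    fun t => D.params.load (D.params.bought (D.requests a) t (ω t).1)).symm

/-- Convexity splits the load into copies bought and failures. By `hK` some client fails with
probability at most `n * n ^ (-(p + 1)) = n ^ (-p)`, which cancels the `n ^ p` of `f_fail_le`. -/
theorem integral_f_assign_le {a : ℕ → Option (Fin m → ℝ≥0)} {n : ℕ} (hn : 0 < n) {τ : ℕ → Fin m}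
    (hτ : D.f (activeLoad D.c a n τ) ≤ D.B) (hK : (p + 1) * Real.log n ≤ D.K / 64) :
    ∫ ω, D.f (activeLoad D.c a n (D.assign a ω)) ∂seedMeasure
      ≤ (480 * p * (D.K * (2 + Real.log (4 * (m * (m + 1)))))) ^ p * D.B := by
  classical
  have hf := hD.aggregate
  have hp := hf.one_le
  have hB := hD.B_pos
  have hP := hD.params_valid
  have hnR : (0 : ℝ) < n := Nat.cast_pos.2 hn
  set A : Set (ℕ → Block) := ⋃ j ∈ Finset.range n, {ω | D.Fails a j ω} with hA
  have hAm : MeasurableSet A := Finset.measurableSet_biUnion _ fun j _ => D.measurableSet_fails a j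
  have hpt : ∀ ω, D.f (activeLoad D.c a n (D.assign a ω)) ≤ 6 ^ p / 2 * D.f (D.boughtLoad a n ω)
      + (D.B / 2 + (2 * n) ^ p * D.B / 2 * A.indicator 1 ω) := by
    intro ω
    set Z := D.boughtLoad a n ω with hZdef
    set W := ∑ j ∈ Finset.range n, (if D.Fails a j ω then D.failLoad a j else 0) with hWdef
    have hZ : 0 ≤ Z := Finset.sum_nonneg fun t _ => hP.load_nonneg _
    have hW : 0 ≤ W := Finset.sum_nonneg fun j _ => by
      split_ifs
      · exact Pi.single_nonneg.2 (add_nonneg (NNReal.coe_nonneg _) (NNReal.coe_nonneg _))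
      · exact le_rfl
    have h1 : D.f (activeLoad D.c a n (D.assign a ω))
        ≤ D.f ((1 / 2 : ℝ) • ((6 : ℝ) • Z) + (1 / 2 : ℝ) • ((2 : ℝ) • W)) := by
      refine hf.mono _ _ (activeLoad_nonneg _ _ _ _)
        ((hD.activeLoad_assign_le a n ω).trans (le_of_eq ?_))
      rw [smul_smul, smul_smul]
      norm_num
      rfl
    have h2 := hf.convex.2 (x := (6 : ℝ) • Z) (y := (2 : ℝ) • W)
      (smul_nonneg (by norm_num) hZ) (smul_nonneg (by norm_num) hW)
      (by norm_num : (0 : ℝ) ≤ 1 / 2) (by norm_num : (0 : ℝ) ≤ 1 / 2) (by norm_num)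
    have h3 := hf.growth 6 Z (by norm_num) hZ
    have h4 := hD.f_fail_le hn hτ ω
    simp only [smul_eq_mul] at h2
    linarith
  have hlaw : ∫ ω, D.f (D.boughtLoad a n ω) ∂seedMeasure
      = D.params.law (D.requests a) (n * D.K) D.f :=
    (hP.law_eq_integral (D.requests a) (n * D.K) D.f).symm
  have hi1 := (integrable_f_boughtLoad D a n).const_mul (6 ^ p / 2)
  have hi2 : Integrable (fun ω => (2 * n) ^ p * D.B / 2 * A.indicator (1 : (ℕ → Block) → ℝ) ω)
      seedMeasure := ((integrable_const (1 : ℝ)).indicator hAm).const_mul _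
  have hi3 : Integrable (fun ω => D.B / 2 + (2 * n) ^ p * D.B / 2 *
      A.indicator (1 : (ℕ → Block) → ℝ) ω) seedMeasure := (integrable_const _).add hi2
  have hprob : seedMeasure.real A ≤ n * Real.exp (-(D.K / 64)) := by
    have := prob_exists_le (μ := seedMeasure) (Finset.range n) (fun j => {ω | D.Fails a j ω})
      (fun j hj => hD.fails_prob_le hτ (Finset.mem_range.1 hj))
    rwa [Finset.card_range] at this
  have hexp : (2 * n : ℝ) ^ p * (n * Real.exp (-(D.K / 64))) ≤ 2 ^ p := by
    have e1 : (2 * n : ℝ) ^ p = 2 ^ p * n ^ p := Real.mul_rpow (by norm_num) hnR.le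
    have e2 : (n : ℝ) ^ p * n = Real.exp ((p + 1) * Real.log n) := by
      rw [← Real.rpow_add_one hnR.ne', Real.rpow_def_of_pos hnR, mul_comm]
    calc _ = 2 ^ p * ((n : ℝ) ^ p * n * Real.exp (-(D.K / 64))) := by rw [e1]; ring
      _ ≤ 2 ^ p * 1 := by
        rw [e2, ← Real.exp_add]
        gcongr
        rw [Real.exp_le_one_iff]
        linarith
      _ = _ := mul_one _
  have hlawle := hD.law_f_le hτ
  set E : ℝ := D.K * (2 + Real.log (4 * (m * (m + 1)))) with hE
  have hE2 : 2 ≤ E := by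
    have hlog : 0 ≤ Real.log (4 * (m * (m + 1))) := by
      have : (1 : ℝ) ≤ m := Nat.one_le_cast.2 hD.m_pos
      exact Real.log_nonneg (by nlinarith)
    have hK : (1 : ℝ) ≤ D.K := Nat.one_le_cast.2 hD.K_pos
    rw [hE]; nlinarith
  calc ∫ ω, D.f (activeLoad D.c a n (D.assign a ω)) ∂seedMeasure
      ≤ ∫ ω, (6 ^ p / 2 * D.f (D.boughtLoad a n ω)
        + (D.B / 2 + (2 * n) ^ p * D.B / 2 * A.indicator 1 ω)) ∂seedMeasure :=
        integral_mono (integrable_f_assign D a n) (hi1.add hi3) hpt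
    _ = 6 ^ p / 2 * D.params.law (D.requests a) (n * D.K) D.f
        + (D.B / 2 + (2 * n) ^ p * D.B / 2 * seedMeasure.real A) := by
        rw [integral_add hi1 hi3, integral_const_mul, hlaw, integral_add (integrable_const _) hi2,
          integral_const_mul, integral_indicator_one hAm, integral_const, probReal_univ, one_smul]
    _ ≤ 6 ^ p / 2 * (7 * (16 * p * E) ^ p * D.B) + (D.B / 2 + 2 ^ p * D.B / 2) := by
        have h6 : (0 : ℝ) ≤ 6 ^ p / 2 := by positivity
        have h1 : (2 * n : ℝ) ^ p * seedMeasure.real A ≤ 2 ^ p :=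
          le_trans (mul_le_mul_of_nonneg_left hprob (by positivity)) hexp
        have h2 := mul_le_mul_of_nonneg_right h1 hB.le
        have h3 := mul_le_mul_of_nonneg_left hlawle h6
        linarith
    _ ≤ 5 * (96 * p * E) ^ p * D.B := by
        have e1 : (96 * p * E) ^ p = 6 ^ p * (16 * p * E) ^ p := by
          rw [← Real.mul_rpow (by norm_num) (by positivity)]; ring_nf
        have hpE : 2 ≤ p * E := by nlinarith
        have h1 : (2 : ℝ) ^ p ≤ (96 * p * E) ^ p :=
          Real.rpow_le_rpow (by norm_num) (by nlinarith) (by linarith)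
        have h2 : (1 : ℝ) ≤ 2 ^ p := Real.one_le_rpow (by norm_num) (by linarith)
        rw [e1] at h1 ⊢
        have h3 := mul_le_mul_of_nonneg_right h1 hB.le
        have h4 := mul_le_mul_of_nonneg_right h2 hB.le
        nlinarith
    _ ≤ (480 * p * E) ^ p * D.B := by
        have e1 : (480 * p * E) ^ p = 5 ^ p * (96 * p * E) ^ p := by
          rw [← Real.mul_rpow (by norm_num) (by positivity)]; ring_nf
        have h5 : (5 : ℝ) ≤ 5 ^ p := Real.self_le_rpow_of_one_le (by norm_num) hp
        rw [e1]
        gcongr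

end Valid

end Phase

/-! ### Dependence on past clients only -/

section Causality

variable {m : ℕ} {S : Type*} [Fintype S]

theorem FracParams.bought_congr (P : FracParams m S) {q q' : ℕ → Request S} {t : ℕ}
    (h : ∀ i ≤ t, q i = q' i) (b : unitInterval) : P.bought q t b = P.bought q' t b := by
  rw [bought, bought, y, y, y, y, P.process_congr fun i hi => h i (Nat.lt_succ_iff.1 hi),
    P.process_congr fun i hi => h i hi.le]

theorem FracParams.wants_congr (P : FracParams m S) {q q' : ℕ → Request S} {T t' t : ℕ}
    (h : ∀ i ≤ T, q i = q' i) (ht' : t' ≤ T) (ht : t ≤ T) (s : S) (b : unitInterval) :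
    P.Wants q t' t s b ↔ P.Wants q' t' t s b := by
  rw [Wants, Wants, P.x_congr fun i hi => h i (hi.trans ht), h t ht, y, y, y, y,
    P.process_congr (t := t + 1) fun i hi => h i (by omega),
    P.process_congr (t := t' + 1) fun i hi => h i (by omega)]

theorem FracParams.serves_congr (P : FracParams m S) {q q' : ℕ → Request S} {t' t : ℕ}
    (h : ∀ i ≤ t, q i = q' i) (ht' : t' ≤ t) (s : S) (b : Block) :
    P.Serves q t' t s b ↔ P.Serves q' t' t s b := by
  have hu : P.usage q t' t s b.2 = P.usage q' t' t s b.2 := by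
    refine Finset.sum_congr rfl fun i hi => ?_
    have hi' := (Finset.mem_range.1 hi).le
    rw [h i hi']
    have hw := P.wants_congr h ht' hi' s (b.2 i)
    by_cases h1 : P.Wants q t' i s (b.2 i)
    · rw [if_pos h1, if_pos (hw.1 h1)]
    · rw [if_neg h1, if_neg fun h2 => h1 (hw.2 h2)]
  rw [Serves, Serves, Accepts, Accepts, P.bought_congr fun i hi => h i (hi.trans ht'),
    P.wants_congr h ht' le_rfl, hu]

/-- The decision on client `j` uses requests before time `j * K + K` only, and these come from
clients up to `j`. -/
theorem Phase.assign_congr [NeZero m] (D : Phase m) {a a' : ℕ → Option (Fin m → ℝ≥0)} {j : ℕ} (h : ∀ i ≤ j, a i = a' i) (ω : ℕ → Block) :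
    D.assign a ω j = D.assign a' ω j := by
  have hq : ∀ t < j * D.K + D.K, D.requests a t = D.requests a' t := by
    intro t ht
    rw [requests, requests, h]
    exact Nat.lt_succ_iff.1 (Nat.div_lt_of_lt_mul (by rwa [Nat.mul_succ, mul_comm D.K]))
  have hc : D.Candidate a ω j = D.Candidate a' ω j := by
    ext s
    refine exists_congr fun t => and_congr_right fun ht => exists_congr fun t' =>
      and_congr_right fun ht' => ?_
    rw [Finset.mem_Ico] at ht
    exact D.params.serves_congr (fun i hi => hq i (by omega)) ht' s _
  rw [assign, assign, h j le_rfl, hc]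

end Causality

/-! ### Comparison of loads and optima -/

section Loads

variable {m : ℕ}

theorem facilityCost_eq_activeLoad (c : Fin m → ℝ≥0) (n : ℕ) (d : ℕ → Fin m → ℝ≥0)
    (σ : ℕ → Fin m) :
    facilityCost c (fun k : Fin n => d k) (fun k : Fin n => σ k)
      = activeLoad c (fun j => some (d j)) n σ := by
  classical
  ext i
  simp only [facilityCost, activeLoad, Option.isSome_some, true_and, Option.getD_some]
  congr 1
  · have : (∃ k : Fin n, σ k = i) ↔ ∃ j < n, σ j = i :=
      ⟨fun ⟨k, hk⟩ => ⟨k, k.2, hk⟩, fun ⟨j, hj, h⟩ => ⟨⟨j, hj⟩, h⟩⟩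
    simp only [this]
  · rw [Finset.sum_filter, ← Fin.sum_univ_eq_sum_range
      (fun j => if σ j = i then ((d j i : ℝ≥0) : ℝ) else 0)]

theorem activeLoad_le_activeLoad (c : Fin m → ℝ≥0) {a a' : ℕ → Option (Fin m → ℝ≥0)} {n n' : ℕ}
    (σ : ℕ → Fin m) (h : ∀ j < n, (a j).isSome → j < n' ∧ a' j = a j) :
    activeLoad c a n σ ≤ activeLoad c a' n' σ := by
  classical
  intro i
  simp only [activeLoad]
  refine add_le_add ?_ ?_
  · split_ifs with h1 h2 h2
    · exact le_rfl
    · obtain ⟨j, hj, ha, hi⟩ := h1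
      exact absurd ⟨j, (h j hj ha).1, by rwa [(h j hj ha).2], hi⟩ h2
    · exact NNReal.coe_nonneg _
    · exact le_rfl
  · have hnn : ∀ j, 0 ≤ if σ j = i then (((a' j).getD 0 i : ℝ≥0) : ℝ) else 0 := fun j => by
      split_ifs
      · exact NNReal.coe_nonneg _
      · exact le_rfl
    have e : ∑ j ∈ Finset.range n, (if σ j = i then (((a j).getD 0 i : ℝ≥0) : ℝ) else 0)
        = ∑ j ∈ (Finset.range n).filter (fun j => (a j).isSome),
          (if σ j = i then (((a j).getD 0 i : ℝ≥0) : ℝ) else 0) := by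
      refine (Finset.sum_filter_of_ne fun j _ hne => ?_).symm
      by_contra hn
      simp only [Option.not_isSome_iff_eq_none] at hn
      simp [hn] at hne
    rw [e]
    refine le_trans (le_of_eq (Finset.sum_congr rfl fun j hj => ?_))
      (Finset.sum_le_sum_of_subset_of_nonneg (t := Finset.range n') (fun j hj => ?_)
        (fun j _ _ => hnn j))
    · rw [Finset.mem_filter, Finset.mem_range] at hj
      rw [(h j hj.1 hj.2).2]
    · rw [Finset.mem_filter, Finset.mem_range] at hj
      exact Finset.mem_range.2 (h j hj.1 hj.2).1

/-- Every client is handled by one of the runs or costs nothing. Several runs may open the same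
facility, so there is only an inequality. -/
theorem activeLoad_le_sum (c : Fin m → ℝ≥0) {ι : Type*} (I : Finset ι)
    (a : ι → ℕ → Option (Fin m → ℝ≥0)) (σ' : ι → ℕ → Fin m) (d : ℕ → Fin m → ℝ≥0) (n : ℕ)
    (σ : ℕ → Fin m) (h : ∀ j < n, (∃ k ∈ I, a k j = some (d j) ∧ σ' k j = σ j) ∨
      (c (σ j) = 0 ∧ d j (σ j) = 0)) :
    activeLoad c (fun j => some (d j)) n σ ≤ ∑ k ∈ I, activeLoad c (a k) n (σ' k) := by
  classical
  intro i
  rw [Finset.sum_apply]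
  simp only [activeLoad, Option.isSome_some, true_and, Option.getD_some]
  rw [Finset.sum_add_distrib]
  have hnn : ∀ k j, 0 ≤ if σ' k j = i then (((a k j).getD 0 i : ℝ≥0) : ℝ) else 0 := fun k j => by
    split_ifs
    · exact NNReal.coe_nonneg _
    · exact le_rfl
  have hcn : ∀ k, 0 ≤ if ∃ j < n, (a k j).isSome ∧ σ' k j = i then (c i : ℝ) else 0 := fun k => by
    split_ifs
    · exact NNReal.coe_nonneg _
    · exact le_rfl
  refine add_le_add ?_ ?_
  · have hs : 0 ≤ ∑ k ∈ I, if ∃ j < n, (a k j).isSome ∧ σ' k j = i then (c i : ℝ) else 0 :=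
      Finset.sum_nonneg fun k _ => hcn k
    split_ifs with h1
    · obtain ⟨j, hj, rfl⟩ := h1
      rcases h j hj with ⟨k, hk, ha, hσ⟩ | h0
      · refine le_trans (le_of_eq ?_) (Finset.single_le_sum (fun k _ => hcn k) hk)
        rw [if_pos ⟨j, hj, by simp [ha], hσ⟩]
      · refine le_trans (le_of_eq ?_) hs
        rw [h0.1, NNReal.coe_zero]
    · exact hs
  · rw [Finset.sum_comm]
    refine Finset.sum_le_sum fun j hj => ?_
    have hs : 0 ≤ ∑ k ∈ I, if σ' k j = i then (((a k j).getD 0 i : ℝ≥0) : ℝ) else 0 :=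
      Finset.sum_nonneg fun k _ => hnn k j
    split_ifs with hi
    · subst hi
      rcases h j (Finset.mem_range.1 hj) with ⟨k, hk, ha, hσ⟩ | h0
      · refine le_trans (le_of_eq ?_) (Finset.single_le_sum (fun k _ => hnn k j) hk)
        rw [if_pos hσ, ha, Option.getD_some]
      · rw [h0.2]; exact hs
    · exact hs

/-- The optimum for the first `n` clients. -/
noncomputable def optPrefix (f : (Fin m → ℝ) → ℝ) (c : Fin m → ℝ≥0) (d : ℕ → Fin m → ℝ≥0)
    (n : ℕ) : ℝ :=
  opt f c fun k : Fin n => d k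

variable {f : (Fin m → ℝ) → ℝ} {c : Fin m → ℝ≥0}

theorem optPrefix_congr {d d' : ℕ → Fin m → ℝ≥0} {n : ℕ} (h : ∀ j < n, d j = d' j) :
    optPrefix f c d n = optPrefix f c d' n := by
  have : (fun k : Fin n => d k) = fun k : Fin n => d' k := funext fun k => h k k.2
  rw [optPrefix, this, optPrefix]

theorem exists_eq_optPrefix [NeZero m] (d : ℕ → Fin m → ℝ≥0) (n : ℕ) :
    ∃ τ : ℕ → Fin m, f (activeLoad c (fun j => some (d j)) n τ) = optPrefix f c d n := by
  obtain ⟨σ, hσ⟩ := exists_eq_ciInf_of_finite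
    (f := fun σ : Fin n → Fin m => f (facilityCost c (fun k : Fin n => d k) σ))
  refine ⟨fun j => if h : j < n then σ ⟨j, h⟩ else 0, ?_⟩
  rw [← facilityCost_eq_activeLoad, optPrefix, opt, ← hσ]
  simp

theorem optPrefix_le (d : ℕ → Fin m → ℝ≥0) (n : ℕ) (τ : ℕ → Fin m) :
    optPrefix f c d n ≤ f (activeLoad c (fun j => some (d j)) n τ) := by
  rw [← facilityCost_eq_activeLoad]
  exact ciInf_le (Set.finite_range _).bddBelow (fun k : Fin n => τ k)

theorem Aggregate.optPrefix_mono [NeZero m] {p : ℝ} (hf : Aggregate p f) (d : ℕ → Fin m → ℝ≥0)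
    {n n' : ℕ} (h : n ≤ n') : optPrefix f c d n ≤ optPrefix f c d n' := by
  obtain ⟨τ, hτ⟩ := exists_eq_optPrefix (f := f) (c := c) d n'
  rw [← hτ]
  refine (optPrefix_le d n τ).trans (hf.mono _ _ (activeLoad_nonneg _ _ _ _) ?_)
  exact activeLoad_le_activeLoad c τ fun j hj _ => ⟨hj.trans_le h, rfl⟩

theorem Aggregate.f_zero_le_optPrefix [NeZero m] {p : ℝ} (hf : Aggregate p f)
    (d : ℕ → Fin m → ℝ≥0) (n : ℕ) : f 0 ≤ optPrefix f c d n := by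
  obtain ⟨τ, hτ⟩ := exists_eq_optPrefix (f := f) (c := c) d n
  rw [← hτ]
  exact hf.mono _ _ le_rfl (activeLoad_nonneg _ _ _ _)

end Loads

/-! ### Load bounds and sums of phases -/

section Unbounded

variable {m : ℕ} {f : (Fin m → ℝ) → ℝ} {p : ℝ}

/-- Every single coordinate can increase `f`. -/
def Nonflat (f : (Fin m → ℝ) → ℝ) : Prop :=
  ∀ i, ∃ t : ℝ, 0 ≤ t ∧ f 0 < f (Pi.single i t)

/-- By convexity a strict increase along an axis continues at least linearly, so `f` is unbounded
there; the intermediate value theorem does the rest. -/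
theorem Aggregate.exists_f_single_eq (hf : Aggregate p f) (hn : Nonflat f) (i : Fin m) {b : ℝ}
    (hb : f 0 ≤ b) : ∃ u : ℝ, 0 ≤ u ∧ f (Pi.single i u) = b := by
  obtain ⟨t, ht0, ht⟩ := hn i
  set δ := f (Pi.single i t) - f 0 with hδ
  have hδ0 : 0 < δ := sub_pos.2 ht
  set s : ℝ := max 1 ((b - f 0) / δ) with hs
  have hs1 : 1 ≤ s := le_max_left _ _
  have hs0 : 0 < s := by linarith
  have hbig : b ≤ f (Pi.single i (s * t)) := by
    have h := hf.convex.2 (x := Pi.single i (s * t)) (y := 0)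
      (Pi.single_nonneg.2 (mul_nonneg hs0.le ht0)) (Set.mem_Ici.2 le_rfl)
      (inv_nonneg.2 hs0.le) (sub_nonneg.2 (inv_le_one_of_one_le₀ hs1)) (by ring)
    have e : s⁻¹ • (Pi.single i (s * t) : Fin m → ℝ) + (1 - s⁻¹) • (0 : Fin m → ℝ)
        = Pi.single i t := by
      rw [smul_zero, add_zero, ← Pi.single_smul, smul_eq_mul, inv_mul_cancel_left₀ hs0.ne']
    rw [e, smul_eq_mul, smul_eq_mul] at h
    have h2 : (b - f 0) / δ ≤ s := le_max_right _ _
    rw [div_le_iff₀ hδ0] at h2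
    have h3 : s * δ ≤ f (Pi.single i (s * t)) - f 0 := by
      have h4 : s * f (Pi.single i t) ≤ s * (s⁻¹ * f (Pi.single i (s * t)) + (1 - s⁻¹) * f 0) := by
        gcongr
      have h5 : s * (s⁻¹ * f (Pi.single i (s * t)) + (1 - s⁻¹) * f 0)
          = f (Pi.single i (s * t)) + (s - 1) * f 0 := by
        field_simp
      rw [h5] at h4
      rw [hδ]; linarith
    linarith
  have hc : ContinuousOn (fun r : ℝ => f (Pi.single i r)) (Set.Icc 0 (s * t)) := by
    refine hf.continuousOn.comp ?_ fun r hr => Set.mem_Ici.2 (Pi.single_nonneg.2 hr.1)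
    exact (continuous_single (A := fun _ : Fin m => ℝ) i).continuousOn
  obtain ⟨u, hu, hfu⟩ := intermediate_value_Icc (mul_nonneg hs0.le ht0) hc
    (show b ∈ Set.Icc _ _ from ⟨by simpa using hb, hbig⟩)
  exact ⟨u, hu.1, hfu⟩

theorem Aggregate.f_single_le (hf : Aggregate p f) {x : Fin m → ℝ} (hx : 0 ≤ x) (i : Fin m) :
    f (Pi.single i (x i)) ≤ f x := by
  refine hf.mono _ _ (Pi.single_nonneg.2 (hx i)) fun j => ?_
  by_cases h : j = i
  · subst h; simp
  · rw [Pi.single_eq_of_ne h]; exact hx j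

/-- By the growth bound, a nonpositive value at one positive load of facility `i` would force
nonpositive values on the whole half-axis. -/
theorem Aggregate.eq_zero_of_f_le_zero (hf : Aggregate p f) (hn : Nonflat f) {x : Fin m → ℝ}
    (hx : 0 ≤ x) (h : f x ≤ 0) : x = 0 := by
  by_contra hne
  obtain ⟨i, hi⟩ := Function.ne_iff.1 hne
  have hi0 : 0 < x i := lt_of_le_of_ne (hx i) (Ne.symm hi)
  obtain ⟨t, ht0, ht⟩ := hn i
  have h1 : f (Pi.single i t) ≤ (max 1 (t / x i)) ^ p * f (Pi.single i (x i)) := by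
    refine hf.le_rpow_mul (le_max_left _ _) (Pi.single_nonneg.2 hi0.le)
      (Pi.single_nonneg.2 ht0) ?_
    rw [← Pi.single_smul, smul_eq_mul]
    refine Pi.single_mono i ?_
    rw [← div_le_iff₀ hi0]
    exact le_max_right _ _
  have h2 : f (Pi.single i (x i)) ≤ 0 := (hf.f_single_le hx i).trans h
  have h3 : (max 1 (t / x i)) ^ p * f (Pi.single i (x i)) ≤ 0 :=
    mul_nonpos_of_nonneg_of_nonpos (Real.rpow_nonneg (by positivity) _) h2
  linarith [hf.nonneg 0 le_rfl]

/-- The load `u i` is one at which facility `i` alone costs `2 * B`. Aiming at `2 * B` keeps `u i`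
positive even if `f 0 = B`, and any larger load costs strictly more than `B`. -/
theorem Aggregate.exists_bounds (hf : Aggregate p f) (hn : Nonflat f) {B : ℝ} (hB : 0 < B)
    (h0 : f 0 ≤ B) : ∃ u : Fin m → ℝ, (∀ i, 0 < u i) ∧ (∀ i, f (Pi.single i (u i)) ≤ 2 * B) ∧
      ∀ x, 0 ≤ x → f x ≤ B → ∀ i, x i ≤ u i := by
  choose u hu0 hu using fun i => hf.exists_f_single_eq hn i (b := 2 * B) (by linarith)
  refine ⟨u, fun i => lt_of_le_of_ne (hu0 i) fun h => ?_, fun i => (hu i).le, fun x hx hfx i => ?_⟩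
  · have := hu i
    rw [← h, Pi.single_zero] at this
    linarith
  · by_contra hlt
    have h1 : f (Pi.single i (u i)) ≤ f (Pi.single i (x i)) :=
      hf.mono _ _ (Pi.single_nonneg.2 (hu0 i)) (Pi.single_mono i (not_le.1 hlt).le)
    have h2 := hf.f_single_le hx i
    have := hu i
    linarith

/-- Weighted convexity with weights that decrease geometrically. -/
theorem Aggregate.f_sum_le (hf : Aggregate p f) (I : Finset ℕ) (v : ℕ → Fin m → ℝ)
    (hv : ∀ k, 0 ≤ v k) :
    f (∑ k ∈ I, v k) ≤ f 0 + ∑ k ∈ I, (2 : ℝ) ^ ((k + 1) * (p - 1)) * f (v k) := by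
  have hp := hf.one_le
  set w : ℕ → ℝ := fun k => (1 / 2 : ℝ) ^ (k + 1) with hw
  have hw0 : ∀ k, 0 < w k := fun k => by simp only [hw]; positivity
  have hsum : ∑ k ∈ I, w k ≤ 1 := by
    obtain ⟨N, hN⟩ : ∃ N, I ⊆ Finset.range N := Finset.exists_nat_subset_range I
    have h1 : ∀ N, ∑ k ∈ Finset.range N, w k = 1 - (1 / 2) ^ N := by
      intro N
      induction N with
      | zero => simp
      | succ N ih => rw [Finset.sum_range_succ, ih]; simp only [hw]; ring
    refine (Finset.sum_le_sum_of_subset_of_nonneg hN fun k _ _ => (hw0 k).le).trans ?_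
    rw [h1]
    have : (0 : ℝ) ≤ (1 / 2) ^ N := by positivity
    linarith
  have h0 := hf.nonneg 0 le_rfl
  have h := hf.convex.map_add_sum_le (t := I) (w := w) (p := fun k => (2 : ℝ) ^ (k + 1) • v k)
    (v := 1 - ∑ k ∈ I, w k) (q := 0) (fun k _ => (hw0 k).le) (by ring)
    (fun k _ => smul_nonneg (by positivity) (hv k)) (sub_nonneg.2 hsum) (Set.mem_Ici.2 le_rfl)
  have e : (1 - ∑ k ∈ I, w k) • (0 : Fin m → ℝ) + ∑ k ∈ I, w k • (2 : ℝ) ^ (k + 1) • v k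
      = ∑ k ∈ I, v k := by
    rw [smul_zero, zero_add]
    refine Finset.sum_congr rfl fun k _ => ?_
    rw [smul_smul]
    simp only [hw]
    rw [← mul_pow]
    norm_num
  rw [e] at h
  refine h.trans (add_le_add ?_ (Finset.sum_le_sum fun k _ => ?_))
  · rw [smul_eq_mul]
    refine mul_le_of_le_one_left h0 ?_
    linarith [Finset.sum_nonneg fun k (_ : k ∈ I) => (hw0 k).le]
  · rw [smul_eq_mul]
    have hg := hf.growth ((2 : ℝ) ^ (k + 1)) (v k) (one_le_pow₀ one_le_two) (hv k)
    refine (mul_le_mul_of_nonneg_left hg (hw0 k).le).trans (le_of_eq ?_)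
    rw [← mul_assoc]
    congr 1
    simp only [hw]
    rw [one_div, inv_pow, ← Real.rpow_natCast, ← Real.rpow_mul zero_le_two,
      ← Real.rpow_neg zero_le_two, ← Real.rpow_add two_pos]
    push_cast
    ring_nf

end Unbounded

/-! ### Guessing the optimum -/

/-- The guess for the optimum in phase `k`. -/
noncomputable def phaseBound (p : ℝ) (k : ℤ) : ℝ := 2 ^ (p * k)

theorem phaseBound_pos (p : ℝ) (k : ℤ) : 0 < phaseBound p k := Real.rpow_pos_of_pos two_pos _

/-- The number of layers. -/
noncomputable def layers (p : ℝ) (n : ℕ) : ℕ := ⌈64 * (p + 1) * max 1 (Real.log n)⌉₊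

open Classical in
/-- Upper bounds on the loads of solutions of aggregate cost `B`. -/
noncomputable def upperBound {m : ℕ} (f : (Fin m → ℝ) → ℝ) (B : ℝ) : Fin m → ℝ :=
  if h : ∃ u : Fin m → ℝ, (∀ i, 0 < u i) ∧ (∀ i, f (Pi.single i (u i)) ≤ 2 * B) ∧
      ∀ x, 0 ≤ x → f x ≤ B → ∀ i, x i ≤ u i then h.choose else 1

/-- The data of phase `k`. -/
noncomputable def phaseData {m : ℕ} (f : (Fin m → ℝ) → ℝ) (c : Fin m → ℝ≥0) (p : ℝ) (n : ℕ)
    (k : ℤ) : Phase m where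
  f := f
  c := c
  u := upperBound f (phaseBound p k)
  B := phaseBound p k
  K := layers p n

/-- The phase of client `j`, according to the optimum of the clients up to `j`. -/
noncomputable def phaseIndex {m : ℕ} (f : (Fin m → ℝ) → ℝ) (c : Fin m → ℝ≥0) (p : ℝ)
    (d : ℕ → Fin m → ℝ≥0) (j : ℕ) : ℤ :=
  ⌈Real.logb 2 (optPrefix f c d (j + 1)) / p⌉

open Classical in
/-- The clients of phase `k`. -/
noncomputable def phaseClients {m : ℕ} (f : (Fin m → ℝ) → ℝ) (c : Fin m → ℝ≥0) (p : ℝ)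
    (d : ℕ → Fin m → ℝ≥0) (k : ℤ) (j : ℕ) : Option (Fin m → ℝ≥0) :=
  if 0 < optPrefix f c d (j + 1) ∧ phaseIndex f c p d j = k then some (d j) else none

open Classical in
/-- The online assignment that runs the algorithm afresh in each phase. -/
noncomputable def onlineAssign {m : ℕ} [NeZero m] (f : (Fin m → ℝ) → ℝ) (c : Fin m → ℝ≥0) (p : ℝ)
    (n : ℕ) (d : ℕ → Fin m → ℝ≥0) (ω : ℕ → Block) (j : ℕ) : Fin m :=
  if 0 < optPrefix f c d (j + 1) then
    (phaseData f c p n (phaseIndex f c p d j)).assign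
      (phaseClients f c p d (phaseIndex f c p d j)) ω j
  else cheapest f c (d j)

/-- The costs `h`, continued by zero. -/
def extend {m a : ℕ} (h : Fin a → Fin m → ℝ≥0) (k : ℕ) : Fin m → ℝ≥0 :=
  if hk : k < a then h ⟨k, hk⟩ else 0

section

variable {m : ℕ} [NeZero m] {f : (Fin m → ℝ) → ℝ} {c : Fin m → ℝ≥0} {p : ℝ}

theorem onlineAssign_congr (n : ℕ) {d d' : ℕ → Fin m → ℝ≥0} {j : ℕ}
    (h : ∀ i ≤ j, d i = d' i) (ω : ℕ → Block) :
    onlineAssign f c p n d ω j = onlineAssign f c p n d' ω j := by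
  have ho : ∀ i ≤ j, optPrefix f c d (i + 1) = optPrefix f c d' (i + 1) := fun i hi =>
    optPrefix_congr fun i' hi' => h i' (by omega)
  have hk : ∀ i ≤ j, phaseIndex f c p d i = phaseIndex f c p d' i := fun i hi => by
    rw [phaseIndex, phaseIndex, ho i hi]
  rw [onlineAssign, onlineAssign, ho j le_rfl, hk j le_rfl, h j le_rfl,
    Phase.assign_congr _ (a' := phaseClients f c p d' (phaseIndex f c p d' j))]
  intro i hi
  rw [phaseClients, phaseClients, ho i hi, hk i hi, h i hi]

theorem measurable_onlineAssign (n : ℕ) (d : ℕ → Fin m → ℝ≥0) (j : ℕ) :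
    Measurable fun ω => onlineAssign f c p n d ω j := by
  unfold onlineAssign
  split_ifs
  · exact Phase.measurable_assign _ _ j
  · exact measurable_const

theorem layers_ge (p : ℝ) (n : ℕ) : 64 * (p + 1) * max 1 (Real.log n) ≤ layers p n :=
  Nat.le_ceil _

omit [NeZero m] in
theorem Aggregate.phaseData_valid (hf : Aggregate p f) (hn : Nonflat f) (hm : 0 < m) (n : ℕ)
    {k : ℤ} (h0 : f 0 ≤ phaseBound p k) : (phaseData f c p n k).Valid p := by
  have hex := hf.exists_bounds hn (phaseBound_pos p k) h0
  have hu : upperBound f (phaseBound p k) = hex.choose := dif_pos hex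
  obtain ⟨h1, h2, h3⟩ := hex.choose_spec
  rw [← hu] at h1 h2 h3
  refine ⟨hm, hf, h1, h2, h3, phaseBound_pos p k, ?_⟩
  have := hf.one_le
  have hl := layers_ge p n
  have h1 : (1 : ℝ) ≤ max 1 (Real.log n) := le_max_left _ _
  have : (0 : ℝ) < layers p n := lt_of_lt_of_le (by positivity) hl
  exact_mod_cast this

omit [NeZero m] in
theorem le_phaseBound (hp : 1 ≤ p) {d : ℕ → Fin m → ℝ≥0} {j : ℕ}
    (h : 0 < optPrefix f c d (j + 1)) :
    optPrefix f c d (j + 1) ≤ phaseBound p (phaseIndex f c p d j) ∧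
      phaseBound p (phaseIndex f c p d j) ≤ 2 ^ p * optPrefix f c d (j + 1) := by
  have hp0 : 0 < p := by linarith
  set L := Real.logb 2 (optPrefix f c d (j + 1)) with hL
  have e : (2 : ℝ) ^ L = optPrefix f c d (j + 1) :=
    Real.rpow_logb two_pos (by norm_num) h
  have h1 : L ≤ p * phaseIndex f c p d j := by
    have := Int.le_ceil (L / p)
    rw [div_le_iff₀ hp0] at this
    rwa [mul_comm]
  have h2 : p * phaseIndex f c p d j ≤ p + L := by
    have := (Int.ceil_lt_add_one (L / p)).le
    have h3 := mul_le_mul_of_nonneg_left this hp0.le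
    rw [mul_add, mul_div_cancel₀ _ hp0.ne', mul_one, add_comm] at h3
    exact h3
  constructor
  · rw [← e, phaseBound]
    exact Real.rpow_le_rpow_of_exponent_le one_le_two h1
  · rw [← e, phaseBound, ← Real.rpow_add two_pos]
    exact Real.rpow_le_rpow_of_exponent_le one_le_two h2

/-- The competitive ratio of a single phase is the `p`-th power of this number. -/
noncomputable def phaseRatio (m n : ℕ) (p : ℝ) : ℝ :=
  480 * p * (layers p n * (2 + Real.log (4 * (m * (m + 1)))))

/-- All clients of the phase have arrived by its last client `J`, and the optimum up to `J` is at
most the guess; an optimal solution at that moment is the comparison `τ`. -/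
theorem Aggregate.phase_cost_le (hf : Aggregate p f) (hn : Nonflat f) {n : ℕ}
    (d : ℕ → Fin m → ℝ≥0) {k : ℤ}
    (hk : ∃ j < n, 0 < optPrefix f c d (j + 1) ∧ phaseIndex f c p d j = k) :
    ∫ ω, f (activeLoad c (phaseClients f c p d k) n
      ((phaseData f c p n k).assign (phaseClients f c p d k) ω)) ∂seedMeasure
      ≤ phaseRatio m n p ^ p * phaseBound p k := by
  classical
  have hp := hf.one_le
  have hm : 0 < m := Nat.pos_of_ne_zero (NeZero.ne m)
  obtain ⟨j₀, hj₀, h0, hk₀⟩ := hk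
  set A := (Finset.range n).filter fun j => 0 < optPrefix f c d (j + 1) ∧ phaseIndex f c p d j = k
    with hA
  have hAne : A.Nonempty := ⟨j₀, by rw [hA, Finset.mem_filter, Finset.mem_range]; exact ⟨hj₀, h0, hk₀⟩⟩
  set J := A.max' hAne with hJ
  have hJA : J ∈ A := A.max'_mem hAne
  rw [hA, Finset.mem_filter, Finset.mem_range] at hJA
  obtain ⟨hJn, hJ0, hJk⟩ := hJA
  have hB := (le_phaseBound hp hJ0).1
  rw [hJk] at hB
  obtain ⟨τ, hτ⟩ := exists_eq_optPrefix (f := f) (c := c) d (J + 1)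
  have hle : activeLoad c (phaseClients f c p d k) n τ
      ≤ activeLoad c (fun j => some (d j)) (J + 1) τ := by
    refine activeLoad_le_activeLoad c τ fun j hj ha => ?_
    rw [phaseClients] at ha ⊢
    split_ifs at ha ⊢ with h
    · refine ⟨Nat.lt_succ_iff.2 (A.le_max' j ?_), rfl⟩
      rw [hA, Finset.mem_filter, Finset.mem_range]
      exact ⟨hj, h⟩
    · simp at ha
  have hτ' : f (activeLoad c (phaseClients f c p d k) n τ) ≤ phaseBound p k :=
    ((hf.mono _ _ (activeLoad_nonneg _ _ _ _) hle).trans hτ.le).trans hB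
  have hf0 : f 0 ≤ phaseBound p k := (hf.mono _ _ le_rfl (activeLoad_nonneg _ _ _ _)).trans hτ'
  refine (hf.phaseData_valid hn hm n hf0).integral_f_assign_le (by omega) hτ' ?_
  have h1 := layers_ge p n
  have h2 : (p + 1) * Real.log n ≤ (p + 1) * max 1 (Real.log n) := by
    have : 0 ≤ p + 1 := by linarith
    gcongr
    exact le_max_right _ _
  change _ ≤ (layers p n : ℝ) / 64
  linarith

/-- A vanishing optimum gives the client a facility of aggregate cost zero; the cheapest one then
has cost zero too, and only the zero load has it. -/
theorem Aggregate.cheapest_eq_zero (hf : Aggregate p f) (hn : Nonflat f) {d : ℕ → Fin m → ℝ≥0}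
    {j : ℕ} (h : ¬ 0 < optPrefix f c d (j + 1)) :
    c (cheapest f c (d j)) = 0 ∧ d j (cheapest f c (d j)) = 0 := by
  obtain ⟨τ, hτ⟩ := exists_eq_optPrefix (f := f) (c := c) d (j + 1)
  have h1 : f (Pi.single (τ j) ((c (τ j) : ℝ) + d j (τ j))) ≤ 0 := by
    refine (hf.mono _ _ (Pi.single_nonneg.2 (by positivity)) ?_).trans (hτ.le.trans (not_lt.1 h))
    intro i
    by_cases hi : i = τ j
    · subst hi
      rw [Pi.single_eq_same]
      exact le_activeLoad c τ (a := fun j => some (d j)) (Nat.lt_succ_self j) rfl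
    · rw [Pi.single_eq_of_ne hi]
      exact activeLoad_nonneg _ _ _ _ i
  have h2 := hf.eq_zero_of_f_le_zero hn (Pi.single_nonneg.2 (by positivity))
    ((cheapest_le f c (d j) (τ j)).trans h1)
  rw [Pi.single_eq_zero_iff] at h2
  have hc : (0 : ℝ) ≤ c (cheapest f c (d j)) := NNReal.coe_nonneg _
  have hd : (0 : ℝ) ≤ d j (cheapest f c (d j)) := NNReal.coe_nonneg _
  constructor
  · exact NNReal.coe_eq_zero.1 (by linarith)
  · exact NNReal.coe_eq_zero.1 (by linarith)

theorem sum_half_pow_le (I : Finset ℕ) : ∑ k ∈ I, (1 / 2 : ℝ) ^ k ≤ 2 := by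
  refine (Summable.sum_le_tsum I (fun k _ => by positivity) summable_geometric_two).trans ?_
  exact tsum_geometric_two.le

theorem integrable_onlineAssign (n : ℕ) (d : ℕ → Fin m → ℝ≥0) :
    Integrable (fun ω => f (facilityCost c (fun k : Fin n => d k)
      fun k : Fin n => onlineAssign f c p n d ω k)) seedMeasure := by
  have hm : Measurable fun (ω : ℕ → Block) (k : Fin n) => onlineAssign f c p n d ω k :=
    measurable_pi_lambda _ fun k => measurable_onlineAssign n d k
  exact integrable_comp_discrete hm fun g => f (facilityCost c (fun k : Fin n => d k) g)

/-- The guess of phase `κ - i` is `2 ^ (-p * i)` times the last one, whereas `f_sum_le` weighs it by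
`2 ^ ((i + 1) * (p - 1))`; the product decays like `2 ^ (-i)`. All phases share one seed, since only
linearity of expectation is used. -/
theorem Aggregate.integral_onlineAssign_le (hf : Aggregate p f) (hn : Nonflat f) (n : ℕ)
    (d : ℕ → Fin m → ℝ≥0) :
    ∫ ω, f (facilityCost c (fun k : Fin n => d k)
      fun k : Fin n => onlineAssign f c p n d ω k) ∂seedMeasure
      ≤ f 0 + 4 ^ p * phaseRatio m n p ^ p * optPrefix f c d n := by
  classical
  have hp := hf.one_le
  have hp0 : 0 < p := by linarith
  have hopt0 : ∀ n, 0 ≤ optPrefix f c d n := fun n =>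
    (hf.nonneg 0 le_rfl).trans (hf.f_zero_le_optPrefix d n)
  -- The phase of the last client; for `n = 0` the truncated subtraction is harmless because no
  -- phase occurs.
  set κ : ℤ := phaseIndex f c p d (n - 1) with hκ
  have hκmax : ∀ j < n, 0 < optPrefix f c d (j + 1) → phaseIndex f c p d j ≤ κ := by
    intro j hj h0
    refine Int.ceil_le_ceil (div_le_div_of_nonneg_right ?_ hp0.le)
    exact Real.logb_le_logb_of_le one_lt_two h0 (hf.optPrefix_mono d (by omega))
  obtain ⟨N, hN⟩ : ∃ N : ℕ, ∀ j < n, (κ - phaseIndex f c p d j).toNat < N := by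
    refine ⟨(Finset.range n).sup (fun j => (κ - phaseIndex f c p d j).toNat) + 1, fun j hj => ?_⟩
    exact Nat.lt_succ_iff.2 (Finset.le_sup (f := fun j => (κ - phaseIndex f c p d j).toNat)
      (Finset.mem_range.2 hj))
  set I : Finset ℕ := (Finset.range N).filter fun i : ℕ =>
    ∃ j < n, 0 < optPrefix f c d (j + 1) ∧ phaseIndex f c p d j = κ - (i : ℤ) with hI
  set v : ℕ → (ℕ → Block) → Fin m → ℝ := fun i ω =>
    activeLoad c (phaseClients f c p d (κ - i)) n
      ((phaseData f c p n (κ - i)).assign (phaseClients f c p d (κ - i)) ω) with hv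
  have hpt : ∀ ω, f (facilityCost c (fun k : Fin n => d k)
      fun k : Fin n => onlineAssign f c p n d ω k)
      ≤ f 0 + ∑ i ∈ I, (2 : ℝ) ^ ((i + 1) * (p - 1)) * f (v i ω) := by
    intro ω
    refine le_trans ?_ (hf.f_sum_le I (fun i => v i ω) fun i => activeLoad_nonneg _ _ _ _)
    rw [facilityCost_eq_activeLoad c n d fun k => onlineAssign f c p n d ω k]
    refine hf.mono _ _ (activeLoad_nonneg _ _ _ _) ?_
    refine activeLoad_le_sum c I (fun i : ℕ => phaseClients f c p d (κ - i)) _ d n _ fun j hj => ?_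
    by_cases h0 : 0 < optPrefix f c d (j + 1)
    · left
      have hle := hκmax j hj h0
      have e : κ - ((κ - phaseIndex f c p d j).toNat : ℤ) = phaseIndex f c p d j := by
        rw [Int.toNat_of_nonneg (by omega)]; ring
      refine ⟨(κ - phaseIndex f c p d j).toNat, ?_, ?_, ?_⟩
      · rw [hI, Finset.mem_filter, Finset.mem_range]
        exact ⟨hN j hj, j, hj, h0, e.symm⟩
      · rw [e, phaseClients, if_pos ⟨h0, rfl⟩]
      · rw [e, onlineAssign, if_pos h0]
    · right
      rw [onlineAssign, if_neg h0]
      exact hf.cheapest_eq_zero hn h0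
  have hvi : ∀ i, Integrable (fun ω => f (v i ω)) seedMeasure := fun i =>
    Phase.Valid.integrable_f_assign (phaseData f c p n (κ - i)) (phaseClients f c p d (κ - i)) n
  have hsi : Integrable (fun ω => ∑ i ∈ I, (2 : ℝ) ^ (((i : ℝ) + 1) * (p - 1)) * f (v i ω))
      seedMeasure := integrable_finsetSum _ fun i _ => (hvi i).const_mul _
  have hR : 0 ≤ phaseRatio m n p ^ p := by
    refine Real.rpow_nonneg ?_ _
    have hm1 : (1 : ℝ) ≤ m := Nat.one_le_cast.2 (Nat.pos_of_ne_zero (NeZero.ne m))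
    have : 0 ≤ Real.log (4 * (m * (m + 1))) := Real.log_nonneg (by nlinarith)
    rw [phaseRatio]; positivity
  have hterm : ∀ i ∈ I, (2 : ℝ) ^ (((i : ℝ) + 1) * (p - 1)) * ∫ ω, f (v i ω) ∂seedMeasure
      ≤ (2 ^ (p - 1) * phaseRatio m n p ^ p * (2 ^ p * optPrefix f c d n)) * (1 / 2) ^ i := by
    intro i hi
    rw [hI, Finset.mem_filter] at hi
    obtain ⟨j, hj, h0, hji⟩ := hi.2
    have h1 := hf.phase_cost_le hn d ⟨j, hj, h0, hji⟩
    have hn1 : n - 1 + 1 = n := by omega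
    have hpos : 0 < optPrefix f c d (n - 1 + 1) :=
      h0.trans_le (hf.optPrefix_mono d (by omega))
    have h2 := (le_phaseBound hp hpos).2
    rw [hn1, ← hκ] at h2
    have e : (2 : ℝ) ^ (((i : ℝ) + 1) * (p - 1)) * phaseBound p (κ - i)
        = 2 ^ (p - 1) * (1 / 2) ^ i * phaseBound p κ := by
      rw [phaseBound, phaseBound, one_div, inv_pow, ← Real.rpow_natCast,
        ← Real.rpow_neg zero_le_two, ← Real.rpow_add two_pos, ← Real.rpow_add two_pos,
        ← Real.rpow_add two_pos]
      push_cast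
      ring_nf
    calc _ ≤ (2 : ℝ) ^ (((i : ℝ) + 1) * (p - 1)) *
          (phaseRatio m n p ^ p * phaseBound p (κ - i)) :=
          mul_le_mul_of_nonneg_left h1 (by positivity)
      _ = phaseRatio m n p ^ p * ((2 : ℝ) ^ (((i : ℝ) + 1) * (p - 1)) * phaseBound p (κ - i)) := by
          ring
      _ = phaseRatio m n p ^ p * (2 ^ (p - 1) * (1 / 2) ^ i * phaseBound p κ) := by rw [e]
      _ ≤ phaseRatio m n p ^ p * (2 ^ (p - 1) * (1 / 2) ^ i * (2 ^ p * optPrefix f c d n)) := by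
          gcongr
      _ = _ := by ring
  calc ∫ ω, f (facilityCost c (fun k : Fin n => d k)
      fun k : Fin n => onlineAssign f c p n d ω k) ∂seedMeasure
      ≤ ∫ ω, (f 0 + ∑ i ∈ I, (2 : ℝ) ^ (((i : ℝ) + 1) * (p - 1)) * f (v i ω)) ∂seedMeasure :=
        integral_mono (integrable_onlineAssign n d) ((integrable_const _).add hsi) hpt
    _ = f 0 + ∑ i ∈ I, (2 : ℝ) ^ (((i : ℝ) + 1) * (p - 1)) * ∫ ω, f (v i ω) ∂seedMeasure := by
        rw [integral_add (integrable_const _) hsi, integral_const, probReal_univ, one_smul,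
          integral_finsetSum _ fun i _ => (hvi i).const_mul _]
        simp only [integral_const_mul]
    _ ≤ f 0 + (2 ^ (p - 1) * phaseRatio m n p ^ p * (2 ^ p * optPrefix f c d n)) * 2 := by
        refine add_le_add_right ((Finset.sum_le_sum hterm).trans ?_) _
        rw [← Finset.mul_sum]
        have := hopt0 n
        exact mul_le_mul_of_nonneg_left (sum_half_pow_le I) (by positivity)
    _ = _ := by
        have e : (4 : ℝ) ^ p = 2 ^ (p - 1) * 2 ^ p * 2 := by
          rw [show (4 : ℝ) = 2 * 2 by norm_num, Real.mul_rpow zero_le_two zero_le_two,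
            Real.rpow_sub_one two_ne_zero]
          ring
        rw [e]; ring

/-- The online algorithm: the rule sees the costs of the clients that have arrived. -/
noncomputable def onlineAlgorithm (f : (Fin m → ℝ) → ℝ) (c : Fin m → ℝ≥0) (p : ℝ) (n : ℕ) :
    OnlineAlgorithm m n where
  Ω := ℕ → Block
  μ := seedMeasure
  rule ω j h := onlineAssign f c p n (extend h) ω j
  measurable_rule j h := measurable_onlineAssign n (extend h) j

theorem onlineAlgorithm_assignment (n : ℕ) (d : Fin n → Fin m → ℝ≥0) (ω : ℕ → Block) :
    (onlineAlgorithm f c p n).assignment d ω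
      = fun k : Fin n => onlineAssign f c p n (extend d) ω k := by
  ext1 j
  refine onlineAssign_congr n (fun i hi => ?_) ω
  have h1 : i < j + 1 := Nat.lt_succ_iff.2 hi
  have h2 : i < n := h1.trans_le j.2
  simp only [extend, h1, h2, dif_pos]
  rfl

theorem Aggregate.onlineAlgorithm_isCompetitive (hf : Aggregate p f) (hn : Nonflat f) (n : ℕ)
    {ρ : ℝ} (hρ : 1 + 4 ^ p * phaseRatio m n p ^ p ≤ ρ) :
    (onlineAlgorithm f c p n).IsCompetitive f c ρ := by
  intro d
  have hd : (fun k : Fin n => extend d k) = d := by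
    ext1 k; simp [extend]
  have h1 := integrable_onlineAssign (f := f) (c := c) (p := p) n (extend d)
  have h2 := hf.integral_onlineAssign_le (c := c) hn n (extend d)
  have h3 := hf.f_zero_le_optPrefix (c := c) (extend d) n
  have h4 : optPrefix f c (extend d) n = opt f c d := by rw [optPrefix, hd]
  rw [hd] at h1 h2
  have e : (fun ω => f (facilityCost c d ((onlineAlgorithm f c p n).assignment d ω)))
      = fun ω : ℕ → Block => f (facilityCost c d
        fun k : Fin n => onlineAssign f c p n (extend d) ω k) :=
    funext fun ω => congrArg (fun σ => f (facilityCost c d σ)) (onlineAlgorithm_assignment n d ω)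
  refine ⟨e ▸ h1, (congrArg (fun g => ∫ ω, g ω ∂seedMeasure) e).trans_le (h2.trans ?_)⟩
  rw [h4] at h3 ⊢
  have h5 : 0 ≤ opt f c d := (hf.nonneg 0 le_rfl).trans h3
  nlinarith [mul_le_mul_of_nonneg_right hρ h5]

/-- If a facility never increases the aggregate cost, use it for all clients. -/
theorem Aggregate.exists_isCompetitive_of_flat (hf : Aggregate p f) (hn : ¬ Nonflat f) (n : ℕ)
    {ρ : ℝ} (hρ : 1 ≤ ρ) : ∃ A : OnlineAlgorithm m n, A.IsCompetitive f c ρ := by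
  simp only [Nonflat, not_forall, not_exists, not_and, not_lt] at hn
  obtain ⟨i, hi⟩ := hn
  obtain ⟨A, hA⟩ : ∃ A : OnlineAlgorithm m n, ∀ d ω, A.assignment d ω = fun _ => i :=
    ⟨{ Ω := Unit, μ := Measure.dirac (), rule := fun _ _ _ => i,
       measurable_rule := fun _ _ => measurable_const }, fun _ _ => rfl⟩
  refine ⟨A, fun d => ?_⟩
  simp only [hA]
  refine ⟨integrable_const _, ?_⟩
  rw [integral_const, probReal_univ, one_smul]
  have hd : (fun k : Fin n => extend d k) = d := by
    ext1 k; simp [extend]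
  have h0 : f 0 ≤ opt f c d := by
    have := hf.f_zero_le_optPrefix (c := c) (extend d) n
    rwa [optPrefix, hd] at this
  have hopt : 0 ≤ opt f c d := (hf.nonneg 0 le_rfl).trans h0
  have hcost := activeLoad_nonneg c (fun j => some (extend d j)) n (fun _ => i)
  have e := facilityCost_eq_activeLoad c n (extend d) (fun _ => i)
  rw [hd] at e
  have hs : facilityCost c d (fun _ => i) = Pi.single i (facilityCost c d (fun _ => i) i) := by
    ext i'
    by_cases h : i' = i
    · subst h; simp
    · rw [Pi.single_eq_of_ne h]
      simp [facilityCost, Ne.symm h]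
  have h1 : f (facilityCost c d (fun _ => i)) ≤ f 0 := by
    rw [hs]
    refine hi _ ?_
    rw [e]
    exact hcost i
  nlinarith

end

/-! ### Constants and conclusion -/

theorem log_size_le (m : ℕ) (hm : 0 < m) :
    2 + Real.log (4 * (m * (m + 1))) ≤ 7 * max 1 (Real.log m) := by
  have hm1 : (1 : ℝ) ≤ m := Nat.one_le_cast.2 hm
  have hm0 : (0 : ℝ) < m := by linarith
  have h1 : Real.log (4 * (m * (m + 1))) ≤ Real.log (2 ^ 3 * (m * m)) :=
    Real.log_le_log (by positivity) (by nlinarith)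
  have e : Real.log (2 ^ 3 * (m * m)) = 3 * Real.log 2 + (Real.log m + Real.log m) := by
    rw [Real.log_mul (by norm_num) (by positivity), Real.log_mul hm0.ne' hm0.ne', Real.log_pow]
    norm_num
  rw [e] at h1
  have h2 := Real.log_two_lt_d9
  have h3 : 1 ≤ max 1 (Real.log m) := le_max_left _ _
  have h4 : Real.log m ≤ max 1 (Real.log m) := le_max_right _ _
  linarith

theorem phaseRatio_le (m n : ℕ) (hm : 0 < m) {p : ℝ} (hp : 1 ≤ p) :
    1 ≤ phaseRatio m n p ∧
      phaseRatio m n p ≤ 480 * 903 * p ^ 2 * max 1 (Real.log m) * max 1 (Real.log n) := by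
  set M := max 1 (Real.log m) with hM
  set N := max 1 (Real.log n) with hN
  have hM1 : 1 ≤ M := le_max_left _ _
  have hN1 : 1 ≤ N := le_max_left _ _
  have hl1 := layers_ge p n
  rw [← hN] at hl1
  -- Here `64 * (p + 1) * N + 1 ≤ 129 * p * N`; with the `7` of `log_size_le` this gives `903 = 129
  -- * 7`.
  have hl2 : (layers p n : ℝ) ≤ 129 * p * N := by
    have := (Nat.ceil_lt_add_one (show 0 ≤ 64 * (p + 1) * N by positivity)).le
    change (layers p n : ℝ) ≤ _ at this
    nlinarith
  have hlog := log_size_le m hm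
  have hlog0 : 0 ≤ Real.log (4 * (m * (m + 1))) := by
    have : (1 : ℝ) ≤ m := Nat.one_le_cast.2 hm
    exact Real.log_nonneg (by nlinarith)
  constructor
  · have h1 : 1 ≤ (layers p n : ℝ) := by nlinarith
    have h2 : 1 ≤ (layers p n : ℝ) * (2 + Real.log (4 * (m * (m + 1)))) := by nlinarith
    rw [phaseRatio]
    nlinarith
  · calc phaseRatio m n p ≤ 480 * p * (129 * p * N * (7 * M)) := by
          rw [phaseRatio]; gcongr
      _ = _ := by ring

end OnlineFL

theorem theorem3 :
    ∃ C : ℝ, 0 < C ∧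
      ∀ (m n : ℕ) (p : ℝ) (f : (Fin m → ℝ) → ℝ) (c : Fin m → ℝ≥0),
        0 < m → OnlineFL.PBounded p f →
          ∃ A : OnlineFL.OnlineAlgorithm m n,
            A.IsCompetitive f c
              ((C * p ^ 2 * (max 1 (Real.log m)) ^ 2 * max 1 (Real.log n)
                * max 1 (Real.log (Real.log n))) ^ p) := by
  -- The `8` is `2 * 4`: the `4` comes from summing the phases, the `2` absorbs the summand `1` for
  -- `f 0`.
  refine ⟨8 * (480 * 903), by norm_num, fun m n p f c hm hpf => ?_⟩
  have hf := hpf.aggregate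
  have hp := hf.one_le
  have : NeZero m := ⟨hm.ne'⟩
  obtain ⟨h1, h2⟩ := OnlineFL.phaseRatio_le m n hm hp
  set M := max 1 (Real.log m)
  set N := max 1 (Real.log n)
  set N' := max 1 (Real.log (Real.log n))
  have hM1 : 1 ≤ M := le_max_left _ _
  have hN1 : 1 ≤ N := le_max_left _ _
  have hN'1 : 1 ≤ N' := le_max_left _ _
  have hX : 8 * OnlineFL.phaseRatio m n p ≤ 8 * (480 * 903) * p ^ 2 * M ^ 2 * N * N' := by
    calc _ ≤ 8 * (480 * 903 * p ^ 2 * M * N) := by gcongr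
      -- The slack factors `M` and `N'` are given away here.
      _ ≤ 8 * (480 * 903 * p ^ 2 * M * N) * (M * N') :=
        le_mul_of_one_le_right (by positivity) (one_le_mul_of_one_le_of_one_le hM1 hN'1)
      _ = _ := by ring
  have hR0 : 0 ≤ OnlineFL.phaseRatio m n p := by linarith
  have hρ : 1 + 4 ^ p * OnlineFL.phaseRatio m n p ^ p
      ≤ (8 * (480 * 903) * p ^ 2 * M ^ 2 * N * N') ^ p := by
    refine le_trans ?_ (Real.rpow_le_rpow (by positivity) hX (by linarith))
    rw [show (8 : ℝ) * OnlineFL.phaseRatio m n p = 2 * (4 * OnlineFL.phaseRatio m n p) by ring,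
      Real.mul_rpow (by norm_num) (by positivity), ← Real.mul_rpow (by norm_num) hR0]
    have h3 : (2 : ℝ) ≤ 2 ^ p := Real.self_le_rpow_of_one_le one_le_two hp
    have h4 : 1 ≤ (4 * OnlineFL.phaseRatio m n p) ^ p :=
      Real.one_le_rpow (by linarith) (by linarith)
    nlinarith
  by_cases hn : OnlineFL.Nonflat f
  · exact ⟨OnlineFL.onlineAlgorithm f c p n, hf.onlineAlgorithm_isCompetitive hn n hρ⟩
  · refine hf.exists_isCompetitive_of_flat hn n (le_trans ?_ hρ)
    exact le_add_of_nonneg_right (by positivity)
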